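/- Let $d,k\ge 1$ be integers. For a simplex $K\subset\mathbb R^d$ the shape regularity constant is $h_K/\rho_K$, where $h_K$ is the diameter of $K$ and $\rho_K$ is the diameter of the largest ball contained in $K$. Let $\Omega\subset\mathbb R^d$ be a polytope domain and let $\mathcal T_h$ be a (finite) conforming simplicial triangulation of $\Omega$. For each $d$-simplex $K\in\mathcal T_h$ choose a point $x_K$ in the interior of $K$, and let $\mathcal T_h^r$ be the refinement that subdivides each $K$ into the $d+1$ simplices whose vertices are $x_K$ and all but one of the vertices of $K$. For $\mathcal S\in\{\mathcal T_h,\mathcal T_h^r\}$ let $$\mathring{\mathcal P}_m(\mathcal S)=\Big\{q\in L^2(\Omega):\ \int_\Omega q=0,\ q|_K\in\mathcal P_m(K)\ \ \forall K\in\mathcal S\Big\},\qquad \mathring{\boldsymbol{\mathcal P}}{}^c_m(\mathcal S)=\{v\in H^1_0(\Omega)^d:\ v|_K\in\mathcal P_m(K)^d\ \ \forall K\in\mathcal S\},$$ where $\mathcal P_m(K)$ is the space of polynomials of total degree at most $m$ on $K$. For a linear subspace $V_h\subset H^1_0(\Omega)^d$ and a space $M_h\subset\{q\in L^2(\Omega):\int_\Omega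 q=0\}$, say that the pair $V_h-M_h$ is inf-sup stable with constant $\gamma>0$ if $$\gamma\ \le\ \inf_{0\ne q\in M_h}\ \sup_{0\neq v\in V_h}\frac{\int_\Omega q\,\operatorname{div}v}{\|v\|_{H^1(\Omega)}\,\|q\|_{L^2(\Omega)}}.$$ Suppose that $\mathring{\boldsymbol{\mathcal P}}{}^c_k(\mathcal T_h^r)\subset V_h\subset H^1_0(\Omega)^d$ and that $V_h-\mathring{\mathcal P}_0(\mathcal T_h)$ is inf-sup stable with constant $\gamma_0>0$. Then $V_h-\mathring{\mathcal P}_{k-1}(\mathcal T_h^r)$ is inf-sup stable with a constant $\gamma>0$ that depends only on $d$, $k$, $\gamma_0$, an upper bound for the diameter of $\Omega$, and an upper bound for the shape regularity constants of the simplices of $\mathcal T_h^r$. In particular, along a family $\{\mathcal T_h\}$ of triangulations of a fixed $\Omega$ for which $\{\mathcal T_h^r\}$ is shape regular, inf-sup stability of $V_h-\mathring{\mathcal P}_0(\mathcal T_h)$ uniformly in $h$ implies inf-sup stability of $V_h-\mathring{\mathcal P}_{k-1}(\mathcal T_h^r)$ uniformly in $h$. -/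

import Mathlib

open MeasureTheory TopologicalSpace
open scoped ENNReal Distributions

noncomputable section

namespace StokesFEM

/-- `ℝᵈ` with its Euclidean norm. -/
abbrev Space (d : ℕ) : Type := EuclideanSpace ℝ (Fin d)

variable {d : ℕ}

/-- The Hilbert space `L²(Ω)` of real-valued functions (classes modulo a.e. equality). -/
abbrev L2 (Ω : Opens (Space d)) : Type :=
  Lp ℝ 2 ((volume : Measure (Space d)).restrict (Ω : Set (Space d)))

/-- `L²(Ω)ᵈ`, the vector fields with components in `L²(Ω)`. -/
abbrev L2Vec (Ω : Opens (Space d)) : Type := Fin d → L2 Ω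

/-! ### Sobolev spaces -/

/-- The classical partial derivative `∂φ/∂xᵢ`. -/
def classicalPartial (i : Fin d) (φ : Space d → ℝ) (x : Space d) : ℝ :=
  fderiv ℝ φ x (EuclideanSpace.single i 1)

/-- `g` is the weak partial derivative `∂ᵢu` on `Ω`:
`∫_Ω u ∂ᵢφ = - ∫_Ω g φ` for every smooth `φ` with compact support in `Ω`. -/
def IsWeakPartial {Ω : Opens (Space d)} (i : Fin d) (u g : L2 Ω) : Prop :=
  ∀ φ : 𝓓(Ω, ℝ),
    ∫ x in (Ω : Set (Space d)), u x * classicalPartial i φ x =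
      - ∫ x in (Ω : Set (Space d)), g x * φ x

/-- Weak partial derivatives are unique. -/
theorem IsWeakPartial.unique {Ω : Opens (Space d)} {i : Fin d} {u g g' : L2 Ω}
    (h : IsWeakPartial i u g) (h' : IsWeakPartial i u g') : g = g' := by
  have hloc : ∀ f : L2 Ω, LocallyIntegrableOn (f : Space d → ℝ) (Ω : Set (Space d)) volume := by
    intro f
    have h1 := (Lp.memLp f).locallyIntegrable (by norm_num)
    rw [locallyIntegrableOn_iff Ω.isOpen.isLocallyClosed]
    intro K hK hKc
    have h2 := h1.integrableOn_isCompact hKc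
    rwa [IntegrableOn, Measure.restrict_restrict hKc.measurableSet,
      Set.inter_eq_left.2 hK] at h2
  have key := Ω.isOpen.ae_eq_zero_of_integral_contDiff_smul_eq_zero
    (f := fun x => (g - g' : L2 Ω) x) (μ := volume) (hloc _) (by
      intro φ hφ hc hs
      let ψ : 𝓓(Ω, ℝ) := ⟨φ, hφ, hc, hs⟩
      have e : ∫ x in (Ω : Set (Space d)), g x * φ x =
          ∫ x in (Ω : Set (Space d)), g' x * φ x := by
        have a := h ψ
        have b := h' ψ
        have : - ∫ x in (Ω : Set (Space d)), g x * ψ x =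
          - ∫ x in (Ω : Set (Space d)), g' x * ψ x := a.symm.trans b
        exact neg_injective this
      have mφ : MemLp φ 2 (volume.restrict (Ω : Set (Space d))) :=
        (hφ.continuous.memLp_of_hasCompactSupport hc).restrict _
      have i1 : Integrable (fun x => g x * φ x) (volume.restrict (Ω : Set (Space d))) :=
        (Lp.memLp g).integrable_mul mφ
      have i2 : Integrable (fun x => g' x * φ x) (volume.restrict (Ω : Set (Space d))) :=
        (Lp.memLp g').integrable_mul mφ
      have e2 : ∫ x, φ x • (g - g' : L2 Ω) x =
          ∫ x in (Ω : Set (Space d)), φ x • (g - g' : L2 Ω) x := by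
        symm
        apply setIntegral_eq_integral_of_forall_compl_eq_zero
        intro x hx
        have : φ x = 0 := by
          by_contra hne
          exact hx (hs (subset_tsupport _ hne))
        simp [this]
      rw [e2]
      have e3 : ∫ x in (Ω : Set (Space d)), φ x • (g - g' : L2 Ω) x =
          ∫ x in (Ω : Set (Space d)), (g x * φ x - g' x * φ x) := by
        apply integral_congr_ae
        filter_upwards [Lp.coeFn_sub g g'] with x hx
        rw [hx, Pi.sub_apply, smul_eq_mul]
        ring
      rw [e3, integral_sub i1 i2, e, sub_self])
  rw [← sub_eq_zero]
  apply Lp.ext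
  have key2 : ∀ᵐ x ∂(volume.restrict (Ω : Set (Space d))), (g - g' : L2 Ω) x = 0 :=
    (ae_restrict_iff' Ω.isOpen.measurableSet).2 key
  filter_upwards [key2, Lp.coeFn_zero ℝ 2 (volume.restrict (Ω : Set (Space d)))] with x h1 h2
  rw [h1, h2, Pi.zero_apply]

/-- `H¹(Ω)`: all weak first-order partial derivatives exist in `L²(Ω)`. -/
def H1 (Ω : Opens (Space d)) : Set (L2 Ω) :=
  {u | ∀ i, ∃ g, IsWeakPartial i u g}

open Classical in
/-- The weak partial derivative `∂ᵢu`; it is unique, and it is used only where it exists. -/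
def weakPartial {Ω : Opens (Space d)} (i : Fin d) (u : L2 Ω) : L2 Ω :=
  if h : ∃ g, IsWeakPartial i u g then h.choose else 0

/-- `H¹₀(Ω)`: the closure of the smooth functions with compact support in `Ω` with respect to
the `H¹(Ω)`-norm. -/
def H10 (Ω : Opens (Space d)) : Set (L2 Ω) :=
  {u | u ∈ H1 Ω ∧ ∀ ε : ℝ≥0∞, 0 < ε → ∃ φ : 𝓓(Ω, ℝ),
    eLpNorm (fun x => u x - φ x) 2 (volume.restrict (Ω : Set (Space d))) ≤ ε ∧
    ∀ i, eLpNorm (fun x => weakPartial i u x - classicalPartial i φ x) 2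
      (volume.restrict (Ω : Set (Space d))) ≤ ε}

/-- The space `H¹₀(Ω)ᵈ` of vector fields. -/
def H10Vec (Ω : Opens (Space d)) : Set (L2Vec Ω) :=
  {v | ∀ i, v i ∈ H10 Ω}

/-- The `H¹(Ω)`-norm of a vector field:
`‖v‖² = ∑ᵢ ‖vᵢ‖²_{L²} + ∑ᵢ ∑ⱼ ‖∂ⱼvᵢ‖²_{L²}`. -/
def h1Norm {Ω : Opens (Space d)} (v : L2Vec Ω) : ℝ :=
  √(∑ i, (‖v i‖ ^ 2 + ∑ j, ‖weakPartial j (v i)‖ ^ 2))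

/-- The divergence `div v = ∑ᵢ ∂ᵢvᵢ` (with weak derivatives). -/
def divergence {Ω : Opens (Space d)} (v : L2Vec Ω) : L2 Ω :=
  ∑ i, weakPartial i (v i)

/-! ### Inf-sup stability -/

/-- The inf-sup constant
`inf_{0 ≠ q ∈ M} sup_{0 ≠ v ∈ V} (∫_Ω q div v) / (‖v‖_{H¹(Ω)} ‖q‖_{L²(Ω)})`, as an extended
real number: the infimum over the empty set is `∞` and the supremum over it is `-∞`. -/
def infSupConst {Ω : Opens (Space d)} (V : Set (L2Vec Ω)) (M : Set (L2 Ω)) : EReal :=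
  ⨅ q ∈ M \ {0}, ⨆ v ∈ V \ {0},
    (((∫ x in (Ω : Set (Space d)), q x * divergence v x) / (h1Norm v * ‖q‖) : ℝ) : EReal)

/-- The pair `V - M` is inf-sup stable with constant `γ > 0`. -/
def InfSupStableWith {Ω : Opens (Space d)} (γ : ℝ) (V : Set (L2Vec Ω)) (M : Set (L2 Ω)) : Prop :=
  0 < γ ∧ (γ : EReal) ≤ infSupConst V M

/-! ### Triangulations; a simplex is given by the finite set of its vertices -/

/-- `T` is a conforming simplicial triangulation of the polytope `Ω`: a finite simplicial complex
in which every maximal simplex is `d`-dimensional, the simplices fill the closure of `Ω`, and the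
open `d`-simplices lie in `Ω`. Any two simplices of a simplicial complex meet in a common face. -/
structure IsTriangulation (T : Geometry.SimplicialComplex ℝ (Space d))
    (Ω : Opens (Space d)) : Prop where
  finite : T.faces.Finite
  pure : ∀ K ∈ T.facets, K.card = d + 1
  space_eq : T.space = closure (Ω : Set (Space d))
  interior_subset : ∀ K ∈ T.facets,
    interior (convexHull ℝ (K : Set (Space d))) ⊆ (Ω : Set (Space d))

open Classical in
/-- The cells of the refined triangulation: each cell `K` is divided into the `d + 1` simplices
obtained by replacing one of its vertices by the point `xK K`. -/
def refinedCells (T : Geometry.SimplicialComplex ℝ (Space d)) (xK : Finset (Space d) → Space d) :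
    Set (Finset (Space d)) :=
  {S | ∃ K ∈ T.facets, ∃ a ∈ K, S = insert (xK K) (K.erase a)}

/-- The diameter of the largest ball inscribed in the simplex with vertex set `K`. -/
def inscribedDiam (K : Finset (Space d)) : ℝ :=
  sSup {δ | ∃ (c : Space d) (r : ℝ), 0 ≤ r ∧ δ = 2 * r ∧
    Metric.closedBall c r ⊆ convexHull ℝ (K : Set (Space d))}

/-- The shape regularity constant `h_K / ρ_K` of the simplex with vertex set `K`. -/
def shapeConst (K : Finset (Space d)) : ℝ :=
  Metric.diam (convexHull ℝ (K : Set (Space d))) / inscribedDiam K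

/-! ### Piecewise polynomial spaces on a set `S` of cells -/

/-- `q|_K ∈ P_k(K)`: on the simplex with vertex set `K`, `q` agrees almost everywhere with a
polynomial of total degree at most `k`. -/
def IsPolyOn {Ω : Opens (Space d)} (k : ℕ) (K : Finset (Space d)) (q : L2 Ω) : Prop :=
  ∃ p : MvPolynomial (Fin d) ℝ, p.totalDegree ≤ k ∧
    ∀ᵐ x ∂(volume.restrict (Ω : Set (Space d))),
      x ∈ convexHull ℝ (K : Set (Space d)) → q x = MvPolynomial.eval (fun i => x i) p

/-- The mean-zero functions `q ∈ L²₀(Ω)` with `q|_K ∈ P_k(K)` for all `K ∈ S`. -/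
def pressureSpace (Ω : Opens (Space d)) (k : ℕ) (S : Set (Finset (Space d))) : Set (L2 Ω) :=
  {q | ∫ x in (Ω : Set (Space d)), q x = 0 ∧ ∀ K ∈ S, IsPolyOn k K q}

/-- The vector fields `v ∈ H¹₀(Ω)ᵈ` with `v|_K ∈ P_k(K)ᵈ` for all `K ∈ S`. -/
def velocitySpace (Ω : Opens (Space d)) (k : ℕ) (S : Set (Finset (Space d))) : Set (L2Vec Ω) :=
  {v | v ∈ H10Vec Ω ∧ ∀ K ∈ S, ∀ i, IsPolyOn k K (v i)}

end StokesFEM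

end

/-! The pressure is split into means and fluctuations. For a pressure `q` on the refined mesh, let
`w` be its mean over each simplex `K` of the coarse mesh. Then `w` and `q - w` are orthogonal in
`L²`, `w` is a coarse pressure handled by the assumed stability, and `q - w` has mean zero on every
`K`. The main point is that `q - w` is exactly the divergence of a field in the velocity space that
vanishes on the boundary of every `K`, with `H¹`-norm at most a constant times `‖q - w‖`. Testing
with this field if `q - w` is a substantial part of `q`, and otherwise with a nearly optimal field
for `w`, gives the result (`InfSupStableWith.of_orthogonal_decomposition`).

The local inversion of the divergence (`exists_isLocalDiv`) is algebraic. Let `M` be the continuous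
piecewise affine function that is `1` at the split point `x` and `0` on the boundary of the simplex,
and let `N_z` be the one that is `1` at the vertex `z` and `0` at `x` and at the other vertices. On
each cell these are the barycentric coordinates, and `N_z` vanishes on the cell opposite to `z`. The
field `M ^ (j + 1) * ∏ N_{z_s}` times a constant vector `t` is continuous, vanishes on the boundary,
and its divergence is its derivative along `t`. For `t` joining two vertices `z` and `a`, the slope
of `M` along `t` is nonzero only on the cells opposite to `a` and to `z` (`hatPiece_linear_sub`). If
`N_z` is one of the factors, the cell opposite to `z` drops out too. Hence `M ^ j * ∏ N_{z_s}`,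
restricted to one cell, equals a divergence plus terms with one more factor `M` and one factor `N`
fewer. Iterating leaves only `M ^ n` on single cells, and a last bubble moves all of these to one
fixed cell. So every piecewise polynomial of degree at most `n` is a divergence plus a multiple of
one nonnegative function of positive integral. Divergences of such fields have mean zero, so for
mean-zero data the multiple is zero (`IsLocalDivMod.isLocalDiv`). That multiple therefore never
needs an estimate.

The constants are uniform because each bubble is scaled by a barycentric coordinate of `x`, which
cancels the slope of `M` without dividing by a small number, and because the other slopes are
bounded through balls inscribed in the cells (`RegularSplit.slope`). For `d ≥ 2`, shape regularity
of the cells bounds the diameter of the whole simplex by the inradius of each cell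
(`regularSplit_of_cells`). For `d = 1` the divergence is the full gradient and no such bound is
needed.

The analytic input is that a Lipschitz function vanishing outside a bounded open `Ω` lies in
`H¹₀(Ω)`, without any boundary regularity (`mem_H10_of_lipschitz`), and satisfies a Poincaré
inequality (`integral_sq_le_of_lipschitz`). -/

noncomputable section

namespace StokesFEM

variable {d : ℕ}

open Filter Topology Metric
open scoped NNReal Convolution

/-! ### Mollification -/

/-- Bounded almost-everywhere convergence on a set of finite measure implies `L²`-convergence. -/
theorem tendsto_eLpNorm_two_of_bounded {α : Type*} [MeasurableSpace α] {μ : Measure α}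
    {F : ℕ → α → ℝ} {f : α → ℝ} {S : Set α} {C : ℝ} (hS : MeasurableSet S) (hμ : μ S ≠ ∞)
    (hF : ∀ n, Measurable (F n)) (hf : Measurable f)
    (hb : ∀ᶠ n in atTop, ∀ x, |f x - F n x| ≤ C) (h0 : ∀ᶠ n in atTop, ∀ x ∉ S, f x - F n x = 0)
    (hlim : ∀ᵐ x ∂μ, Tendsto (fun n => F n x) atTop (𝓝 (f x))) :
    Tendsto (fun n => eLpNorm (fun x => f x - F n x) 2 μ) atTop (𝓝 0) := by
  have h2 : Tendsto (fun n => ∫⁻ x, ‖f x - F n x‖ₑ ^ (2 : ℝ) ∂μ) atTop (𝓝 (∫⁻ x, 0 ∂μ)) := by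
    refine tendsto_lintegral_filter_of_dominated_convergence
      (S.indicator fun _ => ENNReal.ofReal C ^ (2 : ℝ)) ?_ ?_ ?_ ?_
    · exact Eventually.of_forall fun n => (hf.sub (hF n)).enorm.pow_const _
    · filter_upwards [hb, h0] with n hn hn'
      refine Eventually.of_forall fun x => ?_
      by_cases hx : x ∈ S
      · rw [Set.indicator_of_mem hx]
        gcongr
        rw [Real.enorm_eq_ofReal_abs]
        exact ENNReal.ofReal_le_ofReal (hn x)
      · simp [hn' x hx]
    · rw [lintegral_indicator_const hS]
      exact ENNReal.mul_ne_top (by finiteness) hμ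
    · filter_upwards [hlim] with x hx
      have h1 : Tendsto (fun n => f x - F n x) atTop (𝓝 0) := by
        simpa using (tendsto_const_nhds (x := f x)).sub hx
      have := (ENNReal.continuous_rpow_const (y := (2 : ℝ))).tendsto _ |>.comp h1.enorm
      simpa [Function.comp_def] using this
  have h3 := (ENNReal.continuous_rpow_const (y := (1 / 2 : ℝ))).tendsto _ |>.comp h2
  simp only [lintegral_zero, ENNReal.zero_rpow_of_pos (show (0 : ℝ) < 1 / 2 by norm_num)] at h3
  refine h3.congr fun n => ?_
  rw [eLpNorm_eq_lintegral_rpow_enorm_toReal (by norm_num) (by norm_num)]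
  simp

/-- A sequence of bump functions shrinking to the origin. -/
def shrinkingBump (d n : ℕ) : ContDiffBump (0 : Space d) where
  rIn := 1 / (n + 1)
  rOut := 2 / (n + 1)
  rIn_pos := by positivity
  rIn_lt_rOut := by gcongr; norm_num

/-- The mollification of `f` at scale `1 / (n + 1)`. -/
def mollify (n : ℕ) (f : Space d → ℝ) : Space d → ℝ :=
  ((shrinkingBump d n).normed volume ⋆[ContinuousLinearMap.lsmul ℝ ℝ, volume] f)

theorem tendsto_rOut_shrinkingBump :
    Tendsto (fun n => (shrinkingBump d n).rOut) atTop (𝓝 0) := by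
  have := (tendsto_one_div_add_atTop_nhds_zero_nat (𝕜 := ℝ)).const_mul 2
  simpa [shrinkingBump, div_eq_mul_inv] using this

theorem mollify_contDiff (n : ℕ) {f : Space d → ℝ} (hf : LocallyIntegrable f volume)
    (m : ℕ∞) : ContDiff ℝ m (mollify n f) :=
  (shrinkingBump d n).hasCompactSupport_normed.contDiff_convolution_left _
    (shrinkingBump d n).contDiff_normed hf

theorem tsupport_mollify_subset (n : ℕ) {f : Space d → ℝ} :
    tsupport (mollify n f) ⊆ cthickening (shrinkingBump d n).rOut (tsupport f) := by
  refine closure_minimal ?_ isClosed_cthickening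
  refine (support_convolution_subset _).trans ?_
  rintro _ ⟨x, hx, y, hy, rfl⟩
  rw [(shrinkingBump d n).support_normed_eq] at hx
  refine mem_cthickening_of_dist_le _ y _ _ (subset_tsupport _ hy) ?_
  simp only [mem_ball, dist_zero_right] at hx
  simpa [dist_eq_norm] using hx.le

theorem abs_mollify_le (n : ℕ) {f : Space d → ℝ} {C : ℝ} (hfC : ∀ x, |f x| ≤ C) (x : Space d) :
    |mollify n f x| ≤ C := by
  have hi : Integrable (fun t => (shrinkingBump d n).normed volume t * C) volume :=
    ((shrinkingBump d n).integrable_normed).mul_const C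
  have : ‖mollify n f x‖ ≤ ∫ t, (shrinkingBump d n).normed volume t * C := by
    refine norm_integral_le_of_norm_le hi (Eventually.of_forall fun t => ?_)
    simp only [ContinuousLinearMap.lsmul_apply, smul_eq_mul, norm_mul]
    rw [Real.norm_of_nonneg ((shrinkingBump d n).nonneg_normed t)]
    gcongr
    · exact (shrinkingBump d n).nonneg_normed t
    · exact hfC _
  rwa [integral_mul_const, (shrinkingBump d n).integral_normed, one_mul] at this

/-- Lebesgue differentiation applies because the outer radius of each bump is exactly twice the
inner one. Convergence almost everywhere without continuity of `f` is needed, since `f` will also be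
a line derivative of a Lipschitz function. -/
theorem ae_tendsto_mollify {f : Space d → ℝ} (hf : LocallyIntegrable f volume) :
    ∀ᵐ x, Tendsto (fun n => mollify n f x) atTop (𝓝 (f x)) := by
  refine ContDiffBump.ae_convolution_tendsto_right_of_locallyIntegrable (K := 2)
    tendsto_rOut_shrinkingBump (Eventually.of_forall fun n => ?_) hf
  simp only [shrinkingBump]
  apply le_of_eq; ring

/-- Mollification commutes with differentiation of Lipschitz functions. -/
theorem fderiv_mollify (n : ℕ) {f : Space d → ℝ} {C : ℝ≥0} (hf : LipschitzWith C f)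
    (x e : Space d) :
    fderiv ℝ (mollify n f) x e = mollify n (fun y => lineDeriv ℝ f y e) x := by
  set b := (shrinkingBump d n).normed volume with hb
  have hbc : HasCompactSupport b := (shrinkingBump d n).hasCompactSupport_normed
  have hb1 : ContDiff ℝ 1 b := (shrinkingBump d n).contDiff_normed
  have hloc : LocallyIntegrable f volume := hf.continuous.locallyIntegrable
  have h := hbc.hasFDerivAt_convolution_left (ContinuousLinearMap.lsmul ℝ ℝ) hb1 hloc x
  have h1 : fderiv ℝ (mollify n f) x e = ∫ t, fderiv ℝ b t e * f (x - t) := by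
    rw [show mollify n f = (b ⋆[ContinuousLinearMap.lsmul ℝ ℝ, volume] f) from rfl, h.fderiv]
    rw [convolution_def, ContinuousLinearMap.integral_apply]
    · rfl
    · have := (hbc.fderiv ℝ).convolutionExists_left
        ((ContinuousLinearMap.lsmul ℝ ℝ).precompL (Space d) : _)
        (hb1.continuous_fderiv one_ne_zero) hloc x
      exact this
  have hf' : LipschitzWith C (fun t => f (x - t)) := by
    refine LipschitzWith.of_dist_le_mul fun s t => ?_
    rw [← dist_sub_left x s t]
    exact hf.dist_le_mul (x - s) (x - t)
  obtain ⟨D, hD⟩ := ContDiff.lipschitzWith_of_hasCompactSupport hbc hb1 one_ne_zero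
  -- Integration by parts moves the derivative from the bump to `t ↦ f (x - t)`; the reflection
  -- accounts for the direction `-e`.
  have h2 := LipschitzWith.integral_lineDeriv_mul_eq (μ := volume) hf' hD hbc (-e)
  rw [h1]
  have h3 : ∀ t, fderiv ℝ b t e = lineDeriv ℝ b t e := fun t =>
    ((hb1.differentiable one_ne_zero).differentiableAt.lineDeriv_eq_fderiv).symm
  simp_rw [h3]
  rw [neg_neg] at h2
  rw [← h2]
  simp only [mollify, convolution_def, ContinuousLinearMap.lsmul_apply, smul_eq_mul]
  congr 1; ext t
  rw [mul_comm, ← hb]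
  congr 1
  simp only [lineDeriv]
  have : (fun s : ℝ => f (x - (t + s • -e))) = fun s : ℝ => f (x - t + s • e) := by
    ext s; congr 1; simp; abel
  rw [this]

theorem lineDeriv_eq_zero_of_notMem_tsupport {f : Space d → ℝ} {x : Space d}
    (hx : x ∉ tsupport f) (e : Space d) : lineDeriv ℝ f x e = 0 := by
  have h : f =ᶠ[𝓝 x] 0 := notMem_tsupport_iff_eventuallyEq.1 hx
  rw [h.lineDeriv_eq]
  simp [lineDeriv]

/-- A Lipschitz function with compact support in `Ω` is approximated in `H¹` by test functions. -/
theorem exists_testFunction_near {Ω : Opens (Space d)} {f : Space d → ℝ} {C : ℝ≥0}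
    (hf : LipschitzWith C f) (hc : HasCompactSupport f) (hs : tsupport f ⊆ Ω)
    {ε : ℝ≥0∞} (hε : 0 < ε) :
    ∃ φ : 𝓓(Ω, ℝ), eLpNorm (fun x => f x - φ x) 2 volume ≤ ε ∧
      ∀ i, eLpNorm (fun x => lineDeriv ℝ f x (EuclideanSpace.single i 1) - classicalPartial i φ x)
        2 volume ≤ ε := by
  -- There is room `δ` around the support, so mollification at scales below `δ` stays inside `Ω`.
  obtain ⟨δ, hδ, hδΩ⟩ := hc.isCompact.exists_cthickening_subset_open Ω.isOpen hs
  set S := cthickening δ (tsupport f) with hSdef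
  have hScomp : IsCompact S := hc.isCompact.cthickening
  have hev : ∀ᶠ n in atTop, (shrinkingBump d n).rOut ≤ δ :=
    (tendsto_order.1 tendsto_rOut_shrinkingBump).2 δ hδ |>.mono fun n hn => hn.le
  have hsup : ∀ᶠ n in atTop, tsupport (mollify n f) ⊆ S := by
    filter_upwards [hev] with n hn
    exact (tsupport_mollify_subset n).trans (cthickening_mono hn _)
  have hfS : tsupport f ⊆ S := self_subset_cthickening _
  obtain ⟨M, hM⟩ : ∃ M, ∀ x, |f x| ≤ M := by
    obtain ⟨M, hM⟩ := hc.exists_bound_of_continuous hf.continuous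
    exact ⟨M, hM⟩
  have hloc : LocallyIntegrable f volume := hf.continuous.locallyIntegrable
  have hmc : ∀ n, Continuous (mollify n f) := fun n => (mollify_contDiff n hloc 0).continuous
  have t1 : Tendsto (fun n => eLpNorm (fun x => f x - mollify n f x) 2 volume) atTop (𝓝 0) := by
    refine tendsto_eLpNorm_two_of_bounded (S := S) (C := M + M) hScomp.measurableSet
      hScomp.measure_lt_top.ne (fun n => (hmc n).measurable)
      hf.continuous.measurable (Eventually.of_forall fun n x => ?_) ?_
      (ae_tendsto_mollify hloc)
    · exact (abs_sub _ _).trans (add_le_add (hM x) (abs_mollify_le n hM x))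
    · filter_upwards [hsup] with n hn x hx
      rw [image_eq_zero_of_notMem_tsupport fun h => hx (hfS h),
        image_eq_zero_of_notMem_tsupport fun h => hx (hn h), sub_zero]
  have t2 : ∀ i : Fin d, Tendsto (fun n => eLpNorm (fun x =>
      lineDeriv ℝ f x (EuclideanSpace.single i 1) - classicalPartial i (mollify n f) x) 2 volume)
      atTop (𝓝 0) := by
    intro i
    set e : Space d := EuclideanSpace.single i 1
    have hM' : ∀ x, |lineDeriv ℝ f x e| ≤ C * ‖e‖ := fun x =>
      norm_lineDeriv_le_of_lipschitz ℝ hf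
    have hcl : ∀ n x, classicalPartial i (mollify n f) x = mollify n (fun y => lineDeriv ℝ f y e) x :=
      fun n x => fderiv_mollify n hf x e
    refine tendsto_eLpNorm_two_of_bounded (S := S) (C := C * ‖e‖ + C * ‖e‖) hScomp.measurableSet
      hScomp.measure_lt_top.ne (fun n => ?_)
      (measurable_lineDeriv hf.continuous)
      (Eventually.of_forall fun n x => ?_) ?_ ?_
    · have := (mollify_contDiff n hloc 1).continuous_fderiv one_ne_zero
      exact (this.clm_apply continuous_const).measurable
    · rw [hcl]
      exact (abs_sub _ _).trans (add_le_add (hM' x) (abs_mollify_le n hM' x))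
    · filter_upwards [hsup] with n hn x hx
      rw [lineDeriv_eq_zero_of_notMem_tsupport fun h => hx (hfS h)]
      have : fderiv ℝ (mollify n f) x = 0 := by
        have h : mollify n f =ᶠ[𝓝 x] 0 := notMem_tsupport_iff_eventuallyEq.1 fun h => hx (hn h)
        rw [h.fderiv_eq]; simp
      simp [classicalPartial, this]
    · simp_rw [hcl]
      exact ae_tendsto_mollify (hf.locallyIntegrable_lineDeriv e)
  have e1 := (ENNReal.tendsto_nhds_zero.1 t1) ε hε
  have e2 : ∀ᶠ n in atTop, ∀ i : Fin d, eLpNorm (fun x =>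
      lineDeriv ℝ f x (EuclideanSpace.single i 1) - classicalPartial i (mollify n f) x) 2 volume
      ≤ ε := eventually_all.2 fun i => (ENNReal.tendsto_nhds_zero.1 (t2 i)) ε hε
  obtain ⟨n, h1, h2, h3⟩ := (e1.and (e2.and hsup)).exists
  exact ⟨⟨mollify n f, mollify_contDiff n hloc _, hScomp.of_isClosed_subset (isClosed_tsupport _) h3,
    h3.trans hδΩ⟩, h1, h2⟩

/-! ### Weak derivatives of Lipschitz functions -/

theorem weakPartial_eq_of_isWeakPartial {Ω : Opens (Space d)} {i : Fin d} {u g : L2 Ω}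
    (h : IsWeakPartial i u g) : weakPartial i u = g := by
  have hex : ∃ g, IsWeakPartial i u g := ⟨g, h⟩
  rw [weakPartial, dif_pos hex]
  exact hex.choose_spec.unique h

/-! ### Soft thresholding, and Lipschitz functions in `H¹₀` -/

/-- Soft thresholding: moves `s` towards `0` by `ε`. -/
def softThreshold (ε s : ℝ) : ℝ := s - max (-ε) (min s ε)

theorem softThreshold_of_le {ε s : ℝ} (h : |s| ≤ ε) : softThreshold ε s = 0 := by
  obtain ⟨h1, h2⟩ := abs_le.1 h
  rw [softThreshold, min_eq_left h2, max_eq_right h1, sub_self]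

theorem abs_softThreshold_sub_le {ε : ℝ} (hε : 0 ≤ ε) (s t : ℝ) :
    |softThreshold ε s - softThreshold ε t| ≤ |s - t| := by
  unfold softThreshold
  rcases le_total s ε with h1 | h1 <;> rcases le_total t ε with h2 | h2 <;>
  simp only [min_eq_left, min_eq_right, h1, h2]
  · rcases le_total s (-ε) with h3 | h3 <;> rcases le_total t (-ε) with h4 | h4 <;>
    simp only [max_eq_left, max_eq_right, h3, h4, abs_le] <;> constructor <;>
    cases abs_cases (s - t) <;> linarith
  · rw [max_eq_right (by linarith : -ε ≤ ε)]
    rcases le_total s (-ε) with h3 | h3 <;>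
    simp only [max_eq_left, max_eq_right, h3, abs_le] <;> constructor <;>
    cases abs_cases (s - t) <;> linarith
  · rw [max_eq_right (by linarith : -ε ≤ ε)]
    rcases le_total t (-ε) with h3 | h3 <;>
    simp only [max_eq_left, max_eq_right, h3, abs_le] <;> constructor <;>
    cases abs_cases (s - t) <;> linarith
  · rw [max_eq_right (by linarith : -ε ≤ ε)]
    simp

theorem abs_sub_softThreshold_le {ε : ℝ} (hε : 0 ≤ ε) (s : ℝ) : |s - softThreshold ε s| ≤ ε := by
  have : s - softThreshold ε s = max (-ε) (min s ε) := by unfold softThreshold; ring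
  rw [this, abs_le]
  exact ⟨le_max_left _ _, max_le (by linarith) (min_le_right _ _)⟩

/-- Where `|f| > ε`, thresholding locally adds a constant to `f`. -/
theorem lineDeriv_softThreshold {f : Space d → ℝ} (hf : Continuous f) {x : Space d} {ε : ℝ}
    (hε : 0 < ε) (hx : ε < |f x|) (e : Space d) :
    lineDeriv ℝ (fun y => softThreshold ε (f y)) x e = lineDeriv ℝ f x e := by
  rcases lt_abs.1 hx with h | h
  · have : (fun y => softThreshold ε (f y)) =ᶠ[𝓝 x] fun y => f y - ε := by
      filter_upwards [hf.continuousAt.eventually (lt_mem_nhds h)] with y hy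
      rw [softThreshold, min_eq_right hy.le, max_eq_right (by linarith)]
    rw [this.lineDeriv_eq]
    simp [lineDeriv, deriv_sub_const]
  · have h' : f x < -ε := by linarith
    have : (fun y => softThreshold ε (f y)) =ᶠ[𝓝 x] fun y => f y + ε := by
      filter_upwards [hf.continuousAt.eventually (gt_mem_nhds h')] with y hy
      rw [softThreshold, min_eq_left (by linarith), max_eq_left hy.le]; ring
    rw [this.lineDeriv_eq]
    simp [lineDeriv, deriv_add_const]

theorem lineDeriv_eq_fderiv_testFunction {Ω : Opens (Space d)} (φ : 𝓓(Ω, ℝ)) (x e : Space d) :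
    lineDeriv ℝ φ x e = fderiv ℝ φ x e :=
  ((φ.contDiff.differentiable (by simp)).differentiableAt).lineDeriv_eq_fderiv

/-- Lipschitz functions are weakly differentiable. -/
theorem isWeakPartial_lineDeriv {Ω : Opens (Space d)} {f : Space d → ℝ} {C : ℝ≥0}
    (hf : LipschitzWith C f) {u g : L2 Ω} {i : Fin d}
    (hu : u =ᵐ[volume.restrict (Ω : Set (Space d))] f)
    (hg : g =ᵐ[volume.restrict (Ω : Set (Space d))]
      fun x => lineDeriv ℝ f x (EuclideanSpace.single i 1)) : IsWeakPartial i u g := by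
  intro φ
  set e : Space d := EuclideanSpace.single i 1
  have hφ : ContDiff ℝ 1 φ := φ.contDiff.of_le (by simp)
  obtain ⟨D, hD⟩ := ContDiff.lipschitzWith_of_hasCompactSupport φ.hasCompactSupport hφ one_ne_zero
  have key := hf.integral_lineDeriv_mul_eq (μ := volume) hD φ.hasCompactSupport e
  have z1 : ∀ x ∉ (Ω : Set (Space d)), φ x = 0 := fun x hx =>
    image_eq_zero_of_notMem_tsupport fun h => hx (φ.tsupport_subset h)
  have z2 : ∀ x ∉ (Ω : Set (Space d)), classicalPartial i φ x = 0 := fun x hx => by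
    rw [classicalPartial, ← lineDeriv_eq_fderiv_testFunction]
    exact lineDeriv_eq_zero_of_notMem_tsupport (fun h => hx (φ.tsupport_subset h)) _
  have e1 : ∫ x in (Ω : Set (Space d)), u x * classicalPartial i φ x =
      ∫ x, f x * classicalPartial i φ x := by
    refine Eq.trans ?_ (setIntegral_eq_integral_of_forall_compl_eq_zero
      (s := (Ω : Set (Space d))) (fun x hx => by rw [z2 x hx, mul_zero]))
    exact integral_congr_ae (hu.mono fun x hx => by simp only [hx])
  have e2 : ∫ x in (Ω : Set (Space d)), g x * φ x = ∫ x, lineDeriv ℝ f x e * φ x := by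
    refine Eq.trans ?_ (setIntegral_eq_integral_of_forall_compl_eq_zero
      (s := (Ω : Set (Space d))) (fun x hx => by rw [z1 x hx, mul_zero]))
    exact integral_congr_ae (hg.mono fun x hx => by simp only [hx])
  rw [e1, e2, key, ← integral_neg]
  congr 1; ext x
  rw [lineDeriv_eq_fderiv_testFunction, classicalPartial, map_neg]
  ring

theorem hasCompactSupport_of_eq_zero_off {Ω : Set (Space d)} (hΩ : Bornology.IsBounded Ω)
    {f : Space d → ℝ} (h0 : ∀ x ∉ Ω, f x = 0) : HasCompactSupport f :=
  HasCompactSupport.of_support_subset_isCompact hΩ.isCompact_closure fun x hx =>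
    subset_closure (by by_contra h; exact hx (h0 x h))

theorem memLp_two_of_lipschitz {f : Space d → ℝ} {C : ℝ≥0} (hf : LipschitzWith C f)
    (hc : HasCompactSupport f) : MemLp f 2 volume :=
  hf.continuous.memLp_of_hasCompactSupport hc

theorem memLp_lineDeriv_of_hasCompactSupport (p : ℝ≥0∞) {f : Space d → ℝ} {C : ℝ≥0}
    (hf : LipschitzWith C f)
    (hc : HasCompactSupport f) (e : Space d) : MemLp (fun x => lineDeriv ℝ f x e) p volume := by
  have h1 : MemLp (fun x => lineDeriv ℝ f x e) p (volume.restrict (tsupport f)) := by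
    have : IsFiniteMeasure (volume.restrict (tsupport f)) :=
      ⟨by simpa using hc.isCompact.measure_lt_top⟩
    exact (hf.memLp_lineDeriv e).mono_exponent le_top
  have := (memLp_indicator_iff_restrict hc.isCompact.measurableSet).2 h1
  refine this.ae_eq (Eventually.of_forall fun x => ?_)
  by_cases hx : x ∈ tsupport f
  · rw [Set.indicator_of_mem hx]
  · simp [hx, lineDeriv_eq_zero_of_notMem_tsupport hx]

theorem memLp_two_lineDeriv {f : Space d → ℝ} {C : ℝ≥0} (hf : LipschitzWith C f)
    (hc : HasCompactSupport f) (e : Space d) : MemLp (fun x => lineDeriv ℝ f x e) 2 volume :=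
  memLp_lineDeriv_of_hasCompactSupport 2 hf hc e

/-- The weak partial derivatives of a compactly supported Lipschitz function. -/
theorem weakPartial_ae_eq_lineDeriv {Ω : Opens (Space d)} {f : Space d → ℝ} {C : ℝ≥0}
    (hf : LipschitzWith C f) (hc : HasCompactSupport f) {u : L2 Ω}
    (hu : u =ᵐ[volume.restrict (Ω : Set (Space d))] f) (i : Fin d) :
    (∃ g, IsWeakPartial i u g) ∧ weakPartial i u =ᵐ[volume.restrict (Ω : Set (Space d))]
      fun x => lineDeriv ℝ f x (EuclideanSpace.single i 1) := by
  have hm := (memLp_two_lineDeriv hf hc (EuclideanSpace.single i 1)).restrict (Ω : Set (Space d))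
  have hw : IsWeakPartial i u hm.toLp := isWeakPartial_lineDeriv hf hu hm.coeFn_toLp
  refine ⟨⟨_, hw⟩, ?_⟩
  rw [weakPartial_eq_of_isWeakPartial hw]
  exact hm.coeFn_toLp

theorem lipschitzWith_softThreshold {f : Space d → ℝ} {C : ℝ≥0} (hf : LipschitzWith C f) {ε : ℝ}
    (hε : 0 ≤ ε) : LipschitzWith C fun x => softThreshold ε (f x) :=
  LipschitzWith.of_dist_le_mul fun x y =>
    (abs_softThreshold_sub_le hε (f x) (f y)).trans (hf.dist_le_mul x y)

theorem tendsto_softThreshold (s : ℝ) :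
    Tendsto (fun n : ℕ => softThreshold (1 / (n + 1)) s) atTop (𝓝 s) := by
  rw [tendsto_iff_dist_tendsto_zero]
  refine squeeze_zero (fun _ => dist_nonneg) (fun n => ?_)
    (tendsto_one_div_add_atTop_nhds_zero_nat (𝕜 := ℝ))
  rw [dist_comm, Real.dist_eq]
  exact abs_sub_softThreshold_le (by positivity) s

-- At each point the sequence is eventually constant. Its limit is the derivative cut off on the
-- zero set of `f`; comparing this limit with the weak limit shows that the cut-off changes nothing
-- almost everywhere.
open Classical in
theorem tendsto_lineDeriv_softThreshold {f : Space d → ℝ} (hf : Continuous f) (x e : Space d) :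
    Tendsto (fun n : ℕ => lineDeriv ℝ (fun y => softThreshold (1 / (n + 1)) (f y)) x e) atTop
      (𝓝 (if f x = 0 then 0 else lineDeriv ℝ f x e)) := by
  refine tendsto_const_nhds.congr' ?_
  split_ifs with h
  · refine Eventually.of_forall fun n => ?_
    have hpos : (0 : ℝ) < 1 / (n + 1) := by positivity
    have : (fun y => softThreshold (1 / (n + 1)) (f y)) =ᶠ[𝓝 x] fun _ => 0 := by
      have h' : |f x| < 1 / (n + 1) := by rw [h, abs_zero]; exact hpos
      filter_upwards [hf.abs.continuousAt.eventually (gt_mem_nhds h')] with y hy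
      exact softThreshold_of_le hy.le
    change (0 : ℝ) = lineDeriv ℝ _ x e
    rw [this.lineDeriv_eq]
    simp [lineDeriv]
  · filter_upwards [(tendsto_order.1 (tendsto_one_div_add_atTop_nhds_zero_nat (𝕜 := ℝ))).2 _
      (abs_pos.2 h)] with n hn
    rw [lineDeriv_softThreshold hf (by positivity) hn]

/-- The derivative of a Lipschitz function vanishes almost everywhere on its zero set. -/
theorem ae_lineDeriv_eq_zero_of_eq_zero {f : Space d → ℝ} {C : ℝ≥0} (hf : LipschitzWith C f)
    (e : Space d) : ∀ᵐ x, f x = 0 → lineDeriv ℝ f x e = 0 := by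
  classical
  set g : Space d → ℝ := fun x => if f x = 0 then 0 else lineDeriv ℝ f x e with hg
  have hb : ∀ x, |lineDeriv ℝ f x e| ≤ C * ‖e‖ := fun x => norm_lineDeriv_le_of_lipschitz ℝ hf
  have hgb : ∀ x, |g x| ≤ C * ‖e‖ := fun x => by
    simp only [hg]
    split_ifs
    · simp only [abs_zero]; positivity
    · exact hb x
  have hgm : Measurable g :=
    Measurable.ite (hf.continuous.measurable (measurableSet_singleton 0)) measurable_const
      (measurable_lineDeriv hf.continuous)
  have hgl : LocallyIntegrable g volume :=
    (memLp_top_of_bound hgm.aestronglyMeasurable _ (Eventually.of_forall hgb)).locallyIntegrable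
      le_top
  -- The derivative and its cut-off `g` have the same integral against every test function:
  -- integrate by parts for the thresholded functions and pass to the limit on both sides.
  have key := ae_eq_zero_of_integral_contDiff_smul_eq_zero (μ := volume)
    (f := fun x => lineDeriv ℝ f x e - g x) ((hf.locallyIntegrable_lineDeriv e).sub hgl) (by
      intro φ hφ hc
      obtain ⟨D, hD⟩ := ContDiff.lipschitzWith_of_hasCompactSupport hc (hφ.of_le (by simp))
        (one_ne_zero)
      have hφi : Integrable φ volume := hφ.continuous.integrable_of_hasCompactSupport hc
      set ψ : Space d → ℝ := fun x => lineDeriv ℝ φ x (-e)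
      have hψi : Integrable ψ volume := by
        have := ((hφ.continuous_fderiv (by simp)).clm_apply
          (continuous_const (y := -e))).integrable_of_hasCompactSupport
          (μ := volume) (hc.fderiv_apply ℝ (-e))
        refine this.congr (Eventually.of_forall fun x => ?_)
        exact ((hφ.differentiable (by simp)).differentiableAt.lineDeriv_eq_fderiv).symm
      have l1 : Tendsto (fun n : ℕ => ∫ x, lineDeriv ℝ
          (fun y => softThreshold (1 / (n + 1)) (f y)) x e * φ x) atTop (𝓝 (∫ x, g x * φ x)) := by
        refine tendsto_integral_of_dominated_convergence (fun x => C * ‖e‖ * |φ x|) (fun n => ?_)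
          (hφi.abs.const_mul _) (fun n => Eventually.of_forall fun x => ?_)
          (Eventually.of_forall fun x => ?_)
        · exact ((measurable_lineDeriv (lipschitzWith_softThreshold hf
            (by positivity)).continuous).mul hφ.continuous.measurable).aestronglyMeasurable
        · rw [norm_mul]
          gcongr
          · exact norm_lineDeriv_le_of_lipschitz ℝ (lipschitzWith_softThreshold hf (by positivity))
          · exact le_rfl
        · exact (tendsto_lineDeriv_softThreshold hf.continuous x e).mul_const _
      have l2 : Tendsto (fun n : ℕ => ∫ x, ψ x * softThreshold (1 / (n + 1)) (f x)) atTop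
          (𝓝 (∫ x, ψ x * f x)) := by
        refine tendsto_integral_of_dominated_convergence (fun x => |ψ x * f x| + |ψ x|)
          (fun n => ?_) ?_ (fun n => Eventually.of_forall fun x => ?_)
          (Eventually.of_forall fun x => ?_)
        · exact hψi.1.mul (lipschitzWith_softThreshold hf
            (by positivity)).continuous.aestronglyMeasurable
        · refine Integrable.add (Integrable.abs ?_) hψi.abs
          have hcψ : HasCompactSupport ψ := by
            refine (hc.fderiv_apply ℝ (-e)).mono' ?_
            refine subset_trans (fun x hx => ?_) subset_closure
            simp only [Function.mem_support] at hx ⊢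
            rwa [← (hφ.differentiable (by simp)).differentiableAt.lineDeriv_eq_fderiv]
          have hcont : Continuous ψ := by
            have := ((hφ.continuous_fderiv (by simp)).clm_apply (continuous_const (y := -e)))
            refine this.congr fun x => ?_
            exact ((hφ.differentiable (by simp)).differentiableAt.lineDeriv_eq_fderiv).symm
          exact (hcont.mul hf.continuous).integrable_of_hasCompactSupport hcψ.mul_right
        · have h1 : |softThreshold (1 / ((n : ℝ) + 1)) (f x)| ≤ |f x| + 1 := by
            have h2 := abs_sub_softThreshold_le (ε := 1 / ((n : ℝ) + 1)) (by positivity) (f x)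
            have h3 : 1 / ((n : ℝ) + 1) ≤ 1 := by
              rw [div_le_one (by positivity)]; linarith [n.cast_nonneg (α := ℝ)]
            have h4 := abs_sub_abs_le_abs_sub (softThreshold (1 / ((n : ℝ) + 1)) (f x)) (f x)
            rw [abs_sub_comm] at h4
            linarith
          rw [norm_mul, abs_mul]
          have := mul_le_mul_of_nonneg_left h1 (abs_nonneg (ψ x))
          simp only [Real.norm_eq_abs]
          linarith
        · exact (tendsto_softThreshold (f x)).const_mul _
      have l3 := tendsto_nhds_unique l1 (l2.congr fun n =>
        ((lipschitzWith_softThreshold hf (by positivity)).integral_lineDeriv_mul_eq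
          (μ := volume) hD hc e).symm)
      have l4 := hf.integral_lineDeriv_mul_eq (μ := volume) hD hc e
      have i1 : Integrable (fun x => lineDeriv ℝ f x e * φ x) volume := by
        refine (hφi.bdd_mul (measurable_lineDeriv hf.continuous).aestronglyMeasurable
          (Eventually.of_forall hb))
      have i2 : Integrable (fun x => g x * φ x) volume :=
        hφi.bdd_mul hgm.aestronglyMeasurable (Eventually.of_forall hgb)
      have : ∫ x, φ x • (lineDeriv ℝ f x e - g x) =
          ∫ x, (lineDeriv ℝ f x e * φ x - g x * φ x) := by
        congr 1; ext x; rw [smul_eq_mul]; ring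
      rw [this, integral_sub i1 i2, l3, l4, sub_self])
  filter_upwards [key] with x hx h0
  simpa [hg, h0] using hx

/-- A Lipschitz function that vanishes outside the bounded open set `Ω` belongs to `H¹₀(Ω)`. -/
theorem mem_H10_of_lipschitz {Ω : Opens (Space d)}
    (hΩ : Bornology.IsBounded (Ω : Set (Space d))) {f : Space d → ℝ} {C : ℝ≥0}
    (hf : LipschitzWith C f) (h0 : ∀ x ∉ (Ω : Set (Space d)), f x = 0) {u : L2 Ω}
    (hu : u =ᵐ[volume.restrict (Ω : Set (Space d))] f) : u ∈ H10 Ω := by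
  have hc := hasCompactSupport_of_eq_zero_off hΩ h0
  refine ⟨fun i => (weakPartial_ae_eq_lineDeriv hf hc hu i).1, fun ε hε => ?_⟩
  have hTL : ∀ n : ℕ, LipschitzWith C fun x => softThreshold (1 / ((n : ℝ) + 1)) (f x) :=
    fun n => lipschitzWith_softThreshold hf (by positivity)
  -- The support of `f` may touch the boundary of `Ω`, but the closed set where `|f|` is at least
  -- the threshold does not. This replaces any assumption on the boundary.
  have hsub : ∀ n : ℕ, tsupport (fun x => softThreshold (1 / ((n : ℝ) + 1)) (f x)) ⊆ Ω := by
    intro n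
    have hpos : (0 : ℝ) < 1 / ((n : ℝ) + 1) := by positivity
    have hcl : IsClosed {x | 1 / ((n : ℝ) + 1) ≤ |f x|} :=
      isClosed_le continuous_const hf.continuous.abs
    have h1 : tsupport (fun x => softThreshold (1 / ((n : ℝ) + 1)) (f x)) ⊆
        {x | 1 / ((n : ℝ) + 1) ≤ |f x|} := by
      refine closure_minimal (fun x hx => ?_) hcl
      by_contra h
      exact hx (softThreshold_of_le (not_le.1 h).le)
    intro x hx
    by_contra h
    have h2 := h1 hx
    simp only [Set.mem_ofPred_eq, h0 x h, abs_zero] at h2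
    linarith
  have hTc : ∀ n : ℕ, HasCompactSupport fun x => softThreshold (1 / ((n : ℝ) + 1)) (f x) :=
    fun n => hasCompactSupport_of_eq_zero_off hΩ fun x hx =>
      softThreshold_of_le (by rw [h0 x hx, abs_zero]; positivity)
  set S := closure (Ω : Set (Space d))
  have hS : IsCompact S := hΩ.isCompact_closure
  have t1 : Tendsto (fun n : ℕ => eLpNorm (fun x => f x - softThreshold (1 / ((n : ℝ) + 1)) (f x))
      2 volume) atTop (𝓝 0) := by
    refine tendsto_eLpNorm_two_of_bounded (S := S) (C := 1) hS.measurableSet hS.measure_lt_top.ne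
      (fun n => (hTL n).continuous.measurable) hf.continuous.measurable
      (Eventually.of_forall fun n x => ?_) (Eventually.of_forall fun n x hx => ?_)
      (Eventually.of_forall fun x => tendsto_softThreshold (f x))
    · refine (abs_sub_softThreshold_le (by positivity) _).trans ?_
      rw [div_le_one (by positivity)]; linarith [n.cast_nonneg (α := ℝ)]
    · have : f x = 0 := h0 x fun h => hx (subset_closure h)
      rw [this, softThreshold_of_le (by rw [abs_zero]; positivity), sub_zero]
  have t2 : ∀ i : Fin d, Tendsto (fun n : ℕ => eLpNorm (fun x =>
      lineDeriv ℝ f x (EuclideanSpace.single i 1) -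
      lineDeriv ℝ (fun y => softThreshold (1 / ((n : ℝ) + 1)) (f y)) x (EuclideanSpace.single i 1))
      2 volume) atTop (𝓝 0) := by
    intro i
    set e : Space d := EuclideanSpace.single i 1
    refine tendsto_eLpNorm_two_of_bounded (S := S) (C := C * ‖e‖ + C * ‖e‖) hS.measurableSet
      hS.measure_lt_top.ne (fun n => measurable_lineDeriv (hTL n).continuous)
      (measurable_lineDeriv hf.continuous)
      (Eventually.of_forall fun n x => ?_) (Eventually.of_forall fun n x hx => ?_) ?_
    · exact (abs_sub _ _).trans (add_le_add (norm_lineDeriv_le_of_lipschitz ℝ hf)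
        (norm_lineDeriv_le_of_lipschitz ℝ (hTL n)))
    · have hx' : x ∉ tsupport f := fun h => hx
        (closure_mono (fun y hy => by by_contra h; exact hy (h0 y h)) h)
      have hx'' : x ∉ tsupport (fun x => softThreshold (1 / ((n : ℝ) + 1)) (f x)) := fun h =>
        hx (subset_closure (hsub n h))
      rw [lineDeriv_eq_zero_of_notMem_tsupport hx', lineDeriv_eq_zero_of_notMem_tsupport hx'',
        sub_zero]
    -- On the zero set the thresholded derivatives vanish, so convergence there requires the
    -- derivative of `f` to vanish almost everywhere.
    · filter_upwards [ae_lineDeriv_eq_zero_of_eq_zero hf e] with x hx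
      have := tendsto_lineDeriv_softThreshold hf.continuous x e
      split_ifs at this with h
      · rwa [hx h]
      · exact this
  have hε2 : 0 < ε / 2 := ENNReal.half_pos hε.ne'
  have e1 := (ENNReal.tendsto_nhds_zero.1 t1) _ hε2
  have e2 := eventually_all.2 fun i => (ENNReal.tendsto_nhds_zero.1 (t2 i)) _ hε2
  obtain ⟨n, h1, h2⟩ := (e1.and e2).exists
  obtain ⟨φ, h3, h4⟩ := exists_testFunction_near (hTL n) (hTc n) (hsub n) hε2
  refine ⟨φ, ?_, fun i => ?_⟩
  · have a1 : eLpNorm (fun x => u x - φ x) 2 (volume.restrict (Ω : Set (Space d))) =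
        eLpNorm (fun x => (f x - softThreshold (1 / ((n : ℝ) + 1)) (f x)) +
          (softThreshold (1 / ((n : ℝ) + 1)) (f x) - φ x)) 2
          (volume.restrict (Ω : Set (Space d))) :=
      eLpNorm_congr_ae (hu.mono fun x hx => by simp only [hx]; ring)
    rw [a1]
    refine (eLpNorm_mono_measure _ Measure.restrict_le_self).trans ?_
    refine (eLpNorm_add_le (hf.continuous.sub (hTL n).continuous).aestronglyMeasurable
      ((hTL n).continuous.sub φ.continuous).aestronglyMeasurable (by norm_num)).trans ?_
    exact (add_le_add h1 h3).trans (ENNReal.add_halves ε).le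
  · set e : Space d := EuclideanSpace.single i 1
    have a1 : eLpNorm (fun x => weakPartial i u x - classicalPartial i φ x) 2
        (volume.restrict (Ω : Set (Space d))) =
        eLpNorm (fun x => (lineDeriv ℝ f x e -
          lineDeriv ℝ (fun y => softThreshold (1 / ((n : ℝ) + 1)) (f y)) x e) +
          (lineDeriv ℝ (fun y => softThreshold (1 / ((n : ℝ) + 1)) (f y)) x e -
          classicalPartial i φ x)) 2 (volume.restrict (Ω : Set (Space d))) :=
      eLpNorm_congr_ae ((weakPartial_ae_eq_lineDeriv hf hc hu i).2.mono fun x hx => by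
        simp only [hx]; ring)
    rw [a1]
    refine (eLpNorm_mono_measure _ Measure.restrict_le_self).trans ?_
    refine (eLpNorm_add_le ((measurable_lineDeriv hf.continuous).sub
      (measurable_lineDeriv (hTL n).continuous)).aestronglyMeasurable
      ((measurable_lineDeriv (hTL n).continuous).sub
        ((φ.contDiff.continuous_fderiv (by simp)).clm_apply
          continuous_const).measurable).aestronglyMeasurable (by norm_num)).trans ?_
    exact (add_le_add (h2 i) (h4 i)).trans (ENNReal.add_halves ε).le

/-! ### Integrals of derivatives and the Poincaré inequality -/

theorem integral_lineDeriv_eq_zero {f : Space d → ℝ} {C : ℝ≥0} (hf : LipschitzWith C f)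
    (hc : HasCompactSupport f) (e : Space d) : ∫ x, lineDeriv ℝ f x e = 0 := by
  have := (LipschitzWith.const (α := Space d) (1 : ℝ)).integral_lineDeriv_mul_eq
    (μ := volume) hf hc (-e)
  simpa [lineDeriv] using this.symm

/-- The Poincaré inequality for Lipschitz functions vanishing outside a bounded set. -/
theorem integral_sq_le_of_lipschitz {Ω : Set (Space d)} (hΩ : Bornology.IsBounded Ω) {R : ℝ}
    (hR : Metric.diam Ω ≤ R) {f : Space d → ℝ} {C : ℝ≥0} (hf : LipschitzWith C f)
    (h0 : ∀ x ∉ Ω, f x = 0) (i : Fin d) :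
    ∫ x, f x ^ 2 ≤ 4 * R ^ 2 * ∫ x, lineDeriv ℝ f x (EuclideanSpace.single i 1) ^ 2 := by
  have hc := hasCompactSupport_of_eq_zero_off hΩ h0
  set e : Space d := EuclideanSpace.single i 1
  have hR0 : 0 ≤ R := diam_nonneg.trans hR
  rcases Ω.eq_empty_or_nonempty with hE | ⟨x₀, hx₀⟩
  · have : f = 0 := funext fun x => h0 x (by simp [hE])
    subst this
    simp only [Pi.zero_apply, ne_eq, OfNat.ofNat_ne_zero, not_false_eq_true, zero_pow,
      integral_zero]
    exact mul_nonneg (by positivity) (integral_nonneg fun x => sq_nonneg _)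
  have hf2 : MemLp f 2 volume := memLp_two_of_lipschitz hf hc
  have hd2 := memLp_two_lineDeriv hf hc e
  obtain ⟨M, hM⟩ := hc.exists_bound_of_continuous hf.continuous
  have hM0 : 0 ≤ M := (norm_nonneg _).trans (hM x₀)
  have hsqL : LipschitzWith (2 * M.toNNReal * C) fun x => f x * f x := by
    refine LipschitzWith.of_dist_le_mul fun x y => ?_
    rw [Real.dist_eq, show f x * f x - f y * f y = (f x + f y) * (f x - f y) by ring, abs_mul]
    have h1 : |f x + f y| ≤ 2 * M := by
      have := abs_add_le (f x) (f y)
      have a := hM x; have b := hM y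
      rw [Real.norm_eq_abs] at a b
      linarith
    have h2 := hf.dist_le_mul x y
    rw [Real.dist_eq] at h2
    have : ((2 * M.toNNReal * C : ℝ≥0) : ℝ) = 2 * M * C := by simp [hM0]
    rw [this, mul_assoc]
    exact mul_le_mul h1 h2 (abs_nonneg _) (by positivity)
  have hsqc : HasCompactSupport fun x => f x * f x := hc.mul_right
  -- The factor `1` in `∫ f² · 1` is written as the derivative of `x i - x₀ i` along `e`, which is
  -- at most `R` in absolute value on `Ω`.
  have hcoord : LipschitzWith 1 fun x : Space d => x i - x₀ i := by
    refine LipschitzWith.of_dist_le_mul fun x y => ?_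
    rw [NNReal.coe_one, one_mul, Real.dist_eq, dist_eq_norm]
    have := PiLp.norm_apply_le (x - y) i
    simpa using this
  have hcd : ∀ x : Space d, lineDeriv ℝ (fun x : Space d => x i - x₀ i) x e = 1 := by
    intro x
    have : (fun t : ℝ => (x + t • e) i - x₀ i) = fun t => t + (x i - x₀ i) := by
      ext t; simp [e]; ring
    rw [lineDeriv, this, deriv_add_const]; simp
  have key := hcoord.integral_lineDeriv_mul_eq (μ := volume) hsqL hsqc e
  simp only [hcd, one_mul] at key
  -- Young's inequality, weighted so that half of `∫ f²` can be absorbed; this produces the factor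
  -- `4`.
  have hae : ∀ᵐ x, lineDeriv ℝ (fun x => f x * f x) x (-e) * (x i - x₀ i) ≤
      (1 / 2) * f x ^ 2 + 2 * R ^ 2 * lineDeriv ℝ f x e ^ 2 := by
    filter_upwards [hf.ae_differentiableAt (μ := volume)] with x hx
    have e1 : lineDeriv ℝ (fun x => f x * f x) x (-e) = -(2 * f x * lineDeriv ℝ f x e) := by
      rw [(hx.fun_mul hx).lineDeriv_eq_fderiv, hx.lineDeriv_eq_fderiv, fderiv_fun_mul hx hx]
      simp; ring
    rw [e1]
    by_cases hxΩ : x ∈ Ω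
    · have h1 : |x i - x₀ i| ≤ R := by
        have h2 := PiLp.norm_apply_le (x - x₀) i
        have h3 := (dist_le_diam_of_mem hΩ hxΩ hx₀).trans hR
        rw [dist_eq_norm] at h3
        simpa using h2.trans h3
      have h4 : (x i - x₀ i) ^ 2 ≤ R ^ 2 := sq_le_sq' (by linarith [abs_le.1 h1]) (abs_le.1 h1).2
      nlinarith [sq_nonneg (f x + 2 * lineDeriv ℝ f x e * (x i - x₀ i)),
        mul_le_mul_of_nonneg_left h4 (sq_nonneg (lineDeriv ℝ f x e))]
    · rw [h0 x hxΩ]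
      simp only [mul_zero, zero_mul, neg_zero]
      positivity
  have i1 : Integrable (fun x => f x ^ 2) volume := hf2.integrable_sq
  have i2 : Integrable (fun x => lineDeriv ℝ f x e ^ 2) volume := hd2.integrable_sq
  have hle : ∫ x, lineDeriv ℝ (fun x => f x * f x) x (-e) * (x i - x₀ i) ≤
      ∫ x, ((1 / 2) * f x ^ 2 + 2 * R ^ 2 * lineDeriv ℝ f x e ^ 2) := by
    -- Integrability of the left side need not be proved: otherwise its integral is `0` by
    -- convention and the right side is nonnegative.
    by_cases hi : Integrable
        (fun x => lineDeriv ℝ (fun x => f x * f x) x (-e) * (x i - x₀ i)) volume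
    · exact integral_mono_ae hi ((i1.const_mul _).add (i2.const_mul _)) hae
    · rw [integral_undef hi]
      exact integral_nonneg fun x => by simp only [Pi.zero_apply]; positivity
  rw [← key, integral_add (i1.const_mul _) (i2.const_mul _), integral_const_mul,
    integral_const_mul] at hle
  have : ∫ x, f x * f x = ∫ x, f x ^ 2 := by congr 1; ext x; ring
  rw [this] at hle
  linarith

/-! ### Polynomials on `ℝᵈ` -/

/-- Evaluation of a polynomial at a point of `ℝᵈ`. -/
abbrev evalAt (y : Space d) : MvPolynomial (Fin d) ℝ →+* ℝ := MvPolynomial.eval fun i => y i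

theorem continuous_evalAt (p : MvPolynomial (Fin d) ℝ) : Continuous fun y : Space d => evalAt y p :=
  (MvPolynomial.continuous_eval p).comp (by fun_prop)

/-- The polynomial of an affine function. -/
def affPoly (l : Space d →ᵃ[ℝ] ℝ) : MvPolynomial (Fin d) ℝ :=
  MvPolynomial.C (l 0) +
    ∑ i, MvPolynomial.C (l.linear (EuclideanSpace.single i 1)) * MvPolynomial.X i

theorem linear_apply_eq_sum (l : Space d →ₗ[ℝ] ℝ) (t : Space d) :
    l t = ∑ i, l (EuclideanSpace.single i 1) * t i := by
  have h : t = ∑ i, t i • EuclideanSpace.single i (1 : ℝ) := by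
    ext j
    simp [Pi.single_apply]
  conv_lhs => rw [h]
  simp [mul_comm]

@[simp]
theorem evalAt_affPoly (l : Space d →ᵃ[ℝ] ℝ) (y : Space d) : evalAt y (affPoly l) = l y := by
  have h : l y = l.linear y + l 0 := by
    have := l.map_vadd 0 y
    simpa using this
  rw [h, linear_apply_eq_sum l.linear y]
  simp [affPoly, add_comm]

theorem pderiv_affPoly (l : Space d →ᵃ[ℝ] ℝ) (i : Fin d) :
    MvPolynomial.pderiv i (affPoly l) = MvPolynomial.C (l.linear (EuclideanSpace.single i 1)) := by
  classical
  simp [affPoly, MvPolynomial.pderiv_X, Pi.single_apply]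

theorem totalDegree_affPoly_le (l : Space d →ᵃ[ℝ] ℝ) : (affPoly l).totalDegree ≤ 1 := by
  refine (MvPolynomial.totalDegree_add _ _).trans (max_le (by simp) ?_)
  refine MvPolynomial.totalDegree_finsetSum_le fun i _ => ?_
  refine (MvPolynomial.totalDegree_mul _ _).trans ?_
  simp

theorem evalAt_injective {p q : MvPolynomial (Fin d) ℝ} (h : ∀ y : Space d, evalAt y p = evalAt y q) :
    p = q :=
  MvPolynomial.funext fun x => h (WithLp.toLp 2 x)

theorem hasLineDerivAt_evalAt (p : MvPolynomial (Fin d) ℝ) (y t : Space d) :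
    HasLineDerivAt ℝ (fun y => evalAt y p) (∑ i, t i * evalAt y (MvPolynomial.pderiv i p)) y t := by
  unfold HasLineDerivAt
  induction p using MvPolynomial.induction_on with
  | C a => simpa using hasDerivAt_const (0 : ℝ) a
  | add p q hp hq =>
    simp only [map_add, mul_add, Finset.sum_add_distrib]
    exact hp.add hq
  | mul_X p j hp =>
    have hX : HasDerivAt (fun s : ℝ => (y + s • t) j) (t j) 0 := by
      have : HasDerivAt (fun s : ℝ => y j + s * t j) (t j) 0 := by
        simpa using ((hasDerivAt_id (0 : ℝ)).mul_const (t j)).const_add (y j)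
      simpa using this
    have hm := hp.mul hX
    have h0 : (fun s : ℝ => evalAt (y + s • t) (p * MvPolynomial.X j)) =
        (fun s : ℝ => evalAt (y + s • t) p) * fun s : ℝ => (y + s • t) j := by
      ext s; simp
    rw [h0]
    refine hm.congr_deriv ?_
    rw [zero_smul, add_zero]
    symm
    simp only [Derivation.leibniz, smul_eq_mul, map_add, map_mul, MvPolynomial.eval_X,
      MvPolynomial.pderiv_X, Finset.sum_mul, mul_add, Finset.sum_add_distrib, Pi.single_apply]
    rw [add_comm]
    congr 1
    · exact Finset.sum_congr rfl fun i _ => by ring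
    · rw [Finset.sum_eq_single j]
      · simp [mul_comm]
      · intro b _ hb
        simp [hb.symm]
      · simp

/-! ### Coefficients of polynomials and scaling to the unit ball -/

theorem norm_sq_eq_integral {α : Type*} [MeasurableSpace α] {μ : Measure α} (u : Lp ℝ 2 μ) :
    ‖u‖ ^ 2 = ∫ x, u x ^ 2 ∂μ := by
  rw [← real_inner_self_eq_norm_sq, L2.inner_def]
  congr 1; ext x
  simp [pow_two]

/-- Composition with `u ↦ c + r u`. -/
def rescale (c : Space d) (r : ℝ) : MvPolynomial (Fin d) ℝ →ₐ[ℝ] MvPolynomial (Fin d) ℝ :=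
  MvPolynomial.aeval fun i => MvPolynomial.C (c i) + MvPolynomial.C r * MvPolynomial.X i

theorem evalAt_rescale (c : Space d) (r : ℝ) (p : MvPolynomial (Fin d) ℝ) (u : Space d) :
    evalAt u (rescale c r p) = evalAt (c + r • u) p := by
  induction p using MvPolynomial.induction_on with
  | C a => simp [rescale]
  | add p q hp hq => simp only [map_add, hp, hq]
  | mul_X p j hp => rw [map_mul, map_mul, hp]; simp [rescale]

theorem totalDegree_rescale_le (c : Space d) (r : ℝ) (p : MvPolynomial (Fin d) ℝ) :
    (rescale c r p).totalDegree ≤ p.totalDegree := by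
  rw [rescale, MvPolynomial.aeval_def, MvPolynomial.eval₂_eq]
  refine MvPolynomial.totalDegree_finsetSum_le fun β hβ => ?_
  refine (MvPolynomial.totalDegree_mul _ _).trans ?_
  rw [show (algebraMap ℝ (MvPolynomial (Fin d) ℝ)) = MvPolynomial.C from rfl,
    MvPolynomial.totalDegree_C, zero_add]
  refine (MvPolynomial.totalDegree_finsetProd _ _).trans ?_
  refine le_trans ?_ (MvPolynomial.le_totalDegree hβ)
  rw [Finsupp.sum]
  refine Finset.sum_le_sum fun i _ => ?_
  refine (MvPolynomial.totalDegree_pow _ _).trans ?_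
  have : (MvPolynomial.C (c i) + MvPolynomial.C r * MvPolynomial.X i :
      MvPolynomial (Fin d) ℝ).totalDegree ≤ 1 := by
    refine (MvPolynomial.totalDegree_add _ _).trans (max_le (by simp) ?_)
    refine (MvPolynomial.totalDegree_mul _ _).trans ?_
    simp
  calc _ ≤ β i * 1 := Nat.mul_le_mul_left _ this
    _ = β i := mul_one _

/-- The factors `1, X₁, …, X_d` of monomials. -/
def monomialFactor (d : ℕ) : Option (Fin d) → MvPolynomial (Fin d) ℝ
  | none => 1
  | some i => MvPolynomial.X i

/-- Monomials of lower degree are padded with factors `1`. Having exactly `n` affine factors makes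
the later expansion in barycentric coordinates homogeneous of degree `n`. -/
theorem exists_prod_monomialFactor (n : ℕ) (β : Fin d →₀ ℕ) (hβ : (β.sum fun _ e => e) ≤ n) :
    ∃ s : Fin n → Option (Fin d), ∏ t, monomialFactor d (s t) = MvPolynomial.monomial β 1 := by
  classical
  induction n generalizing β with
  | zero =>
    have : β = 0 := by
      ext i
      by_contra h
      have h1 : i ∈ β.support := by simpa using h
      have h2 := Finset.single_le_sum (f := fun i => β i) (fun _ _ => Nat.zero_le _) h1
      simp only [Finsupp.sum] at hβ
      simp at h
      omega
    subst this
    exact ⟨fun _ => none, by simp⟩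
  | succ n ih =>
    by_cases h0 : β = 0
    · subst h0
      exact ⟨fun _ => none, by simp [monomialFactor]⟩
    · obtain ⟨i, hi⟩ := Finsupp.ne_iff.1 h0
      simp only [Finsupp.coe_zero, Pi.zero_apply] at hi
      obtain ⟨β', rfl⟩ : ∃ β', β = Finsupp.single i 1 + β' :=
        ⟨β - Finsupp.single i 1, by
          rw [add_tsub_cancel_of_le]
          rw [Finsupp.single_le_iff]; omega⟩
      rw [Finsupp.sum_add_index' (by simp) (by simp), Finsupp.sum_single_index rfl] at hβ
      obtain ⟨s, hs⟩ := ih β' (by omega)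
      refine ⟨Fin.cons (some i) s, ?_⟩
      rw [Fin.prod_univ_succ]
      simp only [Fin.cons_zero, Fin.cons_succ, hs]
      rw [monomialFactor, MvPolynomial.X, MvPolynomial.monomial_mul, one_mul]

theorem integral_closedBall_comp (f : Space d → ℝ) (c : Space d) {r : ℝ} (hr : 0 < r) :
    ∫ y in closedBall c r, f y = r ^ d * ∫ u in closedBall (0 : Space d) 1, f (c + r • u) := by
  rw [← integral_indicator measurableSet_closedBall, ← integral_indicator measurableSet_closedBall]
  have h1 : ∀ u, (closedBall (0 : Space d) 1).indicator (fun u => f (c + r • u)) u =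
      (closedBall c r).indicator f (c + r • u) := by
    intro u
    have : u ∈ closedBall (0 : Space d) 1 ↔ c + r • u ∈ closedBall c r := by
      simp only [mem_closedBall, dist_eq_norm, sub_zero, add_sub_cancel_left, norm_smul,
        Real.norm_eq_abs, abs_of_pos hr]
      constructor
      · intro h; nlinarith
      · intro h
        have := (mul_le_iff_le_one_right hr).1 h
        exact this
    by_cases h : u ∈ closedBall (0 : Space d) 1
    · rw [Set.indicator_of_mem h, Set.indicator_of_mem (this.1 h)]
    · rw [Set.indicator_of_notMem h, Set.indicator_of_notMem (fun h' => h (this.2 h'))]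
  simp_rw [h1]
  have h2 := Measure.integral_comp_smul (μ := (volume : Measure (Space d)))
    (fun v => (closedBall c r).indicator f (c + v)) r
  simp only [finrank_euclideanSpace, Fintype.card_fin, smul_eq_mul] at h2
  rw [h2, integral_add_left_eq_self (fun v => (closedBall c r).indicator f v) c,
    abs_of_pos (by positivity), ← mul_assoc, mul_inv_cancel₀ (by positivity), one_mul]

theorem memLp_evalAt_closedBall (p : MvPolynomial (Fin d) ℝ) :
    MemLp (fun y => evalAt y p) 2 (volume.restrict (closedBall (0 : Space d) 1)) := by
  obtain ⟨M, hM⟩ := (isCompact_closedBall (0 : Space d) 1).exists_bound_of_continuousOn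
    (continuous_evalAt p).continuousOn
  have : IsFiniteMeasure (volume.restrict (closedBall (0 : Space d) 1)) :=
    ⟨by simpa using measure_closedBall_lt_top⟩
  refine MemLp.of_bound (continuous_evalAt p).aestronglyMeasurable M ?_
  exact (ae_restrict_iff' measurableSet_closedBall).2 (Eventually.of_forall hM)

/-- Polynomials as square integrable functions on the unit ball. -/
def polyToLp (d : ℕ) : MvPolynomial (Fin d) ℝ →ₗ[ℝ]
    Lp ℝ 2 (volume.restrict (closedBall (0 : Space d) 1)) where
  toFun p := (memLp_evalAt_closedBall p).toLp
  map_add' p q := by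
    rw [← MemLp.toLp_add]
    congr 1; ext y; simp
  map_smul' a p := by
    rw [RingHom.id_apply, ← MemLp.toLp_const_smul]
    congr 1; ext y; simp

/-- A polynomial that is zero almost everywhere on the ball vanishes on an open set. Injectivity is
what lets the `L²`-norm control coefficients. -/
theorem polyToLp_injective : Function.Injective (polyToLp d) := by
  rw [← LinearMap.ker_eq_bot, LinearMap.ker_eq_bot']
  intro p hp
  have h1 : (fun y => evalAt y p) =ᵐ[volume.restrict (closedBall (0 : Space d) 1)] 0 :=
    ((memLp_evalAt_closedBall p).coeFn_toLp).symm.trans (by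
      rw [show (memLp_evalAt_closedBall p).toLp = polyToLp d p from rfl, hp]
      exact Lp.coeFn_zero _ _ _)
  have h2 : Set.EqOn (fun y => evalAt y p) 0 (ball (0 : Space d) 1) :=
    Measure.eqOn_open_of_ae_eq (ae_restrict_of_ae_restrict_of_subset ball_subset_closedBall h1)
      isOpen_ball (continuous_evalAt p).continuousOn continuousOn_const
  have h3 : {x : Fin d → ℝ | WithLp.toLp 2 x ∈ ball (0 : Space d) 1} ∈ 𝓝 (0 : Fin d → ℝ) := by
    refine IsOpen.mem_nhds (isOpen_ball.preimage (by fun_prop)) ?_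
    simp
  obtain ⟨ε, hε, hsub⟩ := Metric.mem_nhds_iff.1 h3
  refine MvPolynomial.funext_set (fun _ : Fin d => ball (0 : ℝ) ε) (fun _ => ?_) fun x hx => ?_
  · rw [Real.ball_eq_Ioo]
    exact Set.Ioo_infinite (by linarith)
  · have hx' : x ∈ ball (0 : Fin d → ℝ) ε := by
      rw [mem_ball, dist_pi_lt_iff hε]
      intro i
      exact hx i (Set.mem_univ i)
    have := h2 (hsub hx')
    simpa using this

/-- The factors `1, (X₁ - c₁) / r, …, (X_d - c_d) / r`. -/
def scaledFactor (c : Space d) (r : ℝ) (s : Option (Fin d)) : MvPolynomial (Fin d) ℝ :=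
  rescale (-(r⁻¹ • c)) r⁻¹ (monomialFactor d s)

/-- A polynomial is a combination of products of scaled coordinates, with coefficients controlled by
its `L²`-norm on a ball. -/
theorem exists_coeff_bound (d n : ℕ) : ∃ C : ℝ, 0 ≤ C ∧
    ∀ (c : Space d) (r : ℝ), 0 < r → ∀ p : MvPolynomial (Fin d) ℝ, p.totalDegree ≤ n →
      ∃ a : (Fin n → Option (Fin d)) → ℝ,
        p = ∑ s, a s • ∏ t, scaledFactor c r (s t) ∧
        ∀ s, a s ^ 2 * r ^ d ≤ C * ∫ y in closedBall c r, evalAt y p ^ 2 := by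
  classical
  let W := MvPolynomial.restrictTotalDegree (Fin d) ℝ n
  let Φ : W →ₗ[ℝ] Lp ℝ 2 (volume.restrict (closedBall (0 : Space d) 1)) :=
    polyToLp d ∘ₗ W.subtype
  have hΦ : Function.Injective Φ := polyToLp_injective.comp W.injective_subtype
  have hmem : ∀ s : Fin n → Option (Fin d), ∏ t, monomialFactor d (s t) ∈ W := fun s => by
    rw [MvPolynomial.mem_restrictTotalDegree]
    refine (MvPolynomial.totalDegree_finsetProd _ _).trans ?_
    calc _ ≤ ∑ _t : Fin n, 1 := Finset.sum_le_sum fun t _ => by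
          cases s t <;> simp [monomialFactor]
      _ = n := by simp
  let Ψ : ((Fin n → Option (Fin d)) → ℝ) →ₗ[ℝ] W :=
    Fintype.linearCombination ℝ fun s => ⟨_, hmem s⟩
  have hΨ : Function.Surjective Ψ := by
    intro ⟨p, hp⟩
    have hp' : ∀ β ∈ p.support, (β.sum fun _ e => e) ≤ n := fun β hβ =>
      (MvPolynomial.le_totalDegree hβ).trans ((MvPolynomial.mem_restrictTotalDegree _ _ _).1 hp)
    choose! s hs using fun β hβ => exists_prod_monomialFactor n β (hp' β hβ)
    refine ⟨∑ β ∈ p.support, Pi.single (s β) (p.coeff β), ?_⟩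
    rw [map_sum]
    ext1
    simp only [Ψ, Fintype.linearCombination_apply_single]
    rw [Submodule.coe_sum]
    conv_rhs => rw [MvPolynomial.as_sum p]
    refine Finset.sum_congr rfl fun β hβ => ?_
    simp only [Submodule.coe_smul, hs β hβ, MvPolynomial.smul_monomial, smul_eq_mul, mul_one]
  -- The products span but need not be independent, so a linear choice `g` of coefficients is fixed.
  -- On the finite-dimensional image in `L²` it is continuous, and its operator norm gives the
  -- constant. The factor `r ^ d` comes from scaling the ball.
  obtain ⟨g, hg⟩ := Ψ.exists_rightInverse_of_surjective (LinearMap.range_eq_top.2 hΨ)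
  let e := LinearEquiv.ofInjective Φ hΦ
  have : FiniteDimensional ℝ (LinearMap.range Φ) := inferInstance
  let G : LinearMap.range Φ →L[ℝ] ((Fin n → Option (Fin d)) → ℝ) :=
    LinearMap.toContinuousLinearMap (g ∘ₗ e.symm.toLinearMap)
  refine ⟨‖G‖ ^ 2, by positivity, fun c r hr p hp => ?_⟩
  let P : W := ⟨rescale c r p, (MvPolynomial.mem_restrictTotalDegree _ _ _).2
    ((totalDegree_rescale_le c r p).trans hp)⟩
  refine ⟨g P, ?_, fun s => ?_⟩
  · have h1 : Ψ (g P) = P := LinearMap.congr_fun hg P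
    have h2 : rescale c r p = ∑ s, g P s • ∏ t, monomialFactor d (s t) := by
      have := congrArg Subtype.val h1
      rw [show (P : MvPolynomial (Fin d) ℝ) = rescale c r p from rfl] at this
      rw [← this]
      simp [Ψ, Fintype.linearCombination_apply]
    have h3 : p = rescale (-(r⁻¹ • c)) r⁻¹ (rescale c r p) := by
      refine evalAt_injective fun y => ?_
      rw [evalAt_rescale, evalAt_rescale]
      congr 2
      rw [smul_add, smul_neg, smul_smul, smul_smul, mul_inv_cancel₀ hr.ne']
      simp
    conv_lhs => rw [h3, h2]
    simp [scaledFactor, map_sum, map_prod]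
  · have h1 : G (e P) = g P := by
      simp [G]
    have h2 : |g P s| ≤ ‖G‖ * ‖Φ P‖ := by
      rw [← h1, ← Real.norm_eq_abs]
      exact (norm_le_pi_norm _ s).trans (G.le_opNorm _)
    have h3 : ‖Φ P‖ ^ 2 = ∫ u in closedBall (0 : Space d) 1, evalAt (c + r • u) p ^ 2 := by
      rw [norm_sq_eq_integral]
      refine integral_congr_ae ?_
      filter_upwards [(memLp_evalAt_closedBall (rescale c r p)).coeFn_toLp] with u hu
      rw [← evalAt_rescale, ← hu]
      rfl
    rw [integral_closedBall_comp (fun y => evalAt y p ^ 2) c hr, ← h3]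
    have h4 : g P s ^ 2 ≤ ‖G‖ ^ 2 * ‖Φ P‖ ^ 2 := by
      rw [← mul_pow, ← sq_abs]
      exact pow_le_pow_left₀ (abs_nonneg _) h2 2
    calc g P s ^ 2 * r ^ d ≤ (‖G‖ ^ 2 * ‖Φ P‖ ^ 2) * r ^ d := by gcongr
      _ = _ := by ring

/-! ### Split simplices -/

/-- The vertices of a nondegenerate `d`-simplex. -/
abbrev SimplexBasis (d : ℕ) : Type := AffineBasis (Fin (d + 1)) ℝ (Space d)

theorem affineMap_continuous (l : Space d →ᵃ[ℝ] ℝ) : Continuous l :=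
  AffineMap.continuous_of_finiteDimensional l

theorem affineMap_eq_sum_coord (B : SimplexBasis d) (l : Space d →ᵃ[ℝ] ℝ) (y : Space d) :
    l y = ∑ z, B.coord z y * l (B z) := by
  conv_lhs => rw [← B.affineCombination_coord_eq_self y]
  rw [Finset.map_affineCombination _ _ _ (B.sum_coord_apply_eq_one y),
    Finset.affineCombination_eq_linear_combination _ _ _ (B.sum_coord_apply_eq_one y)]
  simp

theorem affineMap_linear_sub (l : Space d →ᵃ[ℝ] ℝ) (p q : Space d) :
    l.linear (p - q) = l p - l q := by
  simpa using l.linearMap_vsub p q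

theorem coord_ne_zero_measure (l : Space d →ᵃ[ℝ] ℝ) (h : ∃ y, l y ≠ 0) :
    volume {y | l y = 0} = 0 := by
  have hs : ((AffineSubspace.mk' (0 : ℝ) ⊥).comap l : Set (Space d)) = {y | l y = 0} := by
    ext y; simp
  rw [← hs]
  refine Measure.addHaar_affineSubspace _ _ fun htop => ?_
  obtain ⟨y, hy⟩ := h
  have : y ∈ (AffineSubspace.mk' (0 : ℝ) ⊥).comap l := by rw [htop]; trivial
  simp at this
  exact hy this

/-- An affine function with values in `[0, 1]` on a ball has small slope. -/
theorem abs_linear_mul_le (l : Space d →ᵃ[ℝ] ℝ) {c : Space d} {r : ℝ} (hr : 0 ≤ r)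
    (h0 : ∀ y ∈ closedBall c r, 0 ≤ l y) (h1 : ∀ y ∈ closedBall c r, l y ≤ 1) (t : Space d) :
    |l.linear t| * (2 * r) ≤ ‖t‖ := by
  rcases eq_or_ne t 0 with rfl | ht
  · simp
  have ht' : 0 < ‖t‖ := norm_pos_iff.2 ht
  -- The points `c + w` and `c - w` are the ends of a diameter parallel to `t`; `l` varies by at
  -- most `1` between them.
  set w := (r / ‖t‖) • t with hw
  have hwn : ‖w‖ = r := by
    rw [hw, norm_smul, Real.norm_of_nonneg (by positivity)]; field_simp
  have m1 : c + w ∈ closedBall c r := by simp [hwn]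
  have m2 : c - w ∈ closedBall c r := by simp [hwn]
  have e : l (c + w) - l (c - w) = 2 * (r / ‖t‖) * l.linear t := by
    rw [← affineMap_linear_sub, show c + w - (c - w) = (2 * (r / ‖t‖)) • t by
      rw [hw, mul_smul, two_smul]; abel, map_smul, smul_eq_mul]
  have hab : |2 * (r / ‖t‖) * l.linear t| ≤ 1 := by
    rw [← e, abs_le]
    constructor <;> linarith [h0 _ m1, h0 _ m2, h1 _ m1, h1 _ m2]
  rw [abs_mul, abs_of_nonneg (by positivity)] at hab
  have : 2 * (r / ‖t‖) * |l.linear t| = (|l.linear t| * (2 * r)) / ‖t‖ := by field_simp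
  rwa [this, div_le_one ht'] at hab

/-- The affine function that is `1` at `x` and vanishes on the face opposite to the vertex `b`. -/
def hatPiece (B : SimplexBasis d) (x : Space d) (b : Fin (d + 1)) : Space d →ᵃ[ℝ] ℝ :=
  (B.coord b x)⁻¹ • B.coord b

/-- The affine function on the cell opposite to the vertex `b` that is `1` at the vertex `z` and
vanishes at `x` and at the other vertices. -/
def vertPiece (B : SimplexBasis d) (x : Space d) (b z : Fin (d + 1)) : Space d →ᵃ[ℝ] ℝ :=
  B.coord z - B.coord z x • hatPiece B x b

/-- The simplex with vertices `x` and all vertices of `B` but `b`. -/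
def cell (B : SimplexBasis d) (x : Space d) (b : Fin (d + 1)) : Set (Space d) :=
  {y | 0 ≤ B.coord b y ∧ ∀ i, hatPiece B x b y ≤ hatPiece B x i y}

/-- The interior of `cell B x b`. -/
def openCell (B : SimplexBasis d) (x : Space d) (b : Fin (d + 1)) : Set (Space d) :=
  {y | 0 < B.coord b y ∧ ∀ i, i ≠ b → hatPiece B x b y < hatPiece B x i y}

/-- The continuous piecewise affine function that is `1` at `x` and vanishes on the boundary. -/
def hat (B : SimplexBasis d) (x y : Space d) : ℝ :=
  Finset.univ.inf' Finset.univ_nonempty fun i => hatPiece B x i y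

section

variable {B : SimplexBasis d} {x : Space d}

@[simp]
theorem hatPiece_apply (b : Fin (d + 1)) (y : Space d) :
    hatPiece B x b y = (B.coord b x)⁻¹ * B.coord b y := rfl

@[simp]
theorem vertPiece_apply (b z : Fin (d + 1)) (y : Space d) :
    vertPiece B x b z y = B.coord z y - B.coord z x * hatPiece B x b y := rfl

theorem isOpen_openCell (b : Fin (d + 1)) : IsOpen (openCell B x b) := by
  have : openCell B x b = {y | 0 < B.coord b y} ∩
      ⋂ i, {y | i ≠ b → hatPiece B x b y < hatPiece B x i y} := by
    ext y; simp [openCell]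
  rw [this]
  refine (isOpen_lt continuous_const (affineMap_continuous _)).inter
    (isOpen_iInter_of_finite fun i => ?_)
  by_cases h : i = b
  · simp [h]
  · simpa [h] using isOpen_lt (affineMap_continuous (hatPiece B x b))
      (affineMap_continuous (hatPiece B x i))

theorem isClosed_cell (b : Fin (d + 1)) : IsClosed (cell B x b) := by
  have : cell B x b = {y | 0 ≤ B.coord b y} ∩
      ⋂ i, {y | hatPiece B x b y ≤ hatPiece B x i y} := by
    ext y; simp [cell]
  rw [this]
  exact (isClosed_le continuous_const (affineMap_continuous _)).inter
    (isClosed_iInter fun i => isClosed_le (affineMap_continuous _) (affineMap_continuous _))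

theorem openCell_subset_cell (b : Fin (d + 1)) : openCell B x b ⊆ cell B x b := by
  refine fun y hy => ⟨hy.1.le, fun i => ?_⟩
  by_cases h : i = b
  · rw [h]
  · exact (hy.2 i h).le

theorem convex_cell (b : Fin (d + 1)) : Convex ℝ (cell B x b) := by
  have : cell B x b = (B.coord b) ⁻¹' Set.Ici 0 ∩
      ⋂ i, (hatPiece B x i - hatPiece B x b) ⁻¹' Set.Ici 0 := by
    ext y; simp [cell]
  rw [this]
  exact ((convex_Ici 0).affine_preimage _).inter
    (convex_iInter fun i => (convex_Ici 0).affine_preimage _)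

theorem hatPiece_vertex (b z : Fin (d + 1)) :
    hatPiece B x b (B z) = if b = z then (B.coord b x)⁻¹ else 0 := by
  rw [hatPiece_apply, B.coord_apply]; split_ifs <;> simp

variable (hx : ∀ i, 0 < B.coord i x)

include hx

theorem hatPiece_self (b : Fin (d + 1)) : hatPiece B x b x = 1 := by
  rw [hatPiece_apply, inv_mul_cancel₀ (hx b).ne']

theorem coord_eq_mul_hatPiece (b : Fin (d + 1)) (y : Space d) :
    B.coord b y = B.coord b x * hatPiece B x b y := by
  rw [hatPiece_apply, mul_inv_cancel_left₀ (hx b).ne']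

/-- The vertex `b` is absent from the cell opposite to it. This vanishing later confines a
divergence term to a single cell. -/
theorem vertPiece_self (b : Fin (d + 1)) (y : Space d) : vertPiece B x b b y = 0 := by
  rw [vertPiece_apply, ← coord_eq_mul_hatPiece hx, sub_self]

-- Together with `hatPiece B x b`, the functions `vertPiece B x b z` are the barycentric coordinates
-- of the cell. With nonnegativity this bounds all of them by `1` there.
omit hx in
theorem sum_vertPiece (b : Fin (d + 1)) (y : Space d) :
    ∑ z, vertPiece B x b z y = 1 - hatPiece B x b y := by
  simp only [vertPiece_apply, Finset.sum_sub_distrib, ← Finset.sum_mul,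
    B.sum_coord_apply_eq_one, one_mul]

theorem coord_nonneg_of_mem_cell {b : Fin (d + 1)} {y : Space d} (hy : y ∈ cell B x b)
    (i : Fin (d + 1)) : 0 ≤ B.coord i y := by
  have h1 : 0 ≤ hatPiece B x b y := mul_nonneg (inv_nonneg.2 (hx b).le) hy.1
  rw [coord_eq_mul_hatPiece hx]
  exact mul_nonneg (hx i).le (h1.trans (hy.2 i))

omit hx in
theorem hat_eq_of_mem_cell {b : Fin (d + 1)} {y : Space d} (hy : y ∈ cell B x b) :
    hat B x y = hatPiece B x b y :=
  le_antisymm (Finset.inf'_le _ (Finset.mem_univ b)) (Finset.le_inf' _ _ fun i _ => hy.2 i)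

theorem hatPiece_nonneg {b : Fin (d + 1)} {y : Space d} (hy : y ∈ cell B x b) :
    0 ≤ hatPiece B x b y :=
  mul_nonneg (inv_nonneg.2 (hx b).le) hy.1

theorem vertPiece_nonneg {b : Fin (d + 1)} {y : Space d} (hy : y ∈ cell B x b)
    (z : Fin (d + 1)) : 0 ≤ vertPiece B x b z y := by
  rw [vertPiece_apply, coord_eq_mul_hatPiece hx z y, ← mul_sub]
  exact mul_nonneg (hx z).le (sub_nonneg.2 (hy.2 z))

theorem hatPiece_le_one {b : Fin (d + 1)} {y : Space d} (hy : y ∈ cell B x b) :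
    hatPiece B x b y ≤ 1 := by
  have := Finset.sum_nonneg fun z (_ : z ∈ Finset.univ) => vertPiece_nonneg hx hy z
  rw [sum_vertPiece] at this
  linarith

theorem vertPiece_le_one {b : Fin (d + 1)} {y : Space d} (hy : y ∈ cell B x b)
    (z : Fin (d + 1)) : vertPiece B x b z y ≤ 1 := by
  have := Finset.single_le_sum (fun z (_ : z ∈ Finset.univ) => vertPiece_nonneg hx hy z)
    (Finset.mem_univ z)
  rw [sum_vertPiece] at this
  linarith [hatPiece_nonneg hx hy]

omit hx in
theorem exists_mem_cell {y : Space d} (hy : ∀ i, 0 ≤ B.coord i y) : ∃ b, y ∈ cell B x b := by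
  obtain ⟨b, _, hb⟩ := Finset.exists_min_image Finset.univ (fun i => hatPiece B x i y)
    Finset.univ_nonempty
  exact ⟨b, hy b, fun i => hb i (Finset.mem_univ i)⟩

/-- Otherwise every barycentric coordinate of `y` would exceed that of `x`, although both families
sum to `1`. -/
theorem hat_le_one (y : Space d) : hat B x y ≤ 1 := by
  by_contra h
  push Not at h
  have h1 : ∀ i, B.coord i x < B.coord i y := fun i => by
    rw [coord_eq_mul_hatPiece hx i y]
    have : 1 < hatPiece B x i y := h.trans_le (Finset.inf'_le _ (Finset.mem_univ i))
    exact lt_mul_of_one_lt_right (hx i) this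
  have h2 := Finset.sum_lt_sum_of_nonempty Finset.univ_nonempty fun i (_ : i ∈ Finset.univ) => h1 i
  rw [B.sum_coord_apply_eq_one, B.sum_coord_apply_eq_one] at h2
  exact lt_irrefl _ h2

theorem hat_nonpos {y : Space d} (hy : ∃ b, B.coord b y ≤ 0) : hat B x y ≤ 0 := by
  obtain ⟨b, hb⟩ := hy
  exact (Finset.inf'_le _ (Finset.mem_univ b)).trans
    (mul_nonpos_of_nonneg_of_nonpos (inv_nonneg.2 (hx b).le) hb)

theorem coord_sub_mul_hat_nonneg (z : Fin (d + 1)) (y : Space d) :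
    0 ≤ B.coord z y - B.coord z x * hat B x y := by
  rw [coord_eq_mul_hatPiece hx z y, ← mul_sub]
  exact mul_nonneg (hx z).le (sub_nonneg.2 (Finset.inf'_le _ (Finset.mem_univ z)))

/-- The difference lies in finitely many zero sets of affine functions, each of them nonzero at the
vertex `B b`. -/
theorem volume_cell_diff_openCell (b : Fin (d + 1)) :
    volume (cell B x b \ openCell B x b) = 0 := by
  have hsub : cell B x b \ openCell B x b ⊆ {y | B.coord b y = 0} ∪
      ⋃ i : {i // i ≠ b}, {y | (hatPiece B x b - hatPiece B x i) y = 0} := by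
    rintro y ⟨h1, h2⟩
    by_contra h
    simp only [Set.mem_union, Set.mem_iUnion, not_or, not_exists] at h
    refine h2 ⟨lt_of_le_of_ne h1.1 (Ne.symm h.1), fun i hi => lt_of_le_of_ne (h1.2 i) fun he => ?_⟩
    exact h.2 ⟨i, hi⟩ (by simpa [sub_eq_zero] using he)
  refine measure_mono_null hsub (measure_union_null ?_ (measure_iUnion_null fun i => ?_))
  · exact coord_ne_zero_measure _ ⟨B b, by simp⟩
  · refine coord_ne_zero_measure _ ⟨B b, ?_⟩
    have : hatPiece B x (i : Fin (d + 1)) (B b) = 0 := by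
      rw [hatPiece_vertex, if_neg i.2]
    change hatPiece B x b (B b) - hatPiece B x (i : Fin (d + 1)) (B b) ≠ 0
    rw [this, hatPiece_vertex, if_pos rfl, sub_zero]
    exact inv_ne_zero (hx b).ne'

omit hx in
theorem eq_sum_of_cell (b : Fin (d + 1)) (y : Space d) :
    y = hatPiece B x b y • x + ∑ z, vertPiece B x b z y • B z := by
  simp only [vertPiece_apply, sub_smul, Finset.sum_sub_distrib, B.linear_combination_coord_eq_self]
  have : ∑ z, (B.coord z x * hatPiece B x b y) • B z = hatPiece B x b y • x := by
    have h := congrArg (hatPiece B x b y • ·) (B.linear_combination_coord_eq_self x)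
    simp only [Finset.smul_sum, smul_smul] at h
    rw [← h]
    exact Finset.sum_congr rfl fun z _ => by rw [mul_comm]
  rw [this]; abel

/-- Inequalities are convenient for estimates, vertices for the mesh; this links the two
descriptions. -/
theorem cell_eq_convexHull (b : Fin (d + 1)) :
    cell B x b = convexHull ℝ (insert x (B '' {i | i ≠ b})) := by
  apply Set.Subset.antisymm
  · intro y hy
    rw [eq_sum_of_cell b y]
    set S := insert x (B '' {i | i ≠ b})
    have key := (convex_convexHull ℝ S).sum_mem (t := Finset.univ)
      -- The index `b`, whose own weight is zero on this cell, carries the split point `x`.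
      (w := fun z => vertPiece B x b z y + if z = b then hatPiece B x b y else 0)
      (z := fun z => if z = b then x else B z) (fun z _ => ?_) ?_ (fun z _ => ?_)
    · convert key using 1
      have : ∀ z, (vertPiece B x b z y + if z = b then hatPiece B x b y else 0) •
          (if z = b then x else B z) =
          vertPiece B x b z y • B z + if z = b then hatPiece B x b y • x else 0 := fun z => by
        split_ifs with h
        · rw [h, vertPiece_self hx, zero_add, zero_smul, zero_add]
        · rw [add_zero, add_zero]
      simp_rw [this]
      rw [Finset.sum_add_distrib, Finset.sum_ite_eq', if_pos (Finset.mem_univ b), add_comm]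
    · refine add_nonneg (vertPiece_nonneg hx hy z) ?_
      split_ifs
      · exact hatPiece_nonneg hx hy
      · exact le_rfl
    · rw [Finset.sum_add_distrib, sum_vertPiece, Finset.sum_ite_eq', if_pos (Finset.mem_univ b)]
      ring
    · split_ifs with h
      · exact subset_convexHull _ _ (Set.mem_insert _ _)
      · exact subset_convexHull _ _ (Set.mem_insert_of_mem _ ⟨z, h, rfl⟩)
  · refine convexHull_min ?_ (convex_cell b)
    rintro y (rfl | ⟨i, hi, rfl⟩)
    · exact ⟨(hx b).le, fun i => by rw [hatPiece_self hx, hatPiece_self hx]⟩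
    · refine ⟨by rw [B.coord_apply]; split_ifs <;> norm_num, fun j => ?_⟩
      rw [hatPiece_vertex, if_neg (Ne.symm hi), hatPiece_vertex]
      split_ifs
      · exact inv_nonneg.2 (hx j).le
      · exact le_rfl

end

/-! ### Bounded Lipschitz functions -/

/-- Bounded Lipschitz functions. -/
def IsBddLip (f : Space d → ℝ) : Prop :=
  (∃ L, LipschitzWith L f) ∧ ∃ M, ∀ y, |f y| ≤ M

theorem IsBddLip.const (a : ℝ) : IsBddLip fun _ : Space d => a :=
  ⟨⟨0, LipschitzWith.const a⟩, |a|, fun _ => le_rfl⟩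

theorem IsBddLip.mul {f g : Space d → ℝ} (hf : IsBddLip f) (hg : IsBddLip g) :
    IsBddLip fun y => f y * g y := by
  obtain ⟨⟨L, hL⟩, M, hM⟩ := hf
  obtain ⟨⟨L', hL'⟩, M', hM'⟩ := hg
  have hM0 : 0 ≤ M := (abs_nonneg _).trans (hM 0)
  have hM0' : 0 ≤ M' := (abs_nonneg _).trans (hM' 0)
  refine ⟨⟨M.toNNReal * L' + M'.toNNReal * L, LipschitzWith.of_dist_le_mul fun y z => ?_⟩,
    M * M', fun y => ?_⟩
  · rw [Real.dist_eq, show f y * g y - f z * g z = f y * (g y - g z) + g z * (f y - f z) by ring]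
    have h1 := hL.dist_le_mul y z
    have h2 := hL'.dist_le_mul y z
    rw [Real.dist_eq] at h1 h2
    refine (abs_add_le _ _).trans ?_
    rw [abs_mul, abs_mul]
    have a1 := mul_le_mul (hM y) h2 (abs_nonneg _) hM0
    have a2 := mul_le_mul (hM' z) h1 (abs_nonneg _) hM0'
    push_cast
    rw [Real.coe_toNNReal _ hM0, Real.coe_toNNReal _ hM0']
    linarith
  · rw [abs_mul]
    exact mul_le_mul (hM y) (hM' y) (abs_nonneg _) hM0

theorem IsBddLip.pow {f : Space d → ℝ} (hf : IsBddLip f) (n : ℕ) : IsBddLip fun y => f y ^ n := by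
  induction n with
  | zero => simpa using IsBddLip.const 1
  | succ n ih => simpa only [pow_succ] using ih.mul hf

theorem IsBddLip.prod {τ : Type*} (S : Finset τ) {f : τ → Space d → ℝ}
    (hf : ∀ s, IsBddLip (f s)) : IsBddLip fun y => ∏ s ∈ S, f s y := by
  classical
  induction S using Finset.induction_on with
  | empty => simpa using IsBddLip.const 1
  | insert s S hs ih => simpa only [Finset.prod_insert hs] using (hf s).mul ih

theorem affineMap_lipschitz (l : Space d →ᵃ[ℝ] ℝ) : ∃ L, LipschitzWith L l := by
  refine ⟨‖LinearMap.toContinuousLinearMap l.linear‖₊, LipschitzWith.of_dist_le_mul fun y z => ?_⟩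
  rw [Real.dist_eq, ← affineMap_linear_sub, dist_eq_norm]
  exact (LinearMap.toContinuousLinearMap l.linear).le_opNorm (y - z)

theorem hat_lipschitz (B : SimplexBasis d) (x : Space d) : ∃ L, LipschitzWith L (hat B x) := by
  have h : hat B x = Finset.univ.inf' Finset.univ_nonempty
      fun i => (hatPiece B x i : Space d → ℝ) := by
    ext y; simp [hat, Finset.inf'_apply]
  rw [h]
  refine Finset.inf'_induction (p := fun f : Space d → ℝ => ∃ L, LipschitzWith L f) _ _ ?_
    fun b _ => affineMap_lipschitz _
  rintro f ⟨L, hL⟩ g ⟨L', hL'⟩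
  exact ⟨_, hL.min hL'⟩

/-- Truncation at `0` extends the hat function by zero outside the simplex. -/
theorem isBddLip_hat_pos {B : SimplexBasis d} {x : Space d} (hx : ∀ i, 0 < B.coord i x) :
    IsBddLip fun y => max (hat B x y) 0 := by
  obtain ⟨L, hL⟩ := hat_lipschitz B x
  refine ⟨⟨L, hL.max_const 0⟩, 1, fun y => ?_⟩
  rw [abs_of_nonneg (le_max_right _ _)]
  exact max_le (hat_le_one hx y) zero_le_one

/-- Truncation at `1` is invisible on the cells, but it makes the function bounded on the whole
space, so that products remain Lipschitz. -/
theorem isBddLip_vert {B : SimplexBasis d} {x : Space d} (hx : ∀ i, 0 < B.coord i x)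
    (z : Fin (d + 1)) : IsBddLip fun y => min (B.coord z y - B.coord z x * hat B x y) 1 := by
  obtain ⟨L, hL⟩ := hat_lipschitz B x
  obtain ⟨L', hL'⟩ := affineMap_lipschitz (B.coord z)
  refine ⟨⟨_, (hL'.sub ((lipschitzWith_smul (B.coord z x)).comp hL)).min_const 1⟩, 1, fun y => ?_⟩
  rw [abs_of_nonneg (le_min (coord_sub_mul_hat_nonneg hx z y) zero_le_one)]
  exact min_le_right _ _

/-! ### Derivations of products -/

theorem derivation_prod {A : Type*} [CommRing A] [Algebra ℝ A] (D : Derivation ℝ A A)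
    {τ : Type*} [DecidableEq τ] (S : Finset τ) (f : τ → A) :
    D (∏ s ∈ S, f s) = ∑ s ∈ S, D (f s) * ∏ s' ∈ S.erase s, f s' := by
  induction S using Finset.induction_on with
  | empty => simp
  | insert a S ha ih =>
    rw [Finset.prod_insert ha, D.leibniz, ih, Finset.sum_insert ha, Finset.erase_insert ha,
      smul_eq_mul, smul_eq_mul, Finset.mul_sum, add_comm, mul_comm]
    congr 1
    refine Finset.sum_congr rfl fun s hs => ?_
    have hsa : a ≠ s := fun h => ha (h ▸ hs)
    rw [Finset.erase_insert_of_ne hsa,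
      Finset.prod_insert (fun h => ha (Finset.mem_of_mem_erase h))]
    ring

/-- The derivative of a polynomial in the direction `t`. -/
def dirDeriv (t : Space d) : Derivation ℝ (MvPolynomial (Fin d) ℝ) (MvPolynomial (Fin d) ℝ) :=
  MvPolynomial.mkDerivation ℝ fun i => MvPolynomial.C (t i)

theorem dirDeriv_eq_sum (t : Space d) (p : MvPolynomial (Fin d) ℝ) :
    dirDeriv t p = ∑ i, MvPolynomial.C (t i) * MvPolynomial.pderiv i p := by
  induction p using MvPolynomial.induction_on with
  | C a => simp [dirDeriv]
  | add p q hp hq => simp only [map_add, mul_add, Finset.sum_add_distrib, hp, hq]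
  | mul_X p j hp =>
    simp only [Derivation.leibniz, smul_eq_mul, mul_add, Finset.sum_add_distrib, hp]
    congr 1
    · rw [Finset.sum_eq_single j]
      · simp [dirDeriv, mul_comm]
      · intro b _ hb
        simp [MvPolynomial.pderiv_X_of_ne hb.symm]
      · simp
    · rw [Finset.mul_sum]
      exact Finset.sum_congr rfl fun i _ => by ring

theorem dirDeriv_affPoly (t : Space d) (l : Space d →ᵃ[ℝ] ℝ) :
    dirDeriv t (affPoly l) = MvPolynomial.C (l.linear t) := by
  rw [dirDeriv_eq_sum, linear_apply_eq_sum, map_sum]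
  refine Finset.sum_congr rfl fun i _ => ?_
  rw [pderiv_affPoly, mul_comm, map_mul]

/-- At `y`, the polynomial is at most `1` and its partial derivatives are at most `n * G`. -/
def IsTame (y : Space d) (G : ℝ) (n : ℕ) (p : MvPolynomial (Fin d) ℝ) : Prop :=
  |evalAt y p| ≤ 1 ∧ ∀ j, |evalAt y (MvPolynomial.pderiv j p)| ≤ n * G

theorem IsTame.one (y : Space d) (G : ℝ) : IsTame y G 0 1 := by
  simp [IsTame]

theorem IsTame.mul {y : Space d} {G : ℝ} {m n : ℕ} {p q : MvPolynomial (Fin d) ℝ}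
    (hp : IsTame y G m p) (hq : IsTame y G n q) : IsTame y G (m + n) (p * q) := by
  refine ⟨by rw [map_mul, abs_mul]; exact mul_le_one₀ hp.1 (abs_nonneg _) hq.1, fun j => ?_⟩
  rw [Derivation.leibniz, smul_eq_mul, smul_eq_mul, map_add, map_mul, map_mul]
  refine (abs_add_le _ _).trans ?_
  rw [abs_mul, abs_mul]
  have h1 := mul_le_of_le_one_left (abs_nonneg (evalAt y (MvPolynomial.pderiv j q))) hp.1
  have h2 := mul_le_of_le_one_left (abs_nonneg (evalAt y (MvPolynomial.pderiv j p))) hq.1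
  have h3 := hp.2 j
  have h4 := hq.2 j
  push_cast
  linarith

theorem IsTame.pow {y : Space d} {G : ℝ} {p : MvPolynomial (Fin d) ℝ}
    (hp : IsTame y G 1 p) (n : ℕ) : IsTame y G n (p ^ n) := by
  induction n with
  | zero => simpa using IsTame.one y G
  | succ n ih => simpa only [pow_succ] using ih.mul hp

theorem IsTame.prod {y : Space d} {G : ℝ} {τ : Type*} (S : Finset τ)
    {p : τ → MvPolynomial (Fin d) ℝ} (hp : ∀ s, IsTame y G 1 (p s)) :
    IsTame y G S.card (∏ s ∈ S, p s) := by
  classical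
  induction S using Finset.induction_on with
  | empty => simpa using IsTame.one y G
  | insert s S hs ih =>
    rw [Finset.prod_insert hs, Finset.card_insert_of_notMem hs, add_comm]
    exact (hp s).mul ih

/-! ### Divergences of local fields -/

/-- `f` is the piecewise divergence of a continuous field on the split simplex that is piecewise
polynomial of degree at most `k`, vanishes on the boundary, and has derivatives at most `C`. -/
def IsLocalDiv (B : SimplexBasis d) (x : Space d) (k : ℕ) (C : ℝ)
    (f : Fin (d + 1) → MvPolynomial (Fin d) ℝ) : Prop :=
  ∃ (v : Fin d → Space d → ℝ) (P : Fin (d + 1) → Fin d → MvPolynomial (Fin d) ℝ),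
    (∀ i, ∃ L, LipschitzWith L (v i)) ∧
    (∀ i y, (∃ b, B.coord b y ≤ 0) → v i y = 0) ∧
    (∀ b i, (P b i).totalDegree ≤ k) ∧
    (∀ b i, ∀ y ∈ cell B x b, v i y = evalAt y (P b i)) ∧
    (∀ b i j, ∀ y ∈ cell B x b, |evalAt y (MvPolynomial.pderiv j (P b i))| ≤ C) ∧
    ∀ b, ∑ i, MvPolynomial.pderiv i (P b i) = f b

section

variable {B : SimplexBasis d} {x : Space d} {k : ℕ}

theorem IsLocalDiv.zero : IsLocalDiv B x k 0 0 :=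
  ⟨fun _ _ => 0, fun _ _ => 0, fun _ => ⟨0, LipschitzWith.const 0⟩, by simp, by simp, by simp,
    by simp, by simp⟩

theorem IsLocalDiv.mono {C C' : ℝ} {f : Fin (d + 1) → MvPolynomial (Fin d) ℝ}
    (h : IsLocalDiv B x k C f) (hC : C ≤ C') : IsLocalDiv B x k C' f := by
  obtain ⟨v, P, h1, h2, h3, h4, h5, h6⟩ := h
  exact ⟨v, P, h1, h2, h3, h4, fun b i j y hy => (h5 b i j y hy).trans hC, h6⟩

theorem IsLocalDiv.add {C C' : ℝ} {f f' : Fin (d + 1) → MvPolynomial (Fin d) ℝ}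
    (h : IsLocalDiv B x k C f) (h' : IsLocalDiv B x k C' f') :
    IsLocalDiv B x k (C + C') (f + f') := by
  obtain ⟨v, P, h1, h2, h3, h4, h5, h6⟩ := h
  obtain ⟨v', P', h1', h2', h3', h4', h5', h6'⟩ := h'
  refine ⟨fun i y => v i y + v' i y, fun b i => P b i + P' b i, fun i => ?_, fun i y hy => ?_,
    fun b i => ?_, fun b i y hy => ?_, fun b i j y hy => ?_, fun b => ?_⟩
  · obtain ⟨L, hL⟩ := h1 i
    obtain ⟨L', hL'⟩ := h1' i
    exact ⟨_, hL.add hL'⟩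
  · simp only [h2 i y hy, h2' i y hy, add_zero]
  · exact (MvPolynomial.totalDegree_add _ _).trans (max_le (h3 b i) (h3' b i))
  · simp only [map_add, h4 b i y hy, h4' b i y hy]
  · rw [map_add, map_add]
    exact (abs_add_le _ _).trans (add_le_add (h5 b i j y hy) (h5' b i j y hy))
  · simp only [map_add, Finset.sum_add_distrib, h6, h6', Pi.add_apply]

theorem IsLocalDiv.smul {C : ℝ} {f : Fin (d + 1) → MvPolynomial (Fin d) ℝ}
    (h : IsLocalDiv B x k C f) (a : ℝ) : IsLocalDiv B x k (|a| * C) (a • f) := by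
  obtain ⟨v, P, h1, h2, h3, h4, h5, h6⟩ := h
  refine ⟨fun i y => a * v i y, fun b i => a • P b i, fun i => ?_, fun i y hy => ?_,
    fun b i => ?_, fun b i y hy => ?_, fun b i j y hy => ?_, fun b => ?_⟩
  · obtain ⟨L, hL⟩ := h1 i
    exact ⟨_, (lipschitzWith_smul a).comp hL⟩
  · simp only [h2 i y hy, mul_zero]
  · exact (MvPolynomial.totalDegree_smul_le _ _).trans (h3 b i)
  · simp only [MvPolynomial.smul_eval, h4 b i y hy]
  · rw [Derivation.map_smul, MvPolynomial.smul_eval, abs_mul]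
    exact mul_le_mul_of_nonneg_left (h5 b i j y hy) (abs_nonneg a)
  · simp only [Derivation.map_smul, ← Finset.smul_sum, h6, Pi.smul_apply]

/-- The polynomials `M_b` and `N_{b, z}` describing the split simplex. -/
abbrev hatPoly (B : SimplexBasis d) (x : Space d) (b : Fin (d + 1)) : MvPolynomial (Fin d) ℝ :=
  affPoly (hatPiece B x b)

/-- See `hatPoly`. -/
abbrev vertPoly (B : SimplexBasis d) (x : Space d) (b z : Fin (d + 1)) :
    MvPolynomial (Fin d) ℝ :=
  affPoly (vertPiece B x b z)

/-- The `n`-th power of the hat function on the cell opposite to the vertex `0`. -/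
def hatPow (B : SimplexBasis d) (x : Space d) (n : ℕ) (b : Fin (d + 1)) :
    MvPolynomial (Fin d) ℝ :=
  if b = 0 then hatPoly B x 0 ^ n else 0

/-- Being a local divergence up to a multiple of the `n`-th power of the hat function on one
cell; the degree of the field is `n + 1`. -/
def IsLocalDivMod (B : SimplexBasis d) (x : Space d) (n : ℕ) (C : ℝ)
    (f : Fin (d + 1) → MvPolynomial (Fin d) ℝ) : Prop :=
  ∃ c : ℝ, IsLocalDiv B x (n + 1) C (f - c • hatPow B x n)

variable {n : ℕ}

theorem IsLocalDiv.isLocalDivMod {C : ℝ} {f : Fin (d + 1) → MvPolynomial (Fin d) ℝ}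
    (h : IsLocalDiv B x (n + 1) C f) : IsLocalDivMod B x n C f :=
  ⟨0, by simpa using h⟩

theorem IsLocalDivMod.mono {C C' : ℝ} {f : Fin (d + 1) → MvPolynomial (Fin d) ℝ}
    (h : IsLocalDivMod B x n C f) (hC : C ≤ C') : IsLocalDivMod B x n C' f := by
  obtain ⟨c, h⟩ := h
  exact ⟨c, h.mono hC⟩

theorem IsLocalDivMod.add {C C' : ℝ} {f f' : Fin (d + 1) → MvPolynomial (Fin d) ℝ}
    (h : IsLocalDivMod B x n C f) (h' : IsLocalDivMod B x n C' f') :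
    IsLocalDivMod B x n (C + C') (f + f') := by
  obtain ⟨c, h⟩ := h
  obtain ⟨c', h'⟩ := h'
  refine ⟨c + c', ?_⟩
  have := h.add h'
  rwa [sub_add_sub_comm, ← add_smul] at this

theorem IsLocalDivMod.smul {C : ℝ} {f : Fin (d + 1) → MvPolynomial (Fin d) ℝ}
    (h : IsLocalDivMod B x n C f) (a : ℝ) : IsLocalDivMod B x n (|a| * C) (a • f) := by
  obtain ⟨c, h⟩ := h
  refine ⟨a * c, ?_⟩
  have := h.smul a
  rwa [smul_sub, smul_smul] at this

theorem IsLocalDivMod.sum {τ : Type*} (S : Finset τ) {C : ℝ}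
    {f : τ → Fin (d + 1) → MvPolynomial (Fin d) ℝ} (h : ∀ s ∈ S, IsLocalDivMod B x n C (f s)) :
    IsLocalDivMod B x n (S.card * C) (∑ s ∈ S, f s) := by
  classical
  induction S using Finset.induction_on with
  | empty => simpa using IsLocalDiv.zero.isLocalDivMod
  | insert s S hs ih =>
    rw [Finset.sum_insert hs, Finset.card_insert_of_notMem hs]
    have := (h s (Finset.mem_insert_self _ _)).add
      (ih fun s' hs' => h s' (Finset.mem_insert_of_mem hs'))
    refine this.mono (le_of_eq ?_)
    push_cast; ring

end

/-! ### Regular splits, bubble fields and the reduction of monomials -/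

/-- The closed simplex with vertices `B`. -/
def simplexSet (B : SimplexBasis d) : Set (Space d) := {y | ∀ i, 0 ≤ B.coord i y}

/-- The simplex with split point `x` in its interior is `D`-regular: each cell contains a ball whose
radius is comparable to the diameter of the simplex. -/
def RegularSplit (B : SimplexBasis d) (x : Space d) (D : ℝ) : Prop :=
  ∀ b, ∃ (c : Space d) (r : ℝ), 0 < r ∧ closedBall c r ⊆ cell B x b ∧
    ∀ y ∈ simplexSet B, ∀ y' ∈ simplexSet B, dist y y' ≤ D * r

theorem vertex_mem_simplexSet (B : SimplexBasis d) (i : Fin (d + 1)) : B i ∈ simplexSet B := by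
  intro j
  rw [B.coord_apply]; split_ifs <;> norm_num

theorem evalAt_pderiv_affPoly (l : Space d →ᵃ[ℝ] ℝ) (j : Fin d) (y : Space d) :
    evalAt y (MvPolynomial.pderiv j (affPoly l)) = l.linear (EuclideanSpace.single j 1) := by
  rw [pderiv_affPoly, MvPolynomial.eval_C]

section

variable {B : SimplexBasis d} {x : Space d} (hx : ∀ i, 0 < B.coord i x)

include hx

theorem cell_subset_simplexSet (b : Fin (d + 1)) : cell B x b ⊆ simplexSet B :=
  fun _ hy i => coord_nonneg_of_mem_cell hx hy i

/-- The barycentric coordinates of a cell take values in `[0, 1]` on its inscribed ball, so their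
slopes are at most `G = 1 / r`. The last clause makes slopes along differences of points of the
simplex scale-invariantly bounded by `D`. -/
theorem RegularSplit.slope {D : ℝ} (h : RegularSplit B x D) (b : Fin (d + 1)) :
    ∃ G : ℝ, 0 ≤ G ∧ (∀ t, |(hatPiece B x b).linear t| ≤ ‖t‖ * G) ∧
      (∀ z t, |(vertPiece B x b z).linear t| ≤ ‖t‖ * G) ∧
      ∀ y ∈ simplexSet B, ∀ y' ∈ simplexSet B, ‖y - y'‖ * G ≤ D := by
  obtain ⟨c, r, hr, hsub, hD⟩ := h b
  have key : ∀ l : Space d →ᵃ[ℝ] ℝ, (∀ y ∈ cell B x b, 0 ≤ l y) → (∀ y ∈ cell B x b, l y ≤ 1) →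
      ∀ t, |l.linear t| ≤ ‖t‖ * r⁻¹ := by
    intro l h0 h1 t
    have := abs_linear_mul_le l hr.le (fun y hy => h0 y (hsub hy)) (fun y hy => h1 y (hsub hy)) t
    rw [← div_eq_mul_inv, le_div_iff₀ hr]
    nlinarith [abs_nonneg (l.linear t)]
  refine ⟨r⁻¹, inv_nonneg.2 hr.le, key _ (fun y hy => hatPiece_nonneg hx hy)
    (fun y hy => hatPiece_le_one hx hy), fun z => key _ (fun y hy => vertPiece_nonneg hx hy z)
    (fun y hy => vertPiece_le_one hx hy z), fun y hy y' hy' => ?_⟩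
  rw [← dist_eq_norm, ← div_eq_mul_inv, div_le_iff₀ hr]
  exact hD y hy y' hy'

/-- Bubble functions times a constant vector. -/
theorem isLocalDiv_bubble {D : ℝ} (hD : RegularSplit B x D) {τ : Type*} (j : ℕ) (S : Finset τ)
    (z : τ → Fin (d + 1)) {p q : Space d} (hp : p ∈ simplexSet B) (hq : q ∈ simplexSet B)
    {α : ℝ} (hα : |α| ≤ 1) :
    IsLocalDiv B x (j + 1 + S.card) (((j + 1 + S.card : ℕ) : ℝ) * D) fun b =>
      α • dirDeriv (p - q) (hatPoly B x b ^ (j + 1) * ∏ s ∈ S, vertPoly B x b (z s)) := by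
  have hpq : ∀ i, |(p - q) i| ≤ ‖p - q‖ := fun i => PiLp.norm_apply_le (p - q) i
  set t := p - q with ht
  -- The truncated global functions give the Lipschitz field; on each cell they reduce to the
  -- untruncated affine pieces. The exponent `j + 1` is positive, so the field vanishes wherever the
  -- hat function is nonpositive.
  refine ⟨fun i y => α * t i * (max (hat B x y) 0 ^ (j + 1) *
      ∏ s ∈ S, min (B.coord (z s) y - B.coord (z s) x * hat B x y) 1),
    fun b i => MvPolynomial.C (α * t i) *
      (hatPoly B x b ^ (j + 1) * ∏ s ∈ S, vertPoly B x b (z s)),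
    fun i => ?_, fun i y hy => ?_, fun b i => ?_, fun b i y hy => ?_, fun b i l y hy => ?_,
    fun b => ?_⟩
  · exact ((IsBddLip.const (α * t i)).mul (((isBddLip_hat_pos hx).pow (j + 1)).mul
      (IsBddLip.prod S fun s => isBddLip_vert hx (z s)))).1
  · simp only
    rw [max_eq_right (hat_nonpos hx hy), zero_pow (Nat.succ_ne_zero j), zero_mul, mul_zero]
  · refine (MvPolynomial.totalDegree_mul _ _).trans ?_
    rw [MvPolynomial.totalDegree_C, zero_add]
    refine (MvPolynomial.totalDegree_mul _ _).trans (add_le_add ?_ ?_)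
    · refine (MvPolynomial.totalDegree_pow _ _).trans ?_
      calc _ ≤ (j + 1) * 1 := Nat.mul_le_mul_left _ (totalDegree_affPoly_le _)
        _ = _ := mul_one _
    · refine (MvPolynomial.totalDegree_finsetProd _ _).trans ?_
      calc _ ≤ ∑ _s ∈ S, 1 := Finset.sum_le_sum fun s _ => totalDegree_affPoly_le _
        _ = _ := by simp
  · simp only [map_mul, map_pow, map_prod, MvPolynomial.eval_C, evalAt_affPoly]
    rw [hat_eq_of_mem_cell hy, max_eq_left (hatPiece_nonneg hx hy)]
    congr 2
    refine Finset.prod_congr rfl fun s _ => ?_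
    exact min_eq_left (vertPiece_le_one hx hy (z s))
  · obtain ⟨G, hG0, h1, h2, h3⟩ := hD.slope hx b
    have hn : ‖(EuclideanSpace.single l 1 : Space d)‖ = 1 := by simp
    have tM : IsTame y G 1 (hatPoly B x b) := by
      refine ⟨?_, fun l => ?_⟩
      · rw [evalAt_affPoly, abs_of_nonneg (hatPiece_nonneg hx hy)]
        exact hatPiece_le_one hx hy
      · rw [evalAt_pderiv_affPoly]
        simpa using h1 (EuclideanSpace.single l 1)
    have tN : ∀ s, IsTame y G 1 (vertPoly B x b (z s)) := by
      refine fun s => ⟨?_, fun l => ?_⟩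
      · rw [evalAt_affPoly, abs_of_nonneg (vertPiece_nonneg hx hy _)]
        exact vertPiece_le_one hx hy _
      · rw [evalAt_pderiv_affPoly]
        simpa using h2 (z s) (EuclideanSpace.single l 1)
    have hT := ((tM.pow (j + 1)).mul (IsTame.prod S tN)).2 l
    rw [MvPolynomial.pderiv_C_mul, map_mul, MvPolynomial.eval_C, abs_mul, abs_mul]
    have h4 := h3 p hp q hq
    have h5 : |α| * |t i| ≤ ‖p - q‖ := by
      calc _ ≤ 1 * ‖p - q‖ := mul_le_mul hα (hpq i) (abs_nonneg _) zero_le_one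
        _ = _ := one_mul _
    calc _ ≤ ‖p - q‖ * (((j + 1 + S.card : ℕ) : ℝ) * G) :=
          mul_le_mul h5 hT (abs_nonneg _) (norm_nonneg _)
      _ = ((j + 1 + S.card : ℕ) : ℝ) * (‖p - q‖ * G) := by ring
      _ ≤ _ := by gcongr
  · simp only [dirDeriv_eq_sum, Finset.smul_sum]
    refine Finset.sum_congr rfl fun i _ => ?_
    rw [MvPolynomial.pderiv_C_mul, MvPolynomial.smul_eq_C_mul, map_mul, mul_assoc]

theorem vertPoly_self (b : Fin (d + 1)) : vertPoly B x b b = 0 :=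
  evalAt_injective fun y => by rw [evalAt_affPoly, vertPiece_self hx, map_zero]

theorem coord_le_one_of_pos (b : Fin (d + 1)) : B.coord b x ≤ 1 := by
  rw [← B.sum_coord_apply_eq_one x]
  exact Finset.single_le_sum (f := fun i => B.coord i x) (fun i _ => (hx i).le) (Finset.mem_univ b)

/-- The monomial `M ^ j * ∏ N_{z s}` supported on the cell opposite to `a`. -/
def cellMonomial (B : SimplexBasis d) (x : Space d) {τ : Type*} (a : Fin (d + 1)) (j : ℕ)
    (S : Finset τ) (z : τ → Fin (d + 1)) (b : Fin (d + 1)) : MvPolynomial (Fin d) ℝ :=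
  if b = a then hatPoly B x b ^ j * ∏ s ∈ S, vertPoly B x b (z s) else 0

-- On a cell the hat function depends on a single coordinate `B.coord b`, which changes along an
-- edge only if `b` is one of its ends. Hence at most two cells contribute.
omit hx in
theorem hatPiece_linear_sub (b a z : Fin (d + 1)) :
    (hatPiece B x b).linear (B a - B z) =
      (if b = a then (B.coord b x)⁻¹ else 0) - if b = z then (B.coord b x)⁻¹ else 0 := by
  rw [affineMap_linear_sub, hatPiece_vertex, hatPiece_vertex]

/-- The bubble `M ^ (n + 1)` along `B a - B 0` trades `M ^ n` on the cell opposite to `a` for a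
multiple of `M ^ n` on the cell opposite to `0`. -/
theorem isLocalDivMod_hatPow {D : ℝ} (hD : RegularSplit B x D) {τ : Type*} (n : ℕ)
    (a : Fin (d + 1)) (z : τ → Fin (d + 1)) :
    IsLocalDivMod B x n (((n + 1 : ℕ) : ℝ) * D) (cellMonomial B x a n ∅ z) := by
  -- Cancels the slope of the hat function on the cell opposite to `a` and the exponent from
  -- differentiation, while keeping `|α| ≤ 1` however close `x` is to the boundary.
  set α : ℝ := B.coord a x / (n + 1) with hα
  have hα1 : |α| ≤ 1 := by
    rw [abs_of_nonneg (div_nonneg (hx a).le (by positivity)), div_le_one (by positivity)]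
    linarith [coord_le_one_of_pos hx a, n.cast_nonneg (α := ℝ)]
  have h := isLocalDiv_bubble hx hD n (∅ : Finset τ) z (vertex_mem_simplexSet B a)
    (vertex_mem_simplexSet B 0) hα1
  -- This ratio is not bounded uniformly, which is harmless because only the field enters the
  -- estimate.
  refine ⟨B.coord a x * (B.coord 0 x)⁻¹, ?_⟩
  simp only [Finset.card_empty, add_zero] at h
  convert h using 1
  ext1 b
  refine evalAt_injective fun y => ?_
  have hn : ((n : ℝ) + 1) ≠ 0 := by positivity
  have ha := (hx a).ne'
  have h0 := (hx 0).ne'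
  have e1 : evalAt y (α • dirDeriv (B a - B 0) (hatPoly B x b ^ (n + 1) *
      ∏ s ∈ (∅ : Finset τ), vertPoly B x b (z s))) = B.coord a x * hatPiece B x b y ^ n *
      ((if b = a then (B.coord b x)⁻¹ else 0) - if b = 0 then (B.coord b x)⁻¹ else 0) := by
    rw [Finset.prod_empty, mul_one, Derivation.leibniz_pow, dirDeriv_affPoly, hatPiece_linear_sub,
      MvPolynomial.smul_eval, nsmul_eq_mul, smul_eq_mul]
    simp only [map_mul, map_pow, evalAt_affPoly, map_natCast, MvPolynomial.eval_C,
      add_tsub_cancel_right, hα]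
    push_cast
    field_simp
  rw [e1]
  simp only [Pi.sub_apply, Pi.smul_apply, cellMonomial, hatPow, map_sub, Finset.prod_empty, mul_one,
    MvPolynomial.smul_eval]
  rcases eq_or_ne b a with rfl | h1
  · rcases eq_or_ne b 0 with h2 | h2
    · subst h2
      simp [h0]
    · simp only [h2, if_true, if_false, map_pow, evalAt_affPoly, map_zero]
      field_simp
      ring
  · rcases eq_or_ne b 0 with h2 | h2
    · subst h2
      simp only [h1, if_true, if_false, map_pow, evalAt_affPoly, map_zero]
      ring
    · simp [h1, h2]

/-- Reduction of monomials modulo divergences. -/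
theorem isLocalDivMod_cellMonomial_succ {D : ℝ} (hD : RegularSplit B x D) {τ : Type*}
    [DecidableEq τ] {n j N : ℕ} {C : ℝ} (hC : 0 ≤ C)
    (ih : ∀ (a : Fin (d + 1)) (S : Finset τ) (z : τ → Fin (d + 1)), S.card = N →
      IsLocalDivMod B x n C (cellMonomial B x a (j + 1) S z))
    (a : Fin (d + 1)) (S : Finset τ) (z : τ → Fin (d + 1)) (hS : S.card = N + 1)
    (hn : j + (N + 1) = n) :
    IsLocalDivMod B x n (((n + 1 : ℕ) : ℝ) * D + ((d + 1 : ℕ) : ℝ) * ((N + 1 : ℕ) * (D * C)))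
      (cellMonomial B x a j S z) := by
  obtain ⟨s₀, hs₀⟩ : S.Nonempty := Finset.card_pos.1 (by omega)
  have hD0 : 0 ≤ D := by
    obtain ⟨G, hG0, -, -, h3⟩ := hD.slope hx a
    exact (mul_nonneg (norm_nonneg _) hG0).trans
      (h3 _ (vertex_mem_simplexSet B a) _ (vertex_mem_simplexSet B a))
  -- If `a = z s₀`, the monomial contains a factor that vanishes on its own cell.
  rcases eq_or_ne a (z s₀) with haz | haz
  · have : cellMonomial B x a j S z = 0 := by
      ext1 b
      rw [cellMonomial, Pi.zero_apply]
      split_ifs with hb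
      · rw [Finset.prod_eq_zero hs₀ (by rw [hb, ← haz, vertPoly_self hx]), mul_zero]
      · rfl
    rw [this]
    exact IsLocalDiv.zero.isLocalDivMod.mono (by positivity)
  set α : ℝ := B.coord a x / (j + 1) with hα
  have hα1 : |α| ≤ 1 := by
    rw [abs_of_nonneg (div_nonneg (hx a).le (by positivity)), div_le_one (by positivity)]
    linarith [coord_le_one_of_pos hx a, j.cast_nonneg (α := ℝ)]
  have hbub := isLocalDiv_bubble hx hD j S z (vertex_mem_simplexSet B a)
    (vertex_mem_simplexSet B (z s₀)) hα1
  rw [show j + 1 + S.card = n + 1 by omega] at hbub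
  set t := B a - B (z s₀) with ht
  have hlin : ∀ b w, |α * (vertPiece B x b w).linear t| ≤ D := fun b w => by
    obtain ⟨G, -, -, h2, h3⟩ := hD.slope hx b
    rw [abs_mul]
    calc _ ≤ 1 * |(vertPiece B x b w).linear t| := by gcongr
      _ ≤ ‖t‖ * G := by rw [one_mul]; exact h2 w t
      _ ≤ D := h3 _ (vertex_mem_simplexSet B a) _ (vertex_mem_simplexSet B (z s₀))
  -- Differentiating one of the vertex factors leaves the power `j + 1` and `N` factors, to which
  -- `ih` applies. These terms occur on all cells, hence the factors `d + 1` and `N + 1`.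
  have hrest : IsLocalDivMod B x n (((d + 1 : ℕ) : ℝ) * ((N + 1 : ℕ) * (D * C)))
      (∑ b' : Fin (d + 1), ∑ s ∈ S, (-(α * (vertPiece B x b' (z s)).linear t)) •
        cellMonomial B x b' (j + 1) (S.erase s) z) := by
    have := IsLocalDivMod.sum (B := B) (x := x) (n := n) (Finset.univ : Finset (Fin (d + 1)))
      (C := (N + 1 : ℕ) * (D * C)) (f := fun b' => ∑ s ∈ S,
        (-(α * (vertPiece B x b' (z s)).linear t)) • cellMonomial B x b' (j + 1) (S.erase s) z)
      fun b' _ => ?_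
    · simpa using this
    · rw [← hS]
      refine IsLocalDivMod.sum S fun s hs => ?_
      refine ((ih b' (S.erase s) z ?_).smul _).mono ?_
      · rw [Finset.card_erase_of_mem hs, hS, Nat.add_sub_cancel]
      · rw [abs_neg]
        exact mul_le_mul_of_nonneg_right (hlin b' (z s)) hC
  convert hbub.isLocalDivMod.add hrest using 1
  ext1 b
  have e1 : (∑ b' : Fin (d + 1), ∑ s ∈ S, (-(α * (vertPiece B x b' (z s)).linear t)) •
      cellMonomial B x b' (j + 1) (S.erase s) z) b =
      ∑ s ∈ S, (-(α * (vertPiece B x b (z s)).linear t)) •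
        (hatPoly B x b ^ (j + 1) * ∏ s' ∈ S.erase s, vertPoly B x b (z s')) := by
    rw [Finset.sum_apply, Finset.sum_eq_single b]
    · rw [Finset.sum_apply]
      refine Finset.sum_congr rfl fun s _ => ?_
      rw [Pi.smul_apply, cellMonomial, if_pos rfl]
    · intro b' _ hb'
      rw [Finset.sum_apply]
      refine Finset.sum_eq_zero fun s _ => ?_
      rw [Pi.smul_apply, cellMonomial, if_neg hb'.symm, smul_zero]
    · simp
  rw [Pi.add_apply, e1]
  refine evalAt_injective fun y => ?_
  have e2 : evalAt y (α • dirDeriv t (hatPoly B x b ^ (j + 1) * ∏ s ∈ S, vertPoly B x b (z s))) =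
      B.coord a x * hatPiece B x b y ^ j * (∏ s ∈ S, vertPiece B x b (z s) y) *
        ((if b = a then (B.coord b x)⁻¹ else 0) - if b = z s₀ then (B.coord b x)⁻¹ else 0) +
      ∑ s ∈ S, (α * (vertPiece B x b (z s)).linear t) *
        (hatPiece B x b y ^ (j + 1) * ∏ s' ∈ S.erase s, vertPiece B x b (z s') y) := by
    have hj : ((j : ℝ) + 1) ≠ 0 := by positivity
    rw [Derivation.leibniz, derivation_prod, Derivation.leibniz_pow,
      dirDeriv_affPoly, ht, hatPiece_linear_sub, ← ht]
    simp only [dirDeriv_affPoly, MvPolynomial.smul_eval, nsmul_eq_mul, smul_eq_mul, map_mul,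
      map_add, map_sum, map_prod, map_pow, evalAt_affPoly, map_natCast, MvPolynomial.eval_C,
      add_tsub_cancel_right, mul_add, Finset.mul_sum]
    rw [add_comm]
    congr 1
    · rw [hα]; push_cast; field_simp
    · exact Finset.sum_congr rfl fun s _ => by ring
  rw [map_add, e2, map_sum]
  simp only [MvPolynomial.smul_eval, map_mul, map_pow, map_prod, evalAt_affPoly, neg_mul,
    Finset.sum_neg_distrib, add_neg_cancel_right]
  rw [cellMonomial]
  rcases eq_or_ne b a with rfl | h1
  · have := (hx b).ne'
    simp only [haz, if_true, if_false, map_mul, map_pow, map_prod, evalAt_affPoly]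
    field_simp
    ring
  · rcases eq_or_ne b (z s₀) with h2 | h2
    · have hz : ∏ s ∈ S, vertPiece B x b (z s) y = 0 :=
        Finset.prod_eq_zero hs₀ (by rw [← h2, vertPiece_self hx])
      rw [hz, if_neg h1, map_zero]
      ring
    · simp [h1, h2]

end

/-- Every monomial of degree `n` on a cell is a divergence up to a multiple of `hatPow`. -/
theorem exists_isLocalDivMod_cellMonomial (d n N : ℕ) (D : ℝ) (hD0 : 0 ≤ D) : ∃ C : ℝ, 0 ≤ C ∧
    ∀ (B : SimplexBasis d) (x : Space d), (∀ i, 0 < B.coord i x) → RegularSplit B x D →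
      ∀ (j : ℕ), j + N = n → ∀ (a : Fin (d + 1)) (S : Finset (Fin n)) (z : Fin n → Fin (d + 1)),
        S.card = N → IsLocalDivMod B x n C (cellMonomial B x a j S z) := by
  -- `N` counts the vertex factors; each step replaces one of them by a hat factor, with total
  -- degree `n` fixed.
  induction N with
  | zero =>
    refine ⟨((n + 1 : ℕ) : ℝ) * D, by positivity, fun B x hx hD j hj a S z hS => ?_⟩
    obtain rfl : j = n := hj
    rw [Finset.card_eq_zero.1 hS]
    exact isLocalDivMod_hatPow hx hD j a z
  | succ N ih =>
    obtain ⟨C, hC, h⟩ := ih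
    refine ⟨_, ?_, fun B x hx hD j hj a S z hS =>
      isLocalDivMod_cellMonomial_succ hx hD hC (fun a S z hS =>
        h B x hx hD (j + 1) (by omega) a S z hS) a S z hS hj⟩
    positivity

/-- Barycentric interpolation on the cell opposite to `a`, with the unused index `a` standing for
the split point. The coefficients are values of `l` at points of the simplex, hence bounded when `l`
is. -/
theorem affPoly_eq_sum {B : SimplexBasis d} {x : Space d} (hx : ∀ i, 0 < B.coord i x)
    (l : Space d →ᵃ[ℝ] ℝ) (a : Fin (d + 1)) :
    affPoly l = ∑ z, (if z = a then l x else l (B z)) •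
      if z = a then hatPoly B x a else vertPoly B x a z := by
  refine evalAt_injective fun y => ?_
  rw [evalAt_affPoly, map_sum, affineMap_eq_sum_coord B l y]
  have h1 : ∀ z, evalAt y ((if z = a then l x else l (B z)) •
      if z = a then hatPoly B x a else vertPoly B x a z) =
      l (B z) * vertPiece B x a z y + if z = a then l x * hatPiece B x a y else 0 := fun z => by
    rw [MvPolynomial.smul_eval]
    split_ifs with h
    · rw [evalAt_affPoly, h, vertPiece_self hx]; ring
    · rw [evalAt_affPoly, add_zero]
  simp_rw [h1]
  rw [Finset.sum_add_distrib, Finset.sum_ite_eq', if_pos (Finset.mem_univ a),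
    affineMap_eq_sum_coord B l x]
  simp only [vertPiece_apply, mul_sub, Finset.sum_sub_distrib, Finset.sum_mul]
  rw [sub_add_eq_add_sub, add_sub_assoc, ← Finset.sum_sub_distrib]
  rw [Finset.sum_eq_zero (s := Finset.univ) (f := fun i => _ - _), add_zero]
  · exact Finset.sum_congr rfl fun i _ => mul_comm _ _
  · intro i _; ring

/-- Products of `n` bounded affine functions on a cell are divergences up to a multiple of
`hatPow`. -/
theorem exists_isLocalDivMod_prod (d n : ℕ) (D : ℝ) (hD0 : 0 ≤ D) : ∃ C : ℝ, 0 ≤ C ∧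
    ∀ (B : SimplexBasis d) (x : Space d), (∀ i, 0 < B.coord i x) → RegularSplit B x D →
      ∀ (a : Fin (d + 1)) (l : Fin n → Space d →ᵃ[ℝ] ℝ),
        (∀ s, ∀ y ∈ simplexSet B, |l s y| ≤ D) →
        IsLocalDivMod B x n C (fun b => if b = a then ∏ s, affPoly (l s) else 0) := by
  choose C hC0 hC using fun N => exists_isLocalDivMod_cellMonomial d n N D hD0
  refine ⟨((Fintype.card (Fin n → Fin (d + 1)) : ℕ) : ℝ) * (D ^ n * ∑ N ∈ Finset.range (n + 1), C N),
    mul_nonneg (by positivity) (mul_nonneg (by positivity) (Finset.sum_nonneg fun N _ => hC0 N)),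
    fun B x hx hD a l hl => ?_⟩
  -- Multiplying out, a term is a choice of a vertex of the cell for each factor; choices equal to
  -- `a` contribute the hat factors.
  have hexp : (fun b => if b = a then ∏ s, affPoly (l s) else 0) =
      ∑ z : Fin n → Fin (d + 1), (∏ s, if z s = a then l s x else l s (B (z s))) •
        cellMonomial B x a (Finset.univ.filter fun s => z s = a).card
          (Finset.univ.filter fun s => z s ≠ a) z := by
    ext1 b
    rw [Finset.sum_apply]
    simp only [Pi.smul_apply, cellMonomial]
    split_ifs with hb
    · subst hb
      simp_rw [affPoly_eq_sum hx (l _) b]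
      rw [Finset.prod_univ_sum, Fintype.piFinset_univ]
      refine Finset.sum_congr rfl fun z _ => ?_
      simp_rw [Algebra.smul_def]
      rw [Finset.prod_mul_distrib, map_prod]
      congr 1
      rw [Finset.prod_ite, Finset.prod_const]
    · simp
  rw [hexp]
  refine IsLocalDivMod.sum (B := B) (x := x) (n := n) Finset.univ fun z _ => ?_
  have hcard : (Finset.univ.filter fun s => z s = a).card +
      (Finset.univ.filter fun s => z s ≠ a).card = n := by
    simpa using Finset.card_filter_add_card_filter_not (s := Finset.univ) (fun s => z s = a)
  refine ((hC _ B x hx hD _ hcard a _ z rfl).smul _).mono ?_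
  refine mul_le_mul ?_ ?_ (hC0 _) (by positivity)
  · rw [Finset.abs_prod]
    calc _ ≤ ∏ _s : Fin n, D := Finset.prod_le_prod (fun _ _ => abs_nonneg _) fun s _ => by
          split_ifs
          · exact hl s x fun i => (hx i).le
          · exact hl s _ (vertex_mem_simplexSet B _)
      _ = D ^ n := by simp
  · exact Finset.single_le_sum (f := C) (fun N _ => hC0 N) (Finset.mem_range.2 (by omega))

/-! ### The divergence on a split simplex -/

theorem simplexSet_eq_convexHull (B : SimplexBasis d) :
    simplexSet B = convexHull ℝ (Set.range B) :=
  B.convexHull_eq_nonneg_coord.symm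

theorem isCompact_simplexSet (B : SimplexBasis d) : IsCompact (simplexSet B) := by
  rw [simplexSet_eq_convexHull]
  exact Set.Finite.isCompact_convexHull (𝕜 := ℝ) (Set.finite_range B)

theorem integrableOn_of_continuous {f : Space d → ℝ} (hf : Continuous f) {S : Set (Space d)}
    (hS : Bornology.IsBounded S) : IntegrableOn f S :=
  (hf.continuousOn.integrableOn_compact hS.isCompact_closure).mono_set subset_closure

section

variable {B : SimplexBasis d} {x : Space d} (hx : ∀ i, 0 < B.coord i x)

include hx

theorem isBounded_cell (b : Fin (d + 1)) : Bornology.IsBounded (cell B x b) :=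
  (isCompact_simplexSet B).isBounded.subset (cell_subset_simplexSet hx b)

theorem iUnion_cell : ⋃ b, cell B x b = simplexSet B :=
  Set.Subset.antisymm (Set.iUnion_subset fun b => cell_subset_simplexSet hx b)
    fun _ hy => Set.mem_iUnion.2 (exists_mem_cell hy)

theorem pairwise_aedisjoint_cell :
    Pairwise (Function.onFun (AEDisjoint (volume : Measure (Space d))) (cell B x)) := by
  intro b b' hb
  refine measure_mono_null ?_ (volume_cell_diff_openCell hx b)
  rintro y ⟨h1, h2⟩
  exact ⟨h1, fun h => absurd (h2.2 b) (not_le.2 (h.2 b' hb.symm))⟩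

theorem setIntegral_simplexSet {f : Space d → ℝ} (hf : IntegrableOn f (simplexSet B)) :
    ∫ y in simplexSet B, f y = ∑ b, ∫ y in cell B x b, f y := by
  rw [← iUnion_cell hx] at hf ⊢
  rw [integral_iUnion_ae (fun b => (isClosed_cell b).measurableSet.nullMeasurableSet)
    (pairwise_aedisjoint_cell hx) hf, tsum_fintype]

theorem ae_cell_mem_openCell (b : Fin (d + 1)) :
    ∀ᵐ y ∂(volume.restrict (cell B x b)), y ∈ openCell B x b := by
  rw [ae_restrict_iff' (isClosed_cell b).measurableSet, ae_iff]
  refine measure_mono_null ?_ (volume_cell_diff_openCell hx b)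
  intro y hy
  simp only [Set.mem_ofPred_eq, Classical.not_imp] at hy
  exact hy

omit hx in
theorem lineDeriv_of_eqOn_cell {u : Space d → ℝ} {p : MvPolynomial (Fin d) ℝ} {b : Fin (d + 1)}
    (h : ∀ y ∈ cell B x b, u y = evalAt y p) {y : Space d} (hy : y ∈ openCell B x b) (j : Fin d) :
    lineDeriv ℝ u y (EuclideanSpace.single j 1) = evalAt y (MvPolynomial.pderiv j p) := by
  have h1 : u =ᶠ[𝓝 y] fun y => evalAt y p := by
    filter_upwards [(isOpen_openCell b).mem_nhds hy] with z hz
    exact h z (openCell_subset_cell b hz)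
  rw [h1.lineDeriv_eq, (hasLineDerivAt_evalAt p y _).lineDeriv, Finset.sum_eq_single j]
  · simp
  · intro i _ hi
    simp [hi]
  · simp

/-- The divergence of a local field has mean zero. -/
theorem IsLocalDiv.sum_integral_eq_zero {k : ℕ} {C : ℝ}
    {f : Fin (d + 1) → MvPolynomial (Fin d) ℝ} (h : IsLocalDiv B x k C f) :
    ∑ b, ∫ y in cell B x b, evalAt y (f b) = 0 := by
  obtain ⟨v, P, h1, h2, h3, h4, h5, h6⟩ := h
  have hout : ∀ i, ∀ y ∉ simplexSet B, v i y = 0 := fun i y hy => by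
    refine h2 i y ?_
    simp only [simplexSet, Set.mem_ofPred_eq, not_forall, not_le] at hy
    exact hy.imp fun b hb => hb.le
  have hc : ∀ i, HasCompactSupport (v i) := fun i =>
    hasCompactSupport_of_eq_zero_off (isCompact_simplexSet B).isBounded (hout i)
  choose L hL using h1
  have hint : ∀ i, Integrable (fun y => lineDeriv ℝ (v i) y (EuclideanSpace.single i 1)) volume := by
    intro i
    exact memLp_one_iff_integrable.1 (memLp_lineDeriv_of_hasCompactSupport 1 (hL i) (hc i) _)
  have hsupp : ∀ i, ∀ y ∉ simplexSet B,
      lineDeriv ℝ (v i) y (EuclideanSpace.single i 1) = 0 := fun i y hy => by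
    refine lineDeriv_eq_zero_of_notMem_tsupport (fun h => hy ?_) _
    exact closure_minimal (Function.support_subset_iff'.2 (hout i))
      (isCompact_simplexSet B).isClosed h
  -- The extended field is globally Lipschitz, so its weak divergence has no contribution on the
  -- interfaces between cells.
  have e1 : ∫ y in simplexSet B, ∑ i, lineDeriv ℝ (v i) y (EuclideanSpace.single i 1) = 0 := by
    rw [setIntegral_eq_integral_of_forall_compl_eq_zero fun y hy =>
      Finset.sum_eq_zero fun i _ => hsupp i y hy, integral_finsetSum _ fun i _ => hint i]
    exact Finset.sum_eq_zero fun i _ => integral_lineDeriv_eq_zero (hL i) (hc i) _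
  rw [setIntegral_simplexSet hx (integrable_finsetSum _ fun i _ => (hint i).integrableOn)] at e1
  rw [← e1]
  refine Finset.sum_congr rfl fun b _ => integral_congr_ae ?_
  filter_upwards [ae_cell_mem_openCell hx b] with y hy
  rw [← h6 b, map_sum]
  exact Finset.sum_congr rfl fun i _ => (lineDeriv_of_eqOn_cell (h4 b i) hy i).symm

theorem RegularSplit.volume_openCell_pos {D : ℝ} (hD : RegularSplit B x D) (b : Fin (d + 1)) :
    0 < volume (openCell B x b) := by
  obtain ⟨c, r, hr, hsub, -⟩ := hD b
  have h1 : volume (cell B x b) ≤ volume (openCell B x b) := by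
    have := measure_union_le (μ := volume) (openCell B x b) (cell B x b \ openCell B x b)
    rw [volume_cell_diff_openCell hx, add_zero] at this
    exact (measure_mono (by simp)).trans this
  exact ((measure_closedBall_pos volume c hr).trans_le (measure_mono hsub)).trans_le h1

/-- Integrating over the simplex, the mean-zero terms disappear and leave `c` times the integral of
`hatPow`, which is positive; so `c = 0`. -/
theorem IsLocalDivMod.isLocalDiv {D : ℝ} (hD : RegularSplit B x D) {n : ℕ} {C : ℝ}
    {f : Fin (d + 1) → MvPolynomial (Fin d) ℝ} (h : IsLocalDivMod B x n C f)
    (hf : ∑ b, ∫ y in cell B x b, evalAt y (f b) = 0) : IsLocalDiv B x (n + 1) C f := by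
  obtain ⟨c, hc⟩ := h
  have h0 := hc.sum_integral_eq_zero hx
  have hi : ∀ b (p : MvPolynomial (Fin d) ℝ), IntegrableOn (fun y => evalAt y p) (cell B x b) :=
    fun b p => integrableOn_of_continuous (continuous_evalAt p) (isBounded_cell hx b)
  have e1 : ∀ b, ∫ y in cell B x b, evalAt y ((f - c • hatPow B x n) b) =
      (∫ y in cell B x b, evalAt y (f b)) - c * ∫ y in cell B x b, evalAt y (hatPow B x n b) := by
    intro b
    rw [← integral_const_mul, ← integral_sub (hi b _) ((hi b _).const_mul c)]
    congr 1; ext y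
    simp [MvPolynomial.smul_eval]
  simp_rw [e1] at h0
  rw [Finset.sum_sub_distrib, hf, ← Finset.mul_sum, zero_sub, neg_eq_zero,
    Finset.sum_eq_single 0 (fun b _ hb => by simp [hatPow, hb]) (by simp)] at h0
  have hpos : 0 < ∫ y in cell B x 0, evalAt y (hatPow B x n 0) := by
    have hval : ∀ y, evalAt y (hatPow B x n 0) = hatPiece B x 0 y ^ n := fun y => by
      rw [hatPow, if_pos rfl, map_pow, evalAt_affPoly]
    rw [setIntegral_pos_iff_support_of_nonneg_ae]
    · refine (hD.volume_openCell_pos hx 0).trans_le (measure_mono fun y hy => ?_)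
      refine ⟨?_, openCell_subset_cell 0 hy⟩
      rw [Function.mem_support, hval]
      exact (pow_pos (mul_pos (inv_pos.2 (hx 0)) hy.1) n).ne'
    · refine (ae_restrict_iff' (isClosed_cell 0).measurableSet).2 (Eventually.of_forall fun y hy => ?_)
      simp only [Pi.zero_apply, hval]
      exact pow_nonneg (hatPiece_nonneg hx hy) n
    · exact hi 0 _
  have hc0 : c = 0 := (mul_eq_zero.1 h0).resolve_right hpos.ne'
  simpa [hc0] using hc

end

/-- Centred at `c` and scaled by `r`, coordinates are bounded by `D` at distance at most `D * r`.
The condition `1 ≤ D` serves the constant factor. -/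
theorem exists_affPoly_eq_scaledFactor (c : Space d) {r : ℝ} (hr : 0 < r) (s : Option (Fin d)) :
    ∃ l : Space d →ᵃ[ℝ] ℝ, affPoly l = scaledFactor c r s ∧
      ∀ (D : ℝ) (y : Space d), 1 ≤ D → dist y c ≤ D * r → |l y| ≤ D := by
  cases s with
  | none =>
    refine ⟨AffineMap.const ℝ _ 1, evalAt_injective fun y => ?_, fun D y hD _ => by simpa⟩
    simp [scaledFactor, monomialFactor]
  | some i =>
    let p : Space d →ₗ[ℝ] ℝ := (EuclideanSpace.proj i : Space d →L[ℝ] ℝ).toLinearMap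
    refine ⟨r⁻¹ • (p.toAffineMap - AffineMap.const ℝ _ (c i)), evalAt_injective fun y => ?_,
      fun D y hD h => ?_⟩
    · rw [scaledFactor, evalAt_rescale, evalAt_affPoly]
      simp [monomialFactor, p]; ring
    · have h1 : |y i - c i| ≤ D * r := by
        have := PiLp.norm_apply_le (y - c) i
        rw [dist_eq_norm] at h
        exact this.trans h
      change |r⁻¹ * (y i - c i)| ≤ D
      rw [abs_mul, abs_of_pos (inv_pos.2 hr), inv_mul_le_iff₀ hr, mul_comm]
      exact h1

/-- On a regular split simplex every mean-zero piecewise polynomial is the divergence of a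
continuous piecewise polynomial field vanishing on the boundary, with a uniform estimate. -/
theorem exists_isLocalDiv (d n : ℕ) (D : ℝ) (hD1 : 1 ≤ D) : ∃ C : ℝ, 0 ≤ C ∧
    ∀ (B : SimplexBasis d) (x : Space d), (∀ i, 0 < B.coord i x) → RegularSplit B x D →
      ∀ F : Fin (d + 1) → MvPolynomial (Fin d) ℝ, (∀ b, (F b).totalDegree ≤ n) →
        ∑ b, ∫ y in cell B x b, evalAt y (F b) = 0 →
        ∃ K : ℝ, IsLocalDiv B x (n + 1) K F ∧ K ^ 2 * volume.real (simplexSet B) ≤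
          C * ∑ b, ∫ y in cell B x b, evalAt y (F b) ^ 2 := by
  obtain ⟨C₁, hC₁, hcoeff⟩ := exists_coeff_bound d n
  obtain ⟨C₂, hC₂, hprod⟩ := exists_isLocalDivMod_prod d n D (by linarith)
  set ω : ℝ := volume.real (ball (0 : Space d) 1) with hω
  set N : ℕ := Fintype.card (Fin n → Option (Fin d)) with hN
  refine ⟨((d + 1 : ℕ) * (N * C₂)) ^ 2 * (ω * D ^ d * C₁), by positivity,
    fun B x hx hD F hF hmean => ?_⟩
  set I : ℝ := ∑ b, ∫ y in cell B x b, evalAt y (F b) ^ 2 with hI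
  have hIb : ∀ b, ∫ y in cell B x b, evalAt y (F b) ^ 2 ≤ I := fun b =>
    Finset.single_le_sum (f := fun b => ∫ y in cell B x b, evalAt y (F b) ^ 2)
      (fun b _ => integral_nonneg fun y => sq_nonneg _) (Finset.mem_univ b)
  have hI0 : 0 ≤ I := (integral_nonneg fun y => sq_nonneg _).trans (hIb 0)
  set V : ℝ := volume.real (simplexSet B) with hV
  have hVpos : 0 < V := by
    refine ENNReal.toReal_pos ?_ (isCompact_simplexSet B).measure_lt_top.ne
    exact ((hD.volume_openCell_pos hx 0).trans_le (measure_mono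
      ((openCell_subset_cell 0).trans (cell_subset_simplexSet hx 0)))).ne'
  -- One bound for all coefficients on all cells. It is chosen so that `G ^ 2 * V` is a fixed
  -- multiple of the squared `L²`-norm `I`: each inscribed ball has volume comparable to `V`.
  set G : ℝ := √(ω * D ^ d * C₁ * I / V) with hG
  have hG2 : G ^ 2 * V = ω * D ^ d * C₁ * I := by
    rw [hG, Real.sq_sqrt (by positivity), div_mul_cancel₀ _ hVpos.ne']
  have key : ∀ b, ∃ a : (Fin n → Option (Fin d)) → ℝ, ∃ l : (Fin n → Option (Fin d)) → Fin n →
      Space d →ᵃ[ℝ] ℝ, F b = ∑ s, a s • ∏ t, affPoly (l s t) ∧ (∀ s, |a s| ≤ G) ∧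
      ∀ s t, ∀ y ∈ simplexSet B, |l s t y| ≤ D := by
    intro b
    obtain ⟨c, r, hr, hsub, hdist⟩ := hD b
    obtain ⟨a, ha, hab⟩ := hcoeff c r hr (F b) (hF b)
    choose l hl1 hl2 using fun s => exists_affPoly_eq_scaledFactor c hr s
    have hcmem : c ∈ simplexSet B :=
      cell_subset_simplexSet hx b (hsub (mem_closedBall_self hr.le))
    refine ⟨a, fun s t => l (s t), by simpa only [hl1] using ha, fun s => ?_, fun s t y hy =>
      hl2 _ D y hD1 (hdist y hy c hcmem)⟩
    refine Real.abs_le_sqrt ?_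
    rw [le_div_iff₀ hVpos]
    have hVle : V ≤ (D * r) ^ d * ω := by
      have h1 : simplexSet B ⊆ closedBall c (D * r) := fun y hy => hdist y hy c hcmem
      have h2 := measureReal_mono (μ := volume) h1 measure_closedBall_lt_top.ne
      rw [Measure.addHaar_real_closedBall _ _ (by positivity)] at h2
      simpa using h2
    have h3 : ∫ y in closedBall c r, evalAt y (F b) ^ 2 ≤ I := by
      refine le_trans (setIntegral_mono_set ?_ ?_ ?_) (hIb b)
      · exact integrableOn_of_continuous ((continuous_evalAt _).pow 2) (isBounded_cell hx b)
      · exact Eventually.of_forall fun y => sq_nonneg _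
      · exact Eventually.of_forall hsub
    calc a s ^ 2 * V ≤ a s ^ 2 * ((D * r) ^ d * ω) := by gcongr
      _ = (a s ^ 2 * r ^ d) * (ω * D ^ d) := by rw [mul_pow]; ring
      _ ≤ (C₁ * I) * (ω * D ^ d) := by
        refine mul_le_mul_of_nonneg_right ((hab s).trans ?_) (by positivity)
        gcongr
      _ = _ := by ring
  choose a l hF' haG hlD using key
  have hsum : F = ∑ b, ∑ s, a b s • fun b' => if b' = b then ∏ t, affPoly (l b s t) else 0 := by
    ext1 b
    rw [Finset.sum_apply, Finset.sum_eq_single b]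
    · rw [Finset.sum_apply]
      simpa using hF' b
    · intro b' _ hb'
      rw [Finset.sum_apply]
      simp [hb'.symm]
    · simp
  have hmod : IsLocalDivMod B x n ((d + 1 : ℕ) * (N * (G * C₂))) F := by
    rw [hsum]
    have := IsLocalDivMod.sum (B := B) (x := x) (n := n) (Finset.univ : Finset (Fin (d + 1)))
      (C := N * (G * C₂)) (f := fun b => ∑ s, a b s • fun b' =>
        if b' = b then ∏ t, affPoly (l b s t) else 0) fun b _ => ?_
    · simpa using this
    · refine IsLocalDivMod.sum Finset.univ fun s _ => ?_
      refine ((hprod B x hx hD b (l b s) (hlD b s)).smul (a b s)).mono ?_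
      exact mul_le_mul_of_nonneg_right (haG b s) hC₂
  refine ⟨_, hmod.isLocalDiv hx hD hmean, ?_⟩
  calc _ = ((d + 1 : ℕ) * (N * C₂)) ^ 2 * (G ^ 2 * V) := by ring
    _ ≤ _ := by rw [hG2]; apply le_of_eq; ring

/-! ### Shape regularity -/

theorem exists_simplexBasis {K : Finset (Space d)} (hcard : K.card = d + 1)
    (hK : AffineIndependent ℝ ((↑) : K → Space d)) : ∃ B : SimplexBasis d, Set.range B = K := by
  have hspan : affineSpan ℝ (Set.range ((↑) : K → Space d)) = ⊤ := by
    rw [hK.affineSpan_eq_top_iff_card_eq_finrank_add_one]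
    simp [hcard]
  let B₀ : AffineBasis K ℝ (Space d) := ⟨(↑), hK, hspan⟩
  refine ⟨B₀.reindex (K.equivFinOfCardEq hcard), ?_⟩
  rw [AffineBasis.coe_reindex, Set.range_comp, (Equiv.range_eq_univ _), Set.image_univ]
  exact Subtype.range_coe

theorem affineMap_add_smul (l : Space d →ᵃ[ℝ] ℝ) (x t : Space d) (ε : ℝ) :
    l (x + ε • t) = l x + ε * l.linear t := by
  have := l.map_vadd x (ε • t)
  rw [vadd_eq_add, vadd_eq_add, map_smul, smul_eq_mul] at this
  rw [add_comm, this, add_comm]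

section

variable {B : SimplexBasis d} {x : Space d} (hx : ∀ i, 0 < B.coord i x)

include hx

theorem openCell_nonempty (b : Fin (d + 1)) : (openCell B x b).Nonempty := by
  set ε : ℝ := B.coord b x / 2 with hε
  have hb := hx b
  -- The witness is `x` pushed away from the vertex `b`: this lowers `hatPiece B x b` strictly below
  -- the others, and `ε` is small enough to keep the coordinate `b` positive.
  have hc : ∀ i, B.coord i (x + ε • (x - B b)) =
      B.coord i x + ε * (B.coord i x - if i = b then 1 else 0) := fun i => by
    rw [affineMap_add_smul, affineMap_linear_sub, B.coord_apply]
  have hM : ∀ i, hatPiece B x i (x + ε • (x - B b)) =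
      1 + ε - if i = b then ε / B.coord b x else 0 := fun i => by
    have := (hx i).ne'
    rw [hatPiece_apply, hc]
    split_ifs with h
    · subst h; field_simp; ring
    · field_simp; ring
  refine ⟨x + ε • (x - B b), ?_, fun i hi => ?_⟩
  · rw [hc, if_pos rfl, hε]
    nlinarith
  · rw [hM, hM, if_pos rfl, if_neg hi]
    have : 0 < ε / B.coord b x := by positivity
    linarith

theorem exists_closedBall_subset_cell (b : Fin (d + 1)) :
    ∃ (c : Space d) (r : ℝ), 0 < r ∧ closedBall c r ⊆ cell B x b := by
  obtain ⟨c, hc⟩ := openCell_nonempty hx b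
  obtain ⟨r, hr, hsub⟩ := Metric.isOpen_iff.1 (isOpen_openCell b) c hc
  exact ⟨c, r / 2, by positivity, (closedBall_subset_ball (by linarith)).trans
    (hsub.trans (openCell_subset_cell b))⟩

/-- Here `D` depends on the individual simplex. This suffices in dimension one, where only the
existence of a field is needed. -/
theorem exists_regularSplit : ∃ D : ℝ, 1 ≤ D ∧ RegularSplit B x D := by
  choose c r hr hsub using exists_closedBall_subset_cell hx
  have hH : 0 ≤ diam (simplexSet B) := diam_nonneg
  have hterm : ∀ b, 0 ≤ diam (simplexSet B) / r b := fun b => div_nonneg hH (hr b).le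
  refine ⟨1 + ∑ b, diam (simplexSet B) / r b, ?_, fun b => ⟨c b, r b, hr b, hsub b, ?_⟩⟩
  · linarith [Finset.sum_nonneg fun b (_ : b ∈ Finset.univ) => hterm b]
  · intro y hy y' hy'
    have h1 := dist_le_diam_of_mem (isCompact_simplexSet B).isBounded hy hy'
    have h2 := Finset.single_le_sum (fun b (_ : b ∈ Finset.univ) => hterm b) (Finset.mem_univ b)
    rw [← div_le_iff₀ (hr b)]
    exact (div_le_div_of_nonneg_right h1 (hr b).le).trans (by linarith)

theorem vertex_mem_cell {b i : Fin (d + 1)} (h : i ≠ b) : B i ∈ cell B x b := by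
  rw [cell_eq_convexHull hx]
  exact subset_convexHull _ _ (Set.mem_insert_of_mem _ ⟨i, h, rfl⟩)

theorem splitPoint_mem_cell (b : Fin (d + 1)) : x ∈ cell B x b := by
  rw [cell_eq_convexHull hx]
  exact subset_convexHull _ _ (Set.mem_insert _ _)

/-- The barycentric coordinate of `B w` rises from `0` to `1` along the edge from `x` to `B w`, with
slope at most `1 / (2 * r)`. -/
theorem two_mul_le_dist_of_closedBall_subset {b w : Fin (d + 1)} (hw : w ≠ b) {c : Space d} {r : ℝ}
    (hr : 0 ≤ r) (hsub : closedBall c r ⊆ cell B x b) : 2 * r ≤ dist (B w) x := by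
  have h := abs_linear_mul_le (vertPiece B x b w) hr
    (fun y hy => vertPiece_nonneg hx (hsub hy) w) (fun y hy => vertPiece_le_one hx (hsub hy) w)
    (B w - x)
  rw [affineMap_linear_sub, vertPiece_apply, vertPiece_apply, hatPiece_vertex, if_neg hw.symm,
    hatPiece_self hx, B.coord_apply_eq, mul_zero, mul_one, sub_self, sub_zero, sub_zero, abs_one,
    one_mul, ← dist_eq_norm] at h
  exact h

/-- A split simplex of dimension at least two with shape-regular cells is regular. -/
theorem regularSplit_of_cells (hd : 2 ≤ d) {s : ℝ} (hs : 0 ≤ s)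
    (h : ∀ b, ∃ (c : Space d) (r : ℝ), 0 < r ∧ closedBall c r ⊆ cell B x b ∧
      diam (cell B x b) ≤ s * r) : RegularSplit B x (max 1 (s ^ 2)) := by
  choose c r hr hsub hdiam using h
  -- This is where `d ≥ 2` enters: any edge of the simplex lies in some cell, and any two cells
  -- share an edge issuing from `x`.
  have hthird : ∀ p q : Fin (d + 1), ∃ b, b ≠ p ∧ b ≠ q := fun p q => by
    have : ({p, q} : Finset (Fin (d + 1))).card < Fintype.card (Fin (d + 1)) := by
      rw [Fintype.card_fin]
      exact Finset.card_le_two.trans_lt (by omega)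
    obtain ⟨b, hb⟩ := Finset.exists_mem_notMem_of_card_lt_card
      (s := {p, q}) (t := Finset.univ) (by simpa using this)
    exact ⟨b, by simpa [not_or] using hb.2⟩
  have hdist : ∀ b, ∀ y ∈ cell B x b, ∀ y' ∈ cell B x b, dist y y' ≤ s * r b :=
    fun b y hy y' hy' => (dist_le_diam_of_mem (isBounded_cell hx b) hy hy').trans (hdiam b)
  refine fun a => ⟨c a, r a, hr a, hsub a, fun y hy y' hy' => ?_⟩
  have hra := hr a
  have hvert : diam (Set.range B) ≤ s ^ 2 * r a := by
    refine diam_le_of_forall_dist_le (by positivity) ?_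
    rintro _ ⟨p, rfl⟩ _ ⟨q, rfl⟩
    obtain ⟨b, hbp, hbq⟩ := hthird p q
    obtain ⟨w, hwa, hwb⟩ := hthird a b
    -- The edge is at most `s * r b`, and the edge from `x` to `B w`, common to the cells `a` and
    -- `b`, compares `r b` with `r a`.
    have h1 := hdist b _ (vertex_mem_cell hx hbp.symm) _ (vertex_mem_cell hx hbq.symm)
    have h2 := two_mul_le_dist_of_closedBall_subset hx hwb (hr b).le (hsub b)
    have h3 := hdist a _ (vertex_mem_cell hx hwa) _ (splitPoint_mem_cell hx a)
    have h4 : r b ≤ s * r a := by linarith [hr b]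
    nlinarith
  have hy1 := dist_le_diam_of_mem (isCompact_simplexSet B).isBounded hy hy'
  rw [simplexSet_eq_convexHull, convexHull_diam] at hy1
  refine (hy1.trans hvert).trans ?_
  gcongr
  exact le_max_right _ _

end

/-- A ball whose diameter exceeds half the supremum avoids any attainment argument, whence the
factor `4`. In dimension zero the admissible radii are unbounded, so `d ≥ 1` is used. -/
theorem exists_closedBall_of_shapeConst_le (hd : 1 ≤ d) {S : Finset (Space d)} {σ : ℝ}
    (hS : shapeConst S ≤ σ) (hb : ∃ (c : Space d) (r : ℝ), 0 < r ∧
      closedBall c r ⊆ convexHull ℝ (S : Set (Space d))) :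
    0 ≤ σ ∧ ∃ (c : Space d) (r : ℝ), 0 < r ∧ closedBall c r ⊆ convexHull ℝ (S : Set (Space d)) ∧
      diam (convexHull ℝ (S : Set (Space d))) ≤ 4 * σ * r := by
  set H := diam (convexHull ℝ (S : Set (Space d))) with hH
  have hbdd : Bornology.IsBounded (convexHull ℝ (S : Set (Space d))) :=
    isBounded_convexHull.2 S.finite_toSet.isBounded
  set A : Set ℝ := {δ | ∃ (c : Space d) (r : ℝ), 0 ≤ r ∧ δ = 2 * r ∧
    closedBall c r ⊆ convexHull ℝ (S : Set (Space d))} with hA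
  have hA1 : BddAbove A := by
    refine ⟨H, ?_⟩
    rintro _ ⟨c, r, hr, rfl, hsub⟩
    set e : Space d := EuclideanSpace.single ⟨0, hd⟩ 1
    have he : ‖e‖ = 1 := by simp [e]
    have m1 : c + r • e ∈ closedBall c r := by
      simp [norm_smul, he, abs_of_nonneg hr]
    have m2 : c - r • e ∈ closedBall c r := by
      simp [norm_smul, he, abs_of_nonneg hr]
    have := dist_le_diam_of_mem hbdd (hsub m1) (hsub m2)
    rwa [dist_eq_norm, show c + r • e - (c - r • e) = (2 * r) • e by
      rw [mul_smul, two_smul]; abel, norm_smul, he, mul_one, Real.norm_of_nonneg (by positivity)]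
      at this
  have hρ : inscribedDiam S = sSup A := rfl
  obtain ⟨c₀, r₀, hr₀, hsub₀⟩ := hb
  have hpos : 0 < inscribedDiam S := by
    have : 2 * r₀ ≤ sSup A := le_csSup hA1 ⟨c₀, r₀, hr₀.le, rfl, hsub₀⟩
    rw [hρ]; linarith
  have hσ : 0 ≤ σ := (div_nonneg diam_nonneg hpos.le).trans hS
  have hHle : H ≤ σ * inscribedDiam S := (div_le_iff₀ hpos).1 hS
  have hlt : inscribedDiam S / 2 < sSup A := by rw [← hρ]; linarith
  obtain ⟨_, ⟨c, r, hr, rfl, hsub⟩, hlt'⟩ := exists_lt_of_lt_csSup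
    (show A.Nonempty from ⟨2 * r₀, c₀, r₀, hr₀.le, rfl, hsub₀⟩) hlt
  refine ⟨hσ, c, r, by linarith, hsub, hHle.trans ?_⟩
  have : inscribedDiam S ≤ 4 * r := by linarith
  nlinarith

/-- The local inversion of the divergence on a split simplex, with a constant that depends only on
the dimension, the degree and the shape regularity of the cells. -/
theorem exists_local_field (d n : ℕ) (hd : 1 ≤ d) (σ : ℝ) : ∃ C : ℝ, 0 ≤ C ∧
    ∀ (B : SimplexBasis d) (x : Space d), (∀ i, 0 < B.coord i x) →
      (∀ b, ∃ S : Finset (Space d), convexHull ℝ (S : Set (Space d)) = cell B x b ∧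
        shapeConst S ≤ σ) →
      ∀ F : Fin (d + 1) → MvPolynomial (Fin d) ℝ, (∀ b, (F b).totalDegree ≤ n) →
        ∑ b, ∫ y in cell B x b, evalAt y (F b) = 0 →
        ∃ (v : Fin d → Space d → ℝ) (P : Fin (d + 1) → Fin d → MvPolynomial (Fin d) ℝ),
          (∀ i, ∃ L, LipschitzWith L (v i)) ∧
          (∀ i y, (∃ b, B.coord b y ≤ 0) → v i y = 0) ∧
          (∀ b i, (P b i).totalDegree ≤ n + 1) ∧
          (∀ b i, ∀ y ∈ cell B x b, v i y = evalAt y (P b i)) ∧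
          (∀ b, ∑ i, MvPolynomial.pderiv i (P b i) = F b) ∧
          ∀ i j, ∑ b, ∫ y in cell B x b, evalAt y (MvPolynomial.pderiv j (P b i)) ^ 2 ≤
            C * ∑ b, ∫ y in cell B x b, evalAt y (F b) ^ 2 := by
  -- In dimension one the only partial derivative is the divergence itself, so the estimate holds
  -- with constant `1` and no uniform regularity is required.
  rcases hd.eq_or_lt with rfl | hd2
  · refine ⟨1, zero_le_one, fun B x hx _ F hF hmean => ?_⟩
    obtain ⟨D, hD1, hD⟩ := exists_regularSplit hx
    obtain ⟨C, -, h⟩ := exists_isLocalDiv 1 n D hD1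
    obtain ⟨K, ⟨v, P, h1, h2, h3, h4, -, h6⟩, -⟩ := h B x hx hD F hF hmean
    refine ⟨v, P, h1, h2, h3, h4, h6, fun i j => ?_⟩
    have : ∀ b, MvPolynomial.pderiv j (P b i) = F b := fun b => by
      rw [← h6 b, Fin.sum_univ_one, Subsingleton.elim i 0, Subsingleton.elim j 0]
    simp only [this, one_mul, le_refl]
  · obtain ⟨C, hC, h⟩ := exists_isLocalDiv d n (max 1 ((4 * σ) ^ 2)) (le_max_left _ _)
    refine ⟨C, hC, fun B x hx hS F hF hmean => ?_⟩
    have hballs : ∀ b, 0 ≤ σ ∧ ∃ (c : Space d) (r : ℝ), 0 < r ∧ closedBall c r ⊆ cell B x b ∧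
        diam (cell B x b) ≤ 4 * σ * r := fun b => by
      obtain ⟨S, hSc, hSσ⟩ := hS b
      rw [← hSc]
      exact exists_closedBall_of_shapeConst_le hd hSσ (by
        rw [hSc]; exact exists_closedBall_subset_cell hx b)
    have hD := regularSplit_of_cells hx hd2 (by linarith [(hballs 0).1] : 0 ≤ 4 * σ)
      fun b => (hballs b).2
    obtain ⟨K, ⟨v, P, h1, h2, h3, h4, h5, h6⟩, hK⟩ := h B x hx hD F hF hmean
    refine ⟨v, P, h1, h2, h3, h4, h6, fun i j => le_trans ?_ hK⟩
    -- The pointwise bound `K` on the derivatives becomes an `L²` bound by summing the volumes of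
    -- the cells.
    have hV : volume.real (simplexSet B) = ∑ b, volume.real (cell B x b) := by
      have := setIntegral_simplexSet hx (f := fun _ => (1 : ℝ))
        (integrableOn_of_continuous continuous_const (isCompact_simplexSet B).isBounded)
      simpa using this
    rw [hV, Finset.mul_sum]
    refine Finset.sum_le_sum fun b _ => ?_
    have hi := integrableOn_of_continuous (f := fun y =>
      evalAt y (MvPolynomial.pderiv j (P b i)) ^ 2) ((continuous_evalAt _).pow 2)
      (isBounded_cell hx b)
    have hi' := integrableOn_of_continuous (f := fun _ : Space d => K ^ 2) continuous_const
      (isBounded_cell hx b)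
    refine (setIntegral_mono_on hi hi' (isClosed_cell b).measurableSet fun y hy => ?_).trans ?_
    · exact sq_le_sq' (abs_le.1 (h5 b i j y hy)).1 (abs_le.1 (h5 b i j y hy)).2
    · simp [mul_comm]

/-! ### Split meshes -/

/-- A finite family of split simplices that tile `Ω`: `B K` are the vertices of the simplex `K`,
and `x K` is its split point. -/
structure IsSplitMesh {ι : Type*} (Ω : Opens (Space d)) (B : ι → SimplexBasis d)
    (x : ι → Space d) : Prop where
  pos : ∀ K i, 0 < (B K).coord i (x K)
  interior_subset : ∀ K y, (∀ i, 0 < (B K).coord i y) → y ∈ Ω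
  cover : ∀ y ∈ Ω, ∃ K, y ∈ simplexSet (B K)
  disjoint : ∀ K K', K ≠ K' → ∀ y, (∀ i, 0 < (B K').coord i y) → y ∉ simplexSet (B K)

theorem volume_coord_eq_zero (B : SimplexBasis d) (i : Fin (d + 1)) :
    volume {y | B.coord i y = 0} = 0 :=
  coord_ne_zero_measure _ ⟨B i, by simp⟩

theorem volume_simplexSet_diff (B : SimplexBasis d) :
    volume (simplexSet B \ {y | ∀ i, 0 < B.coord i y}) = 0 := by
  refine measure_mono_null ?_ (measure_iUnion_null (volume_coord_eq_zero B))
  rintro y ⟨h1, h2⟩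
  simp only [Set.mem_ofPred_eq, not_forall, not_lt] at h2
  obtain ⟨i, hi⟩ := h2
  exact Set.mem_iUnion.2 ⟨i, le_antisymm hi (h1 i)⟩

theorem coord_pos_of_mem_openCell {B : SimplexBasis d} {x : Space d} (hx : ∀ i, 0 < B.coord i x)
    {b : Fin (d + 1)} {y : Space d} (hy : y ∈ openCell B x b) (i : Fin (d + 1)) :
    0 < B.coord i y := by
  have h1 : 0 < hatPiece B x b y := mul_pos (inv_pos.2 (hx b)) hy.1
  rw [coord_eq_mul_hatPiece hx]
  refine mul_pos (hx i) (h1.trans_le ?_)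
  by_cases h : i = b
  · rw [h]
  · exact (hy.2 i h).le

namespace IsSplitMesh

variable {ι : Type*} [Fintype ι] {Ω : Opens (Space d)} {B : ι → SimplexBasis d} {x : ι → Space d}

omit [Fintype ι] in
theorem openCell_subset (h : IsSplitMesh Ω B x) (K : ι) (b : Fin (d + 1)) :
    openCell (B K) (x K) b ⊆ Ω :=
  fun _ hy => h.interior_subset K _ (coord_pos_of_mem_openCell (h.pos K) hy)

theorem isBounded (h : IsSplitMesh Ω B x) : Bornology.IsBounded (Ω : Set (Space d)) :=
  ((Bornology.isBounded_iUnion (s := fun K => simplexSet (B K))).2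
    fun K => (isCompact_simplexSet (B K)).isBounded).subset
    fun y hy => Set.mem_iUnion.2 (h.cover y hy)

theorem volume_ne_top (h : IsSplitMesh Ω B x) : volume (Ω : Set (Space d)) ≠ ∞ :=
  h.isBounded.measure_lt_top.ne

omit [Fintype ι] in
theorem pairwise_aedisjoint (h : IsSplitMesh Ω B x) :
    Pairwise (Function.onFun (AEDisjoint (volume : Measure (Space d)))
      fun p : ι × Fin (d + 1) => cell (B p.1) (x p.1) p.2) := by
  rintro ⟨K, b⟩ ⟨K', b'⟩ hne
  by_cases hK : K = K'
  · subst hK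
    exact pairwise_aedisjoint_cell (h.pos K) fun hb => hne (congrArg (Prod.mk K) hb)
  · refine measure_mono_null ?_ (volume_simplexSet_diff (B K'))
    rintro y ⟨h1, h2⟩
    exact ⟨cell_subset_simplexSet (h.pos K') b' h2,
      fun h3 => h.disjoint K K' hK y h3 (cell_subset_simplexSet (h.pos K) b h1)⟩

/-- The closed cells cover `Ω`, overlap in null sets, and exceed `Ω` by a null set because the open
cells lie in `Ω`. All integrals and almost-everywhere statements on `Ω` thus reduce to single cells.
-/
theorem restrict_eq_sum (h : IsSplitMesh Ω B x) :
    (volume : Measure (Space d)).restrict (Ω : Set (Space d)) =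
      Measure.sum fun p : ι × Fin (d + 1) => volume.restrict (cell (B p.1) (x p.1) p.2) := by
  rw [← Measure.restrict_iUnion_ae h.pairwise_aedisjoint
    fun p => (isClosed_cell p.2).measurableSet.nullMeasurableSet]
  refine Measure.restrict_congr_set (Filter.EventuallyLE.antisymm ?_ ?_)
  · refine ae_of_all _ fun y hy => ?_
    obtain ⟨K, hK⟩ := h.cover y hy
    obtain ⟨b, hb⟩ := exists_mem_cell (x := x K) hK
    exact Set.mem_iUnion.2 ⟨(K, b), hb⟩
  · refine ae_le_set.2 (measure_mono_null ?_
      (measure_iUnion_null fun p : ι × Fin (d + 1) =>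
        volume_cell_diff_openCell (h.pos p.1) p.2))
    rintro y ⟨h1, h2⟩
    obtain ⟨p, hp⟩ := Set.mem_iUnion.1 h1
    exact Set.mem_iUnion.2 ⟨p, hp, fun h3 => h2 (h.openCell_subset _ _ h3)⟩

theorem ae_iff (h : IsSplitMesh Ω B x) {P : Space d → Prop} :
    (∀ᵐ y ∂(volume.restrict (Ω : Set (Space d))), P y) ↔
      ∀ K b, ∀ᵐ y ∂(volume.restrict (cell (B K) (x K) b)), P y := by
  rw [h.restrict_eq_sum, Measure.ae_sum_iff, Prod.forall]

theorem ae_cell_of_ae (h : IsSplitMesh Ω B x) {P : Space d → Prop} {K : ι} {b : Fin (d + 1)}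
    (hP : ∀ᵐ y ∂(volume.restrict (Ω : Set (Space d))), y ∈ cell (B K) (x K) b → P y) :
    ∀ᵐ y ∂(volume.restrict (cell (B K) (x K) b)), P y := by
  filter_upwards [h.ae_iff.1 hP K b, ae_restrict_mem (isClosed_cell b).measurableSet]
    with y h1 h2 using h1 h2

theorem setIntegral_eq_sum (h : IsSplitMesh Ω B x) {f : Space d → ℝ}
    (hf : IntegrableOn f (Ω : Set (Space d))) :
    ∫ y in (Ω : Set (Space d)), f y = ∑ K, ∑ b, ∫ y in cell (B K) (x K) b, f y := by
  rw [IntegrableOn, h.restrict_eq_sum] at hf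
  rw [h.restrict_eq_sum, integral_sum_measure hf, tsum_fintype, Fintype.sum_prod_type]

end IsSplitMesh

theorem coe_insert_erase_eq {K : Finset (Space d)} [DecidableEq (Space d)] {B : SimplexBasis d}
    (hB : Set.range B = K) (x : Space d) (b : Fin (d + 1)) :
    ((insert x (K.erase (B b)) : Finset (Space d)) : Set (Space d)) =
      insert x (B '' {i | i ≠ b}) := by
  rw [Finset.coe_insert, Finset.coe_erase, ← hB]
  congr 1
  ext y
  simp only [Set.mem_sdiff, Set.mem_range, Set.mem_singleton_iff, Set.mem_image, Set.mem_ofPred_eq]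
  constructor
  · rintro ⟨⟨i, rfl⟩, hi⟩
    exact ⟨i, fun h => hi (by rw [h]), rfl⟩
  · rintro ⟨i, hi, rfl⟩
    exact ⟨⟨i, rfl⟩, fun h => hi (B.ind.injective h)⟩

theorem exists_facet_superset {T : Geometry.SimplicialComplex ℝ (Space d)} (hT : T.faces.Finite)
    {s : Finset (Space d)} (hs : s ∈ T.faces) : ∃ K ∈ T.facets, s ⊆ K := by
  obtain ⟨K, hsK, hK⟩ := hT.exists_le_maximal hs
  exact ⟨K, ⟨hK.prop, fun t ht hKt => hK.eq_of_le ht hKt⟩, hsK⟩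

/-- The refinement of a triangulation as a family of split simplices. -/
theorem IsTriangulation.exists_isSplitMesh {T : Geometry.SimplicialComplex ℝ (Space d)}
    {Ω : Opens (Space d)} (hT : IsTriangulation T Ω) {xK : Finset (Space d) → Space d}
    (hxK : ∀ K ∈ T.facets, xK K ∈ interior (convexHull ℝ (K : Set (Space d)))) :
    ∃ B : T.facets → SimplexBasis d,
      IsSplitMesh Ω B (fun K => xK K) ∧ (∀ K, Set.range (B K) = (K : Finset (Space d))) := by
  have hex : ∀ K : T.facets, ∃ B : SimplexBasis d, Set.range B = (K : Finset (Space d)) :=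
    fun K => exists_simplexBasis (hT.pure K K.2) (T.indep K.2.1)
  choose B hB using hex
  have hint : ∀ K : T.facets, interior (convexHull ℝ ((K : Finset (Space d)) : Set (Space d))) =
      {y | ∀ i, 0 < (B K).coord i y} := fun K => by
    rw [← hB K, (B K).interior_convexHull]
  have hhull : ∀ K : T.facets, convexHull ℝ ((K : Finset (Space d)) : Set (Space d)) =
      simplexSet (B K) := fun K => by
    rw [← hB K, simplexSet_eq_convexHull]
  refine ⟨B, ⟨fun K => ?_, fun K y hy => ?_, fun y hy => ?_, fun K K' hne y hy hyK => ?_⟩, hB⟩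
  · have := hxK K K.2
    rwa [hint] at this
  · refine hT.interior_subset K K.2 ?_
    rw [hint]
    exact hy
  · have : y ∈ T.space := by rw [hT.space_eq]; exact subset_closure hy
    obtain ⟨s, hs, hys⟩ := Geometry.SimplicialComplex.mem_space_iff.1 this
    obtain ⟨K, hK, hsK⟩ := exists_facet_superset hT.finite hs
    refine ⟨⟨K, hK⟩, ?_⟩
    rw [← hhull]
    exact convexHull_mono (by exact_mod_cast hsK) hys
  -- By maximality some vertex of `K'` is not in `K`. Conformity puts a common point of the two
  -- simplices into the hull of their common vertices, where the coordinate of that vertex is zero.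
  · have hnot : ¬ (K' : Finset (Space d)) ⊆ K := fun hsub =>
      hne (Subtype.ext (K'.2.2 K.2.1 hsub).symm)
    obtain ⟨a, ha, haK⟩ := Finset.not_subset.1 hnot
    have ha' : a ∈ Set.range (B K') := by rw [hB]; exact ha
    obtain ⟨i, rfl⟩ := ha'
    have hyI : y ∈ convexHull ℝ (((K : Finset (Space d)) : Set (Space d)) ∩
        ((K' : Finset (Space d)) : Set (Space d))) := by
      refine T.inter_subset_convexHull K.2.1 K'.2.1 ⟨?_, ?_⟩
      · rw [hhull]; exact hyK
      · rw [hhull]; exact fun j => (hy j).le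
    have hconv : Convex ℝ ((B K').coord i ⁻¹' {0}) :=
      (convex_singleton (𝕜 := ℝ) (0 : ℝ)).affine_preimage _
    have hz := convexHull_min (fun z hz => ?_) hconv hyI
    · exact (hy i).ne' hz
    · obtain ⟨hzK, hzK'⟩ := hz
      rw [← hB K'] at hzK'
      obtain ⟨j, rfl⟩ := hzK'
      have hij : i ≠ j := fun h => haK (by rw [h]; exact hzK)
      simp [(B K').coord_apply_ne hij]

/-! ### Piecewise polynomials on split meshes -/

/-- `w` agrees almost everywhere with the polynomial `G K b` on each cell of a split mesh. -/
def IsPiecewise {ι : Type*} (B : ι → SimplexBasis d) (x : ι → Space d) (w : Space d → ℝ)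
    (G : ι → Fin (d + 1) → MvPolynomial (Fin d) ℝ) : Prop :=
  ∀ K b, ∀ᵐ y ∂(volume.restrict (cell (B K) (x K) b)), w y = evalAt y (G K b)

theorem exists_lipschitzWith_sum {ι : Type*} (s : Finset ι) {f : ι → Space d → ℝ}
    (hf : ∀ K, ∃ L, LipschitzWith L (f K)) : ∃ L, LipschitzWith L fun y => ∑ K ∈ s, f K y := by
  classical
  induction s using Finset.induction_on with
  | empty => exact ⟨0, by simp⟩
  | insert a s ha ih =>
    obtain ⟨L, hL⟩ := ih
    obtain ⟨L', hL'⟩ := hf a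
    exact ⟨L' + L, by simpa [Finset.sum_insert ha] using hL'.add hL⟩

theorem integral_mul_eq_inner {α : Type*} [MeasurableSpace α] {μ : Measure α} (u w : Lp ℝ 2 μ) :
    ∫ y, u y * w y ∂μ = inner ℝ u w := by
  rw [L2.inner_def]
  congr 1; ext y
  simp [mul_comm]

namespace IsSplitMesh

variable {ι : Type*} [Fintype ι] {Ω : Opens (Space d)} {B : ι → SimplexBasis d} {x : ι → Space d}

theorem setIntegral_of_isPiecewise (h : IsSplitMesh Ω B x) {w : Space d → ℝ}
    (hw : IntegrableOn w (Ω : Set (Space d))) {G : ι → Fin (d + 1) → MvPolynomial (Fin d) ℝ}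
    (hG : IsPiecewise B x w G) :
    ∫ y in (Ω : Set (Space d)), w y = ∑ K, ∑ b, ∫ y in cell (B K) (x K) b, evalAt y (G K b) := by
  rw [h.setIntegral_eq_sum hw]
  exact Finset.sum_congr rfl fun K _ => Finset.sum_congr rfl fun b _ => integral_congr_ae (hG K b)

theorem norm_sq_of_isPiecewise (h : IsSplitMesh Ω B x) {w : L2 Ω}
    {G : ι → Fin (d + 1) → MvPolynomial (Fin d) ℝ} (hG : IsPiecewise B x w G) :
    ‖w‖ ^ 2 = ∑ K, ∑ b, ∫ y in cell (B K) (x K) b, evalAt y (G K b) ^ 2 := by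
  rw [norm_sq_eq_integral]
  have := h.setIntegral_of_isPiecewise (w := fun y => w y ^ 2) (Lp.memLp w).integrable_sq
    (G := fun K b => G K b ^ 2) fun K b => by
      filter_upwards [hG K b] with y hy
      rw [hy, map_pow]
  simpa only [map_pow] using this

theorem isPiecewise_sub (h : IsSplitMesh Ω B x) {u w : L2 Ω}
    {F G : ι → Fin (d + 1) → MvPolynomial (Fin d) ℝ} (hF : IsPiecewise B x u F)
    (hG : IsPiecewise B x w G) : IsPiecewise B x (u - w : L2 Ω) fun K b => F K b - G K b := by
  intro K b
  filter_upwards [hF K b, hG K b, h.ae_iff.1 (Lp.coeFn_sub u w) K b] with y h1 h2 h3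
  rw [h3, Pi.sub_apply, h1, h2, map_sub]

theorem eq_of_isPiecewise (h : IsSplitMesh Ω B x) {u w : L2 Ω}
    {F : ι → Fin (d + 1) → MvPolynomial (Fin d) ℝ} (hu : IsPiecewise B x u F)
    (hw : IsPiecewise B x w F) : u = w := by
  refine Lp.ext (h.ae_iff.2 fun K b => ?_)
  filter_upwards [hu K b, hw K b] with y h1 h2
  rw [h1, h2]

/-- Piecewise constant functions with prescribed values on the simplices. -/
theorem exists_isPiecewise_const (h : IsSplitMesh Ω B x) (a : ι → ℝ) :
    ∃ w : L2 Ω, IsPiecewise B x w fun K _ => MvPolynomial.C (a K) := by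
  classical
  have : IsFiniteMeasure (volume.restrict (Ω : Set (Space d))) :=
    ⟨by simpa using h.volume_ne_top.lt_top⟩
  have hm : MemLp (fun y => ∑ K, (simplexSet (B K)).indicator (fun _ => a K) y) 2
      (volume.restrict (Ω : Set (Space d))) :=
    memLp_finsetSum _ fun K _ =>
      (memLp_const (a K)).indicator (isCompact_simplexSet (B K)).isClosed.measurableSet
  refine ⟨hm.toLp, fun K b => ?_⟩
  filter_upwards [h.ae_iff.1 hm.coeFn_toLp K b, ae_cell_mem_openCell (h.pos K) b] with y h1 h2
  have hpos := coord_pos_of_mem_openCell (h.pos K) h2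
  rw [h1, Finset.sum_eq_single K]
  · rw [Set.indicator_of_mem (show y ∈ simplexSet (B K) from fun i => (hpos i).le)]
    simp
  · exact fun K' _ hK' => Set.indicator_of_notMem (h.disjoint K' K hK' y hpos) _
  · simp

omit [Fintype ι] in
theorem sum_measureReal_pos (h : IsSplitMesh Ω B x) (K : ι) :
    0 < ∑ b, volume.real (cell (B K) (x K) b) := by
  refine Finset.sum_pos (fun b _ => ?_) Finset.univ_nonempty
  refine ENNReal.toReal_pos ?_ (isBounded_cell (h.pos K) b).measure_lt_top.ne
  exact (((isOpen_openCell b).measure_pos volume (openCell_nonempty (h.pos K) b)).trans_le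
    (measure_mono (openCell_subset_cell b))).ne'

omit [Fintype ι] in
theorem integrableOn_evalAt (h : IsSplitMesh Ω B x) (K : ι) (b : Fin (d + 1))
    (p : MvPolynomial (Fin d) ℝ) : IntegrableOn (fun y => evalAt y p) (cell (B K) (x K) b) :=
  integrableOn_of_continuous (continuous_evalAt p) (isBounded_cell (h.pos K) b)

omit [Fintype ι] in
/-- The mean values of a piecewise polynomial function over the simplices. -/
theorem exists_mean (h : IsSplitMesh Ω B x) (F : ι → Fin (d + 1) → MvPolynomial (Fin d) ℝ) :
    ∃ a : ι → ℝ, ∀ K,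
      ∑ b, ∫ y in cell (B K) (x K) b, evalAt y (F K b - MvPolynomial.C (a K)) = 0 := by
  refine ⟨fun K => (∑ b, ∫ y in cell (B K) (x K) b, evalAt y (F K b)) /
    ∑ b, volume.real (cell (B K) (x K) b), fun K => ?_⟩
  have e : ∀ a : ℝ, ∑ b, ∫ y in cell (B K) (x K) b, evalAt y (F K b - MvPolynomial.C a) =
      (∑ b, ∫ y in cell (B K) (x K) b, evalAt y (F K b)) -
        (∑ b, volume.real (cell (B K) (x K) b)) * a := fun a => by
    rw [Finset.sum_mul, ← Finset.sum_sub_distrib]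
    refine Finset.sum_congr rfl fun b _ => ?_
    simp only [map_sub]
    rw [integral_sub (h.integrableOn_evalAt K b _) (h.integrableOn_evalAt K b _)]
    congr 1
    simp
  rw [e, mul_div_cancel₀ _ (h.sum_measureReal_pos K).ne', sub_self]

/-- The inversion of the divergence on functions whose means over all simplices vanish. -/
theorem exists_field (h : IsSplitMesh Ω B x) (hd : 1 ≤ d) {R : ℝ}
    (hR : diam (Ω : Set (Space d)) ≤ R) {n : ℕ} {C : ℝ} (hC : 0 ≤ C) {q : L2 Ω}
    {F : ι → Fin (d + 1) → MvPolynomial (Fin d) ℝ} (hF : IsPiecewise B x q F)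
    (hloc : ∀ K, ∃ (v : Fin d → Space d → ℝ) (P : Fin (d + 1) → Fin d → MvPolynomial (Fin d) ℝ),
      (∀ i, ∃ L, LipschitzWith L (v i)) ∧
      (∀ i y, (∃ b, (B K).coord b y ≤ 0) → v i y = 0) ∧
      (∀ b i, (P b i).totalDegree ≤ n + 1) ∧
      (∀ b i, ∀ y ∈ cell (B K) (x K) b, v i y = evalAt y (P b i)) ∧
      (∀ b, ∑ i, MvPolynomial.pderiv i (P b i) = F K b) ∧
      ∀ i j, ∑ b, ∫ y in cell (B K) (x K) b, evalAt y (MvPolynomial.pderiv j (P b i)) ^ 2 ≤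
        C * ∑ b, ∫ y in cell (B K) (x K) b, evalAt y (F K b) ^ 2) :
    ∃ v : L2Vec Ω, v ∈ H10Vec Ω ∧
      (∃ P : ι → Fin (d + 1) → Fin d → MvPolynomial (Fin d) ℝ,
        (∀ K b i, (P K b i).totalDegree ≤ n + 1) ∧
        ∀ i, IsPiecewise B x (v i) fun K b => P K b i) ∧
      divergence v = q ∧ h1Norm v ≤ √((4 * R ^ 2 + d) * d * C) * ‖q‖ := by
  choose u P hLip hzero hdeg hcell hdiv hbd using hloc
  have hΩ := h.isBounded
  -- Each local field vanishes outside the interior of its simplex, so the sum glues them: at most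
  -- one term is nonzero at any point.
  set f : Fin d → Space d → ℝ := fun i y => ∑ K, u K i y with hf
  have hfc : ∀ K b i, ∀ y ∈ cell (B K) (x K) b, f i y = evalAt y (P K b i) := by
    intro K b i y hy
    rw [hf]
    simp only
    rw [Finset.sum_eq_single K, hcell K b i y hy]
    · intro K' _ hK'
      refine hzero K' i y ?_
      by_contra hcon
      push Not at hcon
      exact h.disjoint K K' hK'.symm y hcon (cell_subset_simplexSet (h.pos K) b hy)
    · simp
  have hf0 : ∀ i, ∀ y ∉ (Ω : Set (Space d)), f i y = 0 := by
    intro i y hy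
    refine Finset.sum_eq_zero fun K _ => hzero K i y ?_
    by_contra hcon
    push Not at hcon
    exact hy (h.interior_subset K y hcon)
  have hLf : ∀ i, ∃ L, LipschitzWith L (f i) := fun i =>
    exists_lipschitzWith_sum Finset.univ fun K => hLip K i
  choose L hL using hLf
  have hcs : ∀ i, HasCompactSupport (f i) := fun i => hasCompactSupport_of_eq_zero_off hΩ (hf0 i)
  have hmem : ∀ i, MemLp (f i) 2 (volume.restrict (Ω : Set (Space d))) := fun i =>
    (memLp_two_of_lipschitz (hL i) (hcs i)).restrict _
  set v : L2Vec Ω := fun i => (hmem i).toLp with hv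
  have hvf : ∀ i, v i =ᵐ[volume.restrict (Ω : Set (Space d))] f i := fun i => (hmem i).coeFn_toLp
  have hwp : ∀ i j, weakPartial j (v i) =ᵐ[volume.restrict (Ω : Set (Space d))]
      fun y => lineDeriv ℝ (f i) y (EuclideanSpace.single j 1) := fun i j =>
    (weakPartial_ae_eq_lineDeriv (hL i) (hcs i) (hvf i) j).2
  have hpw : ∀ i j, IsPiecewise B x (weakPartial j (v i))
      fun K b => MvPolynomial.pderiv j (P K b i) := by
    intro i j K b
    filter_upwards [h.ae_iff.1 (hwp i j) K b, ae_cell_mem_openCell (h.pos K) b] with y h1 h2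
    rw [h1, lineDeriv_of_eqOn_cell (fun y hy => hfc K b i y hy) h2]
  have hsq : ∀ i j, ‖weakPartial j (v i)‖ ^ 2 ≤ C * ‖q‖ ^ 2 := by
    intro i j
    rw [h.norm_sq_of_isPiecewise (hpw i j), h.norm_sq_of_isPiecewise hF, Finset.mul_sum]
    exact Finset.sum_le_sum fun K _ => hbd K i j
  have hpoin : ∀ i, ‖v i‖ ^ 2 ≤ 4 * R ^ 2 * (C * ‖q‖ ^ 2) := by
    intro i
    -- One coordinate direction suffices for the Poincaré inequality.
    have h1 := integral_sq_le_of_lipschitz hΩ hR (hL i) (hf0 i) ⟨0, hd⟩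
    have h2 : ‖v i‖ ^ 2 = ∫ y, f i y ^ 2 := by
      rw [norm_sq_eq_integral, ← setIntegral_eq_integral_of_forall_compl_eq_zero
        (s := (Ω : Set (Space d))) (f := fun y => f i y ^ 2)
        fun y hy => by rw [hf0 i y hy]; norm_num]
      refine integral_congr_ae ?_
      filter_upwards [hvf i] with y hy
      rw [hy]
    have h3 : ‖weakPartial ⟨0, hd⟩ (v i)‖ ^ 2 =
        ∫ y, lineDeriv ℝ (f i) y (EuclideanSpace.single ⟨0, hd⟩ 1) ^ 2 := by
      rw [norm_sq_eq_integral, ← setIntegral_eq_integral_of_ae_compl_eq_zero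
        (s := (Ω : Set (Space d))) (μ := volume)
        (f := fun y => lineDeriv ℝ (f i) y (EuclideanSpace.single ⟨0, hd⟩ 1) ^ 2)]
      · refine integral_congr_ae ?_
        filter_upwards [hwp i ⟨0, hd⟩] with y hy
        rw [hy]
      -- Vanishing almost everywhere on the zero set covers the boundary of `Ω` without a claim
      -- about its measure.
      · filter_upwards [ae_lineDeriv_eq_zero_of_eq_zero (hL i)
          (EuclideanSpace.single ⟨0, hd⟩ 1)] with y hy hyΩ
        rw [hy (hf0 i y hyΩ)]; norm_num
    rw [h2]
    refine h1.trans ?_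
    rw [← h3]
    exact mul_le_mul_of_nonneg_left (hsq i _) (by positivity)
  refine ⟨v, fun i => mem_H10_of_lipschitz hΩ (hL i) (hf0 i) (hvf i), ⟨P, hdeg, fun i K b => ?_⟩,
    ?_, ?_⟩
  · filter_upwards [h.ae_iff.1 (hvf i) K b, ae_restrict_mem (isClosed_cell b).measurableSet]
      with y h1 h2
    rw [h1, hfc K b i y h2]
  · refine h.eq_of_isPiecewise (F := F) (fun K b => ?_) hF
    have h1 : ∀ᵐ y ∂(volume.restrict (Ω : Set (Space d))),
        divergence v y = ∑ i, weakPartial i (v i) y := by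
      filter_upwards [Lp.coeFn_finsetSum Finset.univ fun i => weakPartial i (v i)] with y hy
      rw [divergence, hy, Finset.sum_apply]
    have h2 : ∀ᵐ y ∂(volume.restrict (cell (B K) (x K) b)),
        ∀ i, weakPartial i (v i) y = evalAt y (MvPolynomial.pderiv i (P K b i)) :=
      ae_all_iff.2 fun i => hpw i i K b
    filter_upwards [h.ae_iff.1 h1 K b, h2] with y h3 h4
    rw [h3, ← hdiv K b, map_sum]
    exact Finset.sum_congr rfl fun i _ => h4 i
  · have hsum : ∑ i, (‖v i‖ ^ 2 + ∑ j, ‖weakPartial j (v i)‖ ^ 2) ≤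
        ((4 * R ^ 2 + d) * d * C) * ‖q‖ ^ 2 := by
      calc ∑ i, (‖v i‖ ^ 2 + ∑ j, ‖weakPartial j (v i)‖ ^ 2)
          ≤ ∑ _i : Fin d, (4 * R ^ 2 * (C * ‖q‖ ^ 2) + ∑ _j : Fin d, C * ‖q‖ ^ 2) :=
            Finset.sum_le_sum fun i _ => add_le_add (hpoin i) (Finset.sum_le_sum fun j _ => hsq i j)
        _ = _ := by
            simp only [Finset.sum_const, Finset.card_univ, Fintype.card_fin, nsmul_eq_mul]
            ring
    rw [h1Norm]
    refine (Real.sqrt_le_sqrt hsum).trans (le_of_eq ?_)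
    rw [Real.sqrt_mul (by positivity), Real.sqrt_sq (norm_nonneg _)]

end IsSplitMesh

namespace IsSplitMesh

variable {ι : Type*} [Fintype ι] {Ω : Opens (Space d)} {B : ι → SimplexBasis d} {x : ι → Space d}

/-- Orthogonal decomposition of a piecewise polynomial function into its means over the simplices
and a remainder. -/
theorem exists_orthogonal_decomposition (h : IsSplitMesh Ω B x) {q : L2 Ω}
    {F : ι → Fin (d + 1) → MvPolynomial (Fin d) ℝ} (hF : IsPiecewise B x q F) :
    ∃ (a : ι → ℝ) (w : L2 Ω), IsPiecewise B x w (fun K _ => MvPolynomial.C (a K)) ∧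
      (∀ K, ∑ b, ∫ y in cell (B K) (x K) b, evalAt y (F K b - MvPolynomial.C (a K)) = 0) ∧
      ∫ y in (Ω : Set (Space d)), w y = ∫ y in (Ω : Set (Space d)), q y ∧
      inner ℝ w (q - w) = 0 := by
  obtain ⟨a, ha⟩ := h.exists_mean F
  obtain ⟨w, hw⟩ := h.exists_isPiecewise_const a
  have : IsFiniteMeasure (volume.restrict (Ω : Set (Space d))) :=
    ⟨by simpa using h.volume_ne_top.lt_top⟩
  have hint : ∀ u : L2 Ω, Integrable u (volume.restrict (Ω : Set (Space d))) := fun u =>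
    (Lp.memLp u).integrable (by norm_num)
  have hsub := h.isPiecewise_sub hF hw
  refine ⟨a, w, hw, ha, ?_, ?_⟩
  · have h1 := h.setIntegral_of_isPiecewise (hint (q - w)) hsub
    rw [Finset.sum_eq_zero fun K _ => ha K, integral_congr_ae (Lp.coeFn_sub q w)] at h1
    simp only [Pi.sub_apply] at h1
    rw [integral_sub (hint q) (hint w)] at h1
    linarith
  -- On each simplex `w` is constant and `q - w` has mean zero.
  · rw [← integral_mul_eq_inner]
    have h1 := h.setIntegral_of_isPiecewise (w := fun y => w y * (q - w : L2 Ω) y)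
      ((Lp.memLp w).integrable_mul (Lp.memLp (q - w : L2 Ω)))
      (G := fun K b => MvPolynomial.C (a K) * (F K b - MvPolynomial.C (a K))) fun K b => by
        filter_upwards [hw K b, hsub K b] with y h2 h3
        rw [h2, h3, map_mul]
    rw [h1]
    refine Finset.sum_eq_zero fun K _ => ?_
    simp only [map_mul, MvPolynomial.eval_C, integral_const_mul]
    rw [← Finset.mul_sum, ha K, mul_zero]

end IsSplitMesh

/-! ### Inf-sup stability -/

theorem weakPartial_zero {Ω : Opens (Space d)} (i : Fin d) : weakPartial i (0 : L2 Ω) = 0 := by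
  have h0 : ∀ f : Space d → ℝ, ∫ x in (Ω : Set (Space d)), (0 : L2 Ω) x * f x = 0 := fun f => by
    refine integral_eq_zero_of_ae ?_
    filter_upwards [Lp.coeFn_zero ℝ 2 ((volume : Measure (Space d)).restrict (Ω : Set (Space d)))]
      with y hy
    rw [hy, Pi.zero_apply, zero_mul]
  refine weakPartial_eq_of_isWeakPartial fun φ => ?_
  rw [h0, h0, neg_zero]

theorem divergence_zero {Ω : Opens (Space d)} : divergence (0 : L2Vec Ω) = 0 :=
  Finset.sum_eq_zero fun i _ => weakPartial_zero i

theorem h1Norm_nonneg {Ω : Opens (Space d)} (v : L2Vec Ω) : 0 ≤ h1Norm v := Real.sqrt_nonneg _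

theorem norm_weakPartial_le_h1Norm {Ω : Opens (Space d)} (v : L2Vec Ω) (i j : Fin d) :
    ‖weakPartial j (v i)‖ ≤ h1Norm v := by
  refine Real.le_sqrt_of_sq_le ?_
  calc ‖weakPartial j (v i)‖ ^ 2 ≤ ∑ j, ‖weakPartial j (v i)‖ ^ 2 :=
        Finset.single_le_sum (f := fun j => ‖weakPartial j (v i)‖ ^ 2)
          (fun j _ => by positivity) (Finset.mem_univ j)
    _ ≤ ‖v i‖ ^ 2 + ∑ j, ‖weakPartial j (v i)‖ ^ 2 := le_add_of_nonneg_left (by positivity)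
    _ ≤ _ := Finset.single_le_sum (f := fun i => ‖v i‖ ^ 2 + ∑ j, ‖weakPartial j (v i)‖ ^ 2)
        (fun i _ => by positivity) (Finset.mem_univ i)

theorem norm_divergence_le {Ω : Opens (Space d)} (v : L2Vec Ω) :
    ‖divergence v‖ ≤ d * h1Norm v := by
  refine (norm_sum_le _ _).trans ?_
  refine (Finset.sum_le_sum fun i _ => norm_weakPartial_le_h1Norm v i i).trans ?_
  simp

theorem le_ratio_of_bound {Ω : Opens (Space d)} {q : L2 Ω} (hq : q ≠ 0) {v : L2Vec Ω}
    (hv : 0 < h1Norm v) {γ : ℝ} (h : γ * (h1Norm v * ‖q‖) ≤ inner ℝ q (divergence v)) :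
    γ ≤ (∫ x in (Ω : Set (Space d)), q x * divergence v x) / (h1Norm v * ‖q‖) := by
  rw [integral_mul_eq_inner]
  exact (le_div_iff₀ (mul_pos hv (norm_pos_iff.2 hq))).2 h

/-- A pair is inf-sup stable if each pressure splits orthogonally into a part from a stable pair
and a remainder that is the divergence of a velocity of controlled norm. -/
theorem InfSupStableWith.of_orthogonal_decomposition (hd : 1 ≤ d) {γ₀ C : ℝ} (hC : 0 < C)
    {Ω : Opens (Space d)} {V : Set (L2Vec Ω)} {M M₀ : Set (L2 Ω)} (h : InfSupStableWith γ₀ V M₀)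
    (hdec : ∀ q ∈ M, ∃ w ∈ M₀, ∃ v ∈ V, inner ℝ w (q - w) = 0 ∧ divergence v = q - w ∧
      h1Norm v ≤ C * ‖q - w‖) :
    InfSupStableWith (min (min (1 / 2) (γ₀ / (8 * d)) / C) (γ₀ / 8)) V M := by
  obtain ⟨hγ₀, h⟩ := h
  have hd' : (0 : ℝ) < d := by exact_mod_cast hd
  -- The threshold for `‖q - w‖ / ‖q‖`. Below it, `1 / 2` gives `‖w‖ ≥ ‖q‖ / 2`, and `γ₀ / (8 * d)`
  -- makes the contribution of `q - w` at most `γ₀ / 8`, the factor `d` coming from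
  -- `norm_divergence_le`.
  set η : ℝ := min (1 / 2) (γ₀ / (8 * d)) with hη
  have hη0 : 0 < η := by positivity
  have hη1 : η ≤ 1 / 2 := min_le_left _ _
  have hη2 : η * d ≤ γ₀ / 8 := by
    have : η ≤ γ₀ / (8 * d) := min_le_right _ _
    calc η * d ≤ γ₀ / (8 * d) * d := by gcongr
      _ = γ₀ / 8 := by field_simp
  refine ⟨by positivity, le_iInf₂ fun q hq => ?_⟩
  obtain ⟨hqM, hq0⟩ := hq
  have hq0 : q ≠ 0 := hq0
  obtain ⟨w, hw, v, hvV, horth, hdiv, hv⟩ := hdec q hqM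
  have hqn : 0 < ‖q‖ := norm_pos_iff.2 hq0
  rcases le_or_gt (η * ‖q‖) ‖q - w‖ with hcase | hcase
  · have hpn : 0 < ‖q - w‖ := (mul_pos hη0 hqn).trans_le hcase
    have hv0 : v ≠ 0 := by
      rintro rfl
      rw [divergence_zero] at hdiv
      rw [← hdiv, norm_zero] at hpn
      exact lt_irrefl _ hpn
    have hvn : 0 < h1Norm v := by
      have h1 := norm_divergence_le v
      rw [hdiv] at h1
      exact pos_of_mul_pos_right (hpn.trans_le h1) hd'.le
    refine le_iSup₂_of_le v ⟨hvV, hv0⟩ (EReal.coe_le_coe_iff.2 ?_)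
    refine (min_le_left _ _).trans (le_ratio_of_bound hq0 hvn ?_)
    -- Orthogonality removes the mean part, so the fluctuation is tested exactly.
    have e : inner ℝ q (divergence v) = ‖q - w‖ ^ 2 := by
      rw [hdiv, ← real_inner_self_eq_norm_sq, inner_sub_left q w (q - w), horth, sub_zero]
    rw [e]
    calc η / C * (h1Norm v * ‖q‖) ≤ η / C * (C * ‖q - w‖ * ‖q‖) := by gcongr
      _ = (η * ‖q‖) * ‖q - w‖ := by field_simp
      _ ≤ ‖q - w‖ * ‖q - w‖ := by gcongr
      _ = _ := by ring
  · have hwn : ‖q‖ / 2 ≤ ‖w‖ := by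
      have h1 : ‖q‖ ≤ ‖q - w‖ + ‖w‖ := by simpa using norm_add_le (q - w) w
      have h2 : η * ‖q‖ ≤ 1 / 2 * ‖q‖ := by gcongr
      linarith
    have hw0 : w ≠ 0 := norm_pos_iff.1 (by linarith)
    -- The supremum need not be attained, so a field reaching half of `γ₀` is taken. With `‖w‖ ≥ ‖q‖
    -- / 2` it yields `γ₀ / 4`, of which `γ₀ / 8` survives the perturbation by `q - w`.
    have h1 : ((γ₀ / 2 : ℝ) : EReal) < ⨆ v ∈ V \ {0},
        (((∫ x in (Ω : Set (Space d)), w x * divergence v x) / (h1Norm v * ‖w‖) : ℝ) : EReal) :=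
      (EReal.coe_lt_coe_iff.2 (by linarith)).trans_le (h.trans (iInf₂_le w ⟨hw, hw0⟩))
    obtain ⟨u, h2⟩ := lt_iSup_iff.1 h1
    obtain ⟨hu, h2⟩ := lt_iSup_iff.1 h2
    have h3 := EReal.coe_lt_coe_iff.1 h2
    rw [integral_mul_eq_inner] at h3
    have hun : 0 < h1Norm u := by
      refine (h1Norm_nonneg u).lt_of_ne fun h0 => ?_
      rw [← h0, zero_mul, div_zero] at h3
      linarith
    rw [lt_div_iff₀ (mul_pos hun (norm_pos_iff.2 hw0))] at h3
    refine le_iSup₂_of_le u hu (EReal.coe_le_coe_iff.2 ?_)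
    refine (min_le_right _ _).trans (le_ratio_of_bound hq0 hun ?_)
    have e : inner ℝ q (divergence u) =
        inner ℝ w (divergence u) + inner ℝ (q - w) (divergence u) := by
      rw [← inner_add_left, add_sub_cancel]
    have h4 : -(η * ‖q‖ * (d * h1Norm u)) ≤ inner ℝ (q - w) (divergence u) := by
      refine neg_le_of_abs_le ((abs_real_inner_le_norm _ _).trans ?_)
      exact mul_le_mul hcase.le (norm_divergence_le u) (norm_nonneg _) (by positivity)
    have h5 : γ₀ / 2 * (h1Norm u * (‖q‖ / 2)) ≤ γ₀ / 2 * (h1Norm u * ‖w‖) := by gcongr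
    have h6 : η * d * (h1Norm u * ‖q‖) ≤ γ₀ / 8 * (h1Norm u * ‖q‖) := by gcongr
    rw [e]
    linarith

theorem IsSplitMesh.isPolyOn_zero {ι : Type*} [Fintype ι] {Ω : Opens (Space d)}
    {B : ι → SimplexBasis d} {x : ι → Space d} (h : IsSplitMesh Ω B x) {w : L2 Ω} {a : ι → ℝ}
    (hw : IsPiecewise B x w fun K _ => MvPolynomial.C (a K)) {K : ι} {S : Finset (Space d)}
    (hS : Set.range (B K) = S) : IsPolyOn 0 S w := by
  refine ⟨MvPolynomial.C (a K), by simp, h.ae_iff.2 fun K' b' => ?_⟩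
  filter_upwards [hw K' b', ae_cell_mem_openCell (h.pos K') b'] with y h1 h2 hy
  rw [← hS, ← simplexSet_eq_convexHull] at hy
  have hK : K = K' := by
    by_contra hne
    exact h.disjoint K K' hne y (coord_pos_of_mem_openCell (h.pos K') h2) hy
  rw [h1, hK]

theorem IsSplitMesh.exists_isPiecewise_of_isPolyOn {ι : Type*} [Fintype ι] {Ω : Opens (Space d)}
    {B : ι → SimplexBasis d} {x : ι → Space d} (h : IsSplitMesh Ω B x)
    {S : ι → Fin (d + 1) → Finset (Space d)}
    (hS : ∀ K b, convexHull ℝ (S K b : Set (Space d)) = cell (B K) (x K) b) {n : ℕ} {w : L2 Ω}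
    (hw : ∀ K b, IsPolyOn n (S K b) w) :
    ∃ F : ι → Fin (d + 1) → MvPolynomial (Fin d) ℝ, (∀ K b, (F K b).totalDegree ≤ n) ∧
      IsPiecewise B x w F := by
  choose F hdeg hF using hw
  refine ⟨F, hdeg, fun K b => ?_⟩
  refine h.ae_cell_of_ae ?_
  filter_upwards [hF K b] with y hy
  rwa [← hS]

theorem IsPiecewise.isPolyOn {ι : Type*} {Ω : Opens (Space d)} {B : ι → SimplexBasis d}
    {x : ι → Space d} {n : ℕ} {w : L2 Ω} {P : ι → Fin (d + 1) → MvPolynomial (Fin d) ℝ}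
    (hw : IsPiecewise B x w P) {K : ι} {b : Fin (d + 1)} (hdeg : (P K b).totalDegree ≤ n)
    {S : Finset (Space d)} (hS : convexHull ℝ (S : Set (Space d)) = cell (B K) (x K) b) :
    IsPolyOn n S w := by
  refine ⟨P K b, hdeg, ae_restrict_of_ae ?_⟩
  rw [hS]
  exact (ae_restrict_iff' (isClosed_cell b).measurableSet).1 (hw K b)

end StokesFEM

end

/-! ### The stability theorem -/

open StokesFEM in
/-- For all `d, k ≥ 1`, `R`, `σ` and `γ₀ > 0` there is `γ > 0` such that on every polytope domain of
diameter at most `R`, for every triangulation whose refinement has shape regularity constant at most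
`σ`, stability with constant `γ₀` against the piecewise constants on the mesh implies stability with
constant `γ` against the piecewise `P_{k-1}` pressures on the refined mesh. -/
theorem proposition6p1 (d k : ℕ) (hd : 1 ≤ d) (hk : 1 ≤ k) (R σ γ₀ : ℝ) (hγ₀ : 0 < γ₀) :
    ∃ γ : ℝ, 0 < γ ∧
      ∀ (Ω : TopologicalSpace.Opens (Space d)),
        IsConnected (Ω : Set (Space d)) →
        Metric.diam (Ω : Set (Space d)) ≤ R →
      ∀ (T : Geometry.SimplicialComplex ℝ (Space d)), IsTriangulation T Ω →
      ∀ (xK : Finset (Space d) → Space d),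
        (∀ K ∈ T.facets, xK K ∈ interior (convexHull ℝ (K : Set (Space d)))) →
        (∀ K ∈ refinedCells T xK, shapeConst K ≤ σ) →
      ∀ (V : Submodule ℝ (L2Vec Ω)),
        (V : Set (L2Vec Ω)) ⊆ H10Vec Ω →
        velocitySpace Ω k (refinedCells T xK) ⊆ V →
        InfSupStableWith γ₀ (V : Set (L2Vec Ω)) (pressureSpace Ω 0 T.facets) →
        InfSupStableWith γ (V : Set (L2Vec Ω)) (pressureSpace Ω (k - 1) (refinedCells T xK)) := by
  classical
  obtain ⟨n, rfl⟩ : ∃ n, k = n + 1 := ⟨k - 1, by omega⟩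
  obtain ⟨C, hC, hlocal⟩ := exists_local_field d n hd σ
  -- The added `1` makes the constant strictly positive, as needed for division by it.
  set C' : ℝ := √((4 * R ^ 2 + d) * d * C) + 1 with hC'
  have hC'0 : 0 < C' := by positivity
  have hd' : (0 : ℝ) < d := by exact_mod_cast hd
  refine ⟨min (min (1 / 2) (γ₀ / (8 * d)) / C') (γ₀ / 8), by positivity, ?_⟩
  intro Ω _ hR T hT xK hxK hshape V _ hV hstab
  obtain ⟨B, hM, hB⟩ := hT.exists_isSplitMesh hxK
  have : Fintype T.facets :=
    (hT.finite.subset Geometry.SimplicialComplex.facets_subset).fintype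
  set S : T.facets → Fin (d + 1) → Finset (Space d) :=
    fun K b => insert (xK K) ((K : Finset (Space d)).erase (B K b)) with hSdef
  have hBK : ∀ (K : T.facets) (b : Fin (d + 1)), B K b ∈ (K : Finset (Space d)) := fun K b => by
    rw [← Finset.mem_coe, ← hB K]
    exact ⟨b, rfl⟩
  have hSmem : ∀ K b, S K b ∈ refinedCells T xK := fun K b => ⟨K, K.2, B K b, hBK K b, rfl⟩
  have hShull : ∀ K b, convexHull ℝ (S K b : Set (Space d)) = cell (B K) (xK K) b := fun K b => by
    rw [hSdef, cell_eq_convexHull (hM.pos K), coe_insert_erase_eq (hB K)]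
  refine hstab.of_orthogonal_decomposition hd hC'0 fun q hq => ?_
  obtain ⟨F, hFdeg, hF⟩ :=
    hM.exists_isPiecewise_of_isPolyOn hShull fun K b => hq.2 _ (hSmem K b)
  obtain ⟨a, w, hw, hmean, hint, horth⟩ := hM.exists_orthogonal_decomposition hF
  obtain ⟨v, hvH, ⟨P, hPdeg, hP⟩, hdiv, hnorm⟩ :=
    hM.exists_field hd hR hC (hM.isPiecewise_sub hF hw) fun K =>
      hlocal (B K) (xK K) (hM.pos K) (fun b => ⟨S K b, hShull K b, hshape _ (hSmem K b)⟩)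
        (fun b => F K b - MvPolynomial.C (a K))
        (fun b => (MvPolynomial.totalDegree_sub _ _).trans (by simpa using hFdeg K b)) (hmean K)
  -- Taking means preserves the total integral, so `w` is an admissible coarse pressure.
  refine ⟨w, ⟨hint.trans hq.1, fun K hK => hM.isPolyOn_zero hw (hB ⟨K, hK⟩)⟩, v,
    hV ⟨hvH, ?_⟩, horth, hdiv, hnorm.trans ?_⟩
  · rintro _ ⟨K, hK, c, hc, rfl⟩ i
    obtain ⟨b, rfl⟩ : c ∈ Set.range (B ⟨K, hK⟩) := by rw [hB]; exact hc
    exact (hP i).isPolyOn (K := ⟨K, hK⟩) (hPdeg _ _ _) (hShull ⟨K, hK⟩ b)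
  · exact mul_le_mul_of_nonneg_right (by linarith) (norm_nonneg _)
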